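/- **Setup.** Let $X$ be a compact Hausdorff space. Signed Radon measures on $X$ are identified with continuous linear forms on $C^0(X)$, and $\mathcal M$ denotes the set of Radon probability measures, with the weak topology. The *finest topology* of a real vector space is the one in which a set is open iff its trace on each finite dimensional subspace is open. Let $n\ge 1$ be an integer, and assume given: * a dense linear subspace $\mathcal D\subset C^0(X)$ containing the constants; * a partially ordered real vector space $\mathcal Z$ whose positive cone $\mathcal Z_+$ spans $\mathcal Z$ and is closed in the finest topology, and a linear map $dd^c:\mathcal D\to\mathcal Z$ vanishing on constants; * a nonzero symmetric $n$-linear map $(\theta_1,\dots,\theta_n)\mapsto\theta_1\wedge\dots\wedge\theta_n$ from $\mathcal Z^n$ to signed Radon measures on $X$, positive when all $\theta_i\ge0$, such that each bilinear form $(\varphi,\psi)\mapsto\int\varphi\,dd^c\psi\wedge\theta_1\wedge\dots\wedge\theta_{n-1}$ on $\mathcal D$ is symmetric, and is seminegative when all $\theta_i\ge0$. Let $\mathrm{Pos}(X)$ be the interior, in the finest topology of $\mathcal Z/dd^c\mathcal D$, of the image of $\mathcal Z_+$. For $\omega\in\mathcal Z_+$ with $[\omega]\in\mathrm{Pos}(X)$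 set: * $\mathcal D_\omega=\{\varphi\in\mathcal D:\omega+dd^c\varphi\ge0\}$, $V_\omega=\int\omega^n>0$, $\mu_\omega=V_\omega^{-1}\omega^n$, $\mathrm{MA}_\omega(\varphi)=V_\omega^{-1}(\omega+dd^c\varphi)^n$; * $E_\omega(\varphi)=\frac{1}{(n+1)V_\omega}\sum_{j=0}^n\int\varphi\,(\omega+dd^c\varphi)^j\wedge\omega^{n-j}$ for $\varphi\in\mathcal D$ (for $\theta\in\mathcal Z$, the same formula defines $E_{\omega+t\theta}(\varphi)$ for $|t|$ small), and $\nabla_\theta E_\omega(\varphi)=\frac{d}{dt}\big|_{t=0}E_{\omega+t\theta}(\varphi)$; * $J_\omega(\mu)=\sup_{\varphi\in\mathcal D_\omega}\{E_\omega(\varphi)-\int\varphi\,\mu\}\in[0,+\infty]$ for $\mu\in\mathcal M$, and $\mathcal M^1_\omega=\{\mu\in\mathcal M: J_\omega(\mu)<\infty\}$ with the strong topology, i.e. the coarsest refinement of the weak topology in which $J_\omega$ is continuous; * $T_\omega=\sup_{\varphi\in\mathcal D_\omega}\{\sup\varphi-\int\varphi\,\mu_\omega\}\in[0,+\infty]$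 and $J^+_\omega(\mu)=J_\omega(\mu)+T_\omega$. For $\theta\in\mathcal Z$, the *twisted energy* $J^\theta_\omega:\mathcal M^1_\omega\to\mathbb R$ is the unique strongly continuous functional with $J_\omega^\theta(\mathrm{MA}_\omega(\varphi))=\nabla_\theta E_\omega(\varphi)$ for all $\varphi\in\mathcal D_\omega$. The *submean value property* means that $T_\omega<\infty$ for some $\omega\in\mathcal Z_+$ with $[\omega]\in\mathrm{Pos}(X)$. The form $\omega$ has the *orthogonality property* if * for all $\varphi,\psi\in\mathcal D_\omega$ and $f\in\mathcal D$ with $\max\{\varphi,\psi\}<f$ there is $\tau\in\mathcal D_\omega$ with $\max\{\varphi,\psi\}\le\tau<f$, and * for all $f\in\mathcal D$ and $\varepsilon>0$ there is $\varphi_0\in\mathcal D_\omega$ with $\varphi_0<f$ such that $\int(f-\varphi)\,\mathrm{MA}_\omega(\varphi)\le\varepsilon$ for all $\varphi\in\mathcal D_\omega$ with $\varphi_0\le\varphi<f$. For $\omega,\omega'\in\mathcal Z_+$ and $\theta\in\mathcal Z$ put $\|\theta\|_\omega=\inf\{C\ge0:\pm\theta\le C\omega\}$ (so that $\theta$ is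 $\omega$-bounded iff $\|\theta\|_\omega<\infty$) and $d_T(\omega,\omega')=\inf\{\delta\ge0:e^{-\delta}\omega\le\omega'\le e^\delta\omega\}$. **Theorem.** For each $n\ge1$ there is a constant $C_n>0$, depending only on $n$, such that the following holds in every setup as above, with $\alpha:=2^{-n}$. Assume the submean value property, and let $\omega,\omega'\in\mathcal Z_+$ have $[\omega],[\omega']\in\mathrm{Pos}(X)$, the orthogonality property, and Thompson distance $\delta:=d_T(\omega,\omega')\le1$. Let $\theta,\theta'\in\mathcal Z$ be $\omega$-bounded. Then $T_\omega$ and $T_{\omega'}$ are finite, $\mathcal M^1_\omega=\mathcal M^1_{\omega'}=:\mathcal M^1$ as sets, the twisted energies $J_\omega^\theta$ and $J_{\omega'}^{\theta'}$ exist and are unique, and for all $\mu\in\mathcal M^1$ $$\left|J_\omega^\theta(\mu)-J_{\omega'}^{\theta'}(\mu)\right|\le C_n\left(\delta^\alpha\|\theta\|_\omega+\|\theta-\theta'\|_\omega\right)J^+_\omega(\mu)$$ and $$\left|J^+_\omega(\mu)-J^+_{\omega'}(\mu)\right|\le C_n\,\delta^\alpha J^+_{\omega'}(\mu).$$ -/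

import Mathlib

open scoped ENNReal NNReal Topology

noncomputable section

namespace Pluripotential

/-! ### Topological and order-theoretic preliminaries -/

/-- The finest vector space topology of a real vector space `V`, generated by its finite
dimensional subspaces: a subset is open (closed) iff its trace on each finite dimensional subspace
is. Finite dimensional subspaces are parametrised by linear maps `ℝᵏ → V`, which are quotient maps
onto their images, so `A` is open (closed) iff all the sets `L ⁻¹' A` are. -/
@[reducible] def finestTopology (V : Type*) [AddCommGroup V] [Module ℝ V] : TopologicalSpace V :=
  ⨆ (k : ℕ) (L : (Fin k → ℝ) →ₗ[ℝ] V), TopologicalSpace.coinduced L inferInstance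

/-- The space `C⁰(X)^∨` of signed Radon measures on a compact Hausdorff space `X`, i.e. the
topological dual of `C⁰(X)`, with its weak topology (pointwise convergence on `C⁰(X)`).
The integral `∫ f μ` is the value `μ f`. -/
abbrev SignedRadon (X : Type*) [TopologicalSpace X] [CompactSpace X] : Type _ :=
  WeakDual ℝ C(X, ℝ)

/-- The set `ℳ` of Radon probability measures on `X`. -/
def radonProb (X : Type*) [TopologicalSpace X] [CompactSpace X] : Set (SignedRadon X) :=
  {μ | (∀ f : C(X, ℝ), 0 ≤ f → 0 ≤ μ f) ∧ μ 1 = 1}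

section Forms

variable {Z : Type*} [AddCommGroup Z] [Module ℝ Z] [PartialOrder Z]

/-- `‖θ‖_ω = inf {C ≥ 0 | ± θ ≤ C ω} ∈ [0, +∞]`. -/
def formNorm (ω θ : Z) : ℝ≥0∞ :=
  ⨅ (C : ℝ≥0) (_ : θ ≤ (C : ℝ) • ω ∧ -θ ≤ (C : ℝ) • ω), (C : ℝ≥0∞)

/-- The form `θ` is `ω`-bounded. -/
def IsBoundedBy (ω θ : Z) : Prop := formNorm ω θ < ⊤

/-- The Thompson distance `inf {δ ≥ 0 | e^{-δ} ω ≤ ω' ≤ e^δ ω} ∈ [0, +∞]`. -/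
def thompsonDist (ω ω' : Z) : ℝ≥0∞ :=
  ⨅ (d : ℝ≥0) (_ : Real.exp (-(d : ℝ)) • ω ≤ ω' ∧ ω' ≤ Real.exp (d : ℝ) • ω), (d : ℝ≥0∞)

end Forms

/-! ### The synthetic setup -/

/-- The data of a synthetic pluripotential theory of dimension `n` on the compact Hausdorff space
`X`, with space of closed `(1,1)`-forms the partially ordered real vector space `Z`. -/
structure Setup (n : ℕ) (X : Type*) [TopologicalSpace X] [CompactSpace X] [T2Space X]
    (Z : Type*) [AddCommGroup Z] [Module ℝ Z] [PartialOrder Z] [IsOrderedAddMonoid Z]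
    [PosSMulMono ℝ Z] where
  /-- the test functions -/
  D : Submodule ℝ C(X, ℝ)
  dense_D : Dense (D : Set C(X, ℝ))
  const_mem : ∀ c : ℝ, ContinuousMap.const X c ∈ D
  /-- the partial order of `Z` is nice: the positive cone spans `Z` and is closed in the finest
  vector space topology -/
  span_pos : Submodule.span ℝ {θ : Z | 0 ≤ θ} = ⊤
  isClosed_pos : IsClosed[finestTopology Z] {θ : Z | 0 ≤ θ}
  /-- the operator `ddᶜ` -/
  ddc : D →ₗ[ℝ] Z
  ddc_const : ∀ c : ℝ, ddc ⟨ContinuousMap.const X c, const_mem c⟩ = 0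
  /-- the `n`-linear map `(θ₁, …, θₙ) ↦ θ₁ ∧ … ∧ θₙ` -/
  wedge : MultilinearMap ℝ (fun _ : Fin n => Z) (SignedRadon X)
  wedge_ne_zero : wedge ≠ 0
  wedge_symm : ∀ (σ : Equiv.Perm (Fin n)) (θ : Fin n → Z), wedge (fun i => θ (σ i)) = wedge θ
  wedge_pos : ∀ θ : Fin n → Z, (∀ i, 0 ≤ θ i) → ∀ f : C(X, ℝ), 0 ≤ f → 0 ≤ wedge θ f
  /-- symmetry of `(φ, ψ) ↦ ∫ φ ddᶜψ ∧ θ₁ ∧ … ∧ θₙ₋₁`; the form `ddᶜψ` is put in the slot `i`,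
  and the other `n - 1` slots are filled by the forms `θ j`, `j ≠ i` -/
  ibp : ∀ (θ : Fin n → Z) (i : Fin n) (φ ψ : D),
    wedge (Function.update θ i (ddc ψ)) (φ : C(X, ℝ)) =
      wedge (Function.update θ i (ddc φ)) (ψ : C(X, ℝ))
  /-- seminegativity of this bilinear form when the `θ j` are nonnegative -/
  seminegative : ∀ (θ : Fin n → Z) (i : Fin n), (∀ j, 0 ≤ θ j) → ∀ φ : D,
    wedge (Function.update θ i (ddc φ)) (φ : C(X, ℝ)) ≤ 0

namespace Setup

variable {n : ℕ} {X : Type*} [TopologicalSpace X] [CompactSpace X] [T2Space X]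
  {Z : Type*} [AddCommGroup Z] [Module ℝ Z] [PartialOrder Z] [IsOrderedAddMonoid Z]
  [PosSMulMono ℝ Z]

/-- The set `𝒟_θ` of `θ`-psh test functions. -/
def psh (S : Setup n X Z) (θ : Z) : Set S.D := {φ | 0 ≤ θ + S.ddc φ}

/-- The Bott--Chern cohomology space `𝒵 / ddᶜ𝒟`. -/
abbrev HBC (S : Setup n X Z) : Type _ := Z ⧸ LinearMap.range S.ddc

/-- The Bott--Chern class of a form. -/
def cls (S : Setup n X Z) (θ : Z) : S.HBC := Submodule.Quotient.mk θ

/-- The positive cone `Pos(X)`, i.e. the interior of the image of `𝒵₊` in the finest vector space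
topology of the Bott--Chern cohomology space. -/
def posCone (S : Setup n X Z) : Set S.HBC :=
  @interior _ (finestTopology S.HBC) (S.cls '' {θ : Z | 0 ≤ θ})

/-- The forms `ω ∈ 𝒵₊` with `[ω] ∈ Pos(X)`. -/
def IsPolarization (S : Setup n X Z) (ω : Z) : Prop := 0 ≤ ω ∧ S.cls ω ∈ S.posCone

/-- The energy pairing `(θ₀, φ₀) ⋯ (θₙ, φₙ)`, given by
`∑ᵢ ∫ φᵢ θ₀ ∧ ⋯ ∧ θᵢ₋₁ ∧ (θᵢ₊₁ + ddᶜφᵢ₊₁) ∧ ⋯ ∧ (θₙ + ddᶜφₙ)`. It is the unique symmetric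
`(n+1)`-linear map with `(0, φ₀)·(θ₁, φ₁) ⋯ (θₙ, φₙ) = ∫ φ₀ (θ₁ + ddᶜφ₁) ∧ ⋯ ∧ (θₙ + ddᶜφₙ)` and
`(θ₀, 0) ⋯ (θₙ, 0) = 0`. -/
def energyPairing (S : Setup n X Z) (p : Fin (n + 1) → Z × S.D) : ℝ :=
  ∑ i : Fin (n + 1),
    S.wedge (fun j : Fin n =>
      if j.castSucc < i then (p (i.succAbove j)).1
      else (p (i.succAbove j)).1 + S.ddc (p (i.succAbove j)).2) ((p i).2 : C(X, ℝ))

/-- The volume `V_ω = ∫ ωⁿ`. -/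
def vol (S : Setup n X Z) (ω : Z) : ℝ := S.wedge (fun _ => ω) 1

/-- The Monge--Ampère operator `MA_ω(φ) = V_ω⁻¹ (ω + ddᶜφ)ⁿ`. -/
def MA (S : Setup n X Z) (ω : Z) (φ : S.D) : SignedRadon X :=
  (S.vol ω)⁻¹ • S.wedge (fun _ => ω + S.ddc φ)

/-- The measure `μ_ω = V_ω⁻¹ ωⁿ`. -/
def refMeasure (S : Setup n X Z) (ω : Z) : SignedRadon X :=
  (S.vol ω)⁻¹ • S.wedge (fun _ => ω)

/-- The Monge--Ampère energy `E_ω(φ) = (ω, φ)ⁿ⁺¹ / ((n+1) V_ω)`. -/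
def energy (S : Setup n X Z) (ω : Z) (φ : S.D) : ℝ :=
  S.energyPairing (fun _ => (ω, φ)) / ((n + 1) * S.vol ω)

/-- `T_ω = sup {sup φ - ∫ φ μ_ω | φ ∈ 𝒟_ω} ∈ [0, +∞]`. -/
def submeanConst (S : Setup n X Z) (ω : Z) : EReal :=
  ⨆ φ : S.psh ω, (((⨆ x : X, (φ.1 : C(X, ℝ)) x) - S.refMeasure ω (φ.1 : C(X, ℝ)) : ℝ) : EReal)

/-- The submean value property. -/
def SubmeanProperty (S : Setup n X Z) : Prop :=
  ∃ ω : Z, S.IsPolarization ω ∧ S.submeanConst ω < ⊤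

/-- `𝒟_ω` admits maxima. -/
def AdmitsMaxima (S : Setup n X Z) (ω : Z) : Prop :=
  ∀ φ ∈ S.psh ω, ∀ ψ ∈ S.psh ω, ∀ f : S.D,
    (∀ x, max ((φ : C(X, ℝ)) x) ((ψ : C(X, ℝ)) x) < (f : C(X, ℝ)) x) →
    ∃ τ ∈ S.psh ω, ∀ x, max ((φ : C(X, ℝ)) x) ((ψ : C(X, ℝ)) x) ≤ (τ : C(X, ℝ)) x ∧
      (τ : C(X, ℝ)) x < (f : C(X, ℝ)) x

/-- The orthogonality property of `ω`: `𝒟_ω` admits maxima, and for all `f ∈ 𝒟` the integral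
`∫ (f - φ) MA_ω(φ)` tends to `0` along the directed set of all `φ ∈ 𝒟_ω` with `φ < f`. -/
def OrthogonalityProperty (S : Setup n X Z) (ω : Z) : Prop :=
  S.AdmitsMaxima ω ∧
  ∀ f : S.D, ∀ ε : ℝ, 0 < ε → ∃ φ₀ ∈ S.psh ω,
    (∀ x, (φ₀ : C(X, ℝ)) x < (f : C(X, ℝ)) x) ∧
    ∀ φ ∈ S.psh ω, (∀ x, (φ₀ : C(X, ℝ)) x ≤ (φ : C(X, ℝ)) x ∧
        (φ : C(X, ℝ)) x < (f : C(X, ℝ)) x) →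
      S.MA ω φ ((f : C(X, ℝ)) - (φ : C(X, ℝ))) ≤ ε

/-- The energy `J_ω(μ) = sup {E_ω(φ) - ∫ φ μ | φ ∈ 𝒟_ω} ∈ [0, +∞]` of a measure. -/
def measureEnergy (S : Setup n X Z) (ω : Z) (μ : SignedRadon X) : EReal :=
  ⨆ φ : S.psh ω, ((S.energy ω φ.1 - μ (φ.1 : C(X, ℝ)) : ℝ) : EReal)

/-- The space `ℳ¹_ω` of measures of finite energy. -/
def finiteEnergy (S : Setup n X Z) (ω : Z) : Set (SignedRadon X) :=
  {μ | μ ∈ radonProb X ∧ S.measureEnergy ω μ < ⊤}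

/-- The strong topology of `ℳ¹_ω`, i.e. the coarsest refinement of the weak topology in which
`J_ω` becomes continuous. -/
@[reducible] def strongTopology (S : Setup n X Z) (ω : Z) : TopologicalSpace (S.finiteEnergy ω) :=
  TopologicalSpace.induced (fun μ => (μ : SignedRadon X)) inferInstance ⊓
    TopologicalSpace.induced (fun μ => (S.measureEnergy ω μ).toReal) inferInstance

/-- `J⁺_ω(μ) = J_ω(μ) + T_ω`, as a real number (when both terms are finite). -/
def energyPlus (S : Setup n X Z) (ω : Z) (μ : SignedRadon X) : ℝ :=
  (S.measureEnergy ω μ).toReal + (S.submeanConst ω).toReal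

/-- The directional derivative `∇_θ E_ω(φ) = d/dt|_{t=0} E_{ω+tθ}(φ)`. -/
def nablaEnergy (S : Setup n X Z) (ω θ : Z) (φ : S.D) : ℝ :=
  deriv (fun t : ℝ => S.energy (ω + t • θ) φ) 0

/-- `F : ℳ¹_ω → ℝ` is strongly continuous, with `F(MA_ω(φ)) = ∇_θ E_ω(φ)` for all `φ ∈ 𝒟_ω`. -/
def IsTwistedEnergy (S : Setup n X Z) (ω θ : Z) (F : S.finiteEnergy ω → ℝ) : Prop :=
  Continuous[S.strongTopology ω, inferInstance] F ∧
  ∀ φ ∈ S.psh ω, ∀ μ : S.finiteEnergy ω, (μ : SignedRadon X) = S.MA ω φ →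
    F μ = S.nablaEnergy ω θ φ

open Classical in
/-- The `θ`-twisted energy `J_ω^θ : ℳ¹_ω → ℝ`, i.e. the unique functional satisfying
`IsTwistedEnergy` (with value `0` by convention if there is no such functional). -/
def twistedEnergy (S : Setup n X Z) (ω θ : Z) : S.finiteEnergy ω → ℝ :=
  if h : ∃ F : S.finiteEnergy ω → ℝ, S.IsTwistedEnergy ω θ F then h.choose else 0

end Setup

end Pluripotential

end

/-! Write n = p + 1. If χ nearly attains the supremum J_ω(μ), then MA_ω(χ) is close to μ, so
J^θ_ω(μ) has to be the limit of ∇_θE_ω(χ) along near maximizers χ. The heart of the proof is a rate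
for this limit, `abs_nablaEnergy_sub_le`: if φ and ψ compute J_ω(μ) up to r M, with M ≥ J⁺_ω(μ) and
±θ ≤ C ω, then ∇_θE_ω(φ) and ∇_θE_ω(ψ) differ by at most a dimensional constant times C r^α M.

Put u = φ - ψ. Uniform concavity of the energy (`q_le_E_mid`) makes the Dirichlet seminorm of u with
respect to the p-th power of the midpoint form at most O(r M). Cauchy–Schwarz then replaces the
factors of the midpoint form, one at a time, by a form dominating all functions involved
(`q_exchange`). Each exchange halves the exponent of r. After p exchanges and one last
Cauchy–Schwarz inequality the exponent is 2^{-(p+1)}, and ∫ u MA_ω(χ) agrees with E_ω(φ) - E_ω(ψ) up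
to O(r^α M) for every χ whose energy is O(M) (`abs_I_pow_sub_E_le`). The difference of the two
derivatives is a combination of integrals of u against mixed products of θ with the forms of φ and
ψ. These mixed measures need not be Monge–Ampère measures, but their energy is O(M)
(`E_add_I_mixed_le`), and orthogonality approximates any measure of finite energy by MA_ω of its
near maximizers (`exists_quadratic_bound`, `abs_MA_sub_le`). This gives `abs_mixed_sub_le`, and
summation gives the rate. Existence, strong continuity and uniqueness of the twisted energy follow
from the rate and from strong density of Monge–Ampère measures (`tendsto_MA`).

For two forms at Thompson distance less than d one has ω ≤ e^d ω' ≤ e^{2d} ω. A normalised near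
maximizer φ for ω with error d M / 2 gives the near maximizer e^{-d} φ for ω' with error O(d M)
(`exp_neg_smul_mem_nearMax`), and replacing ω by e^d ω' changes ∇E at φ by O(d M) only
(`abs_nablaEnergy_sub_exp_le`). Combining this with the rate for each form gives the first estimate,
with exponent α; the estimate for J⁺ is even Lipschitz in d.

All computations take place in the symmetric algebra of the space of forms, to which the wedge
product extends linearly, so that they reduce to polynomial identities together with positivity and
integration by parts (`Calculus`). -/

set_option linter.unusedSectionVars false

noncomputable section

namespace Pluripotential

section

/-! ### Complete homogeneous polynomials -/

section Homogeneous

variable {R : Type*} [CommRing R]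

/-- The complete homogeneous polynomial `∑ aⁱ bᵏ⁻ⁱ` in two variables. -/
def hom : ℕ → R → R → R
  | 0, _, _ => 1
  | k + 1, a, b => a * hom k a b + b ^ (k + 1)

/-- The complete homogeneous polynomial in three variables. -/
def hom3 : ℕ → R → R → R → R
  | 0, _, _, _ => 1
  | k + 1, a, b, c => a * hom3 k a b c + hom (k + 1) b c

lemma hom_eq_sum (k : ℕ) (a b : R) : hom k a b =
    ∑ i ∈ Finset.range (k + 1), a ^ i * b ^ (k - i) := by
  induction k with
  | zero => simp [hom]
  | succ k ih =>
    rw [hom, ih, Finset.sum_range_succ' _ (k + 1), Finset.mul_sum]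
    simp [pow_succ', mul_assoc]

lemma sub_mul_hom (k : ℕ) (a b : R) : (a - b) * hom k a b = a ^ (k + 1) - b ^ (k + 1) := by
  induction k with
  | zero => simp [hom]
  | succ k ih => rw [hom, mul_add, mul_left_comm, ih]; ring

lemma hom_succ' (k : ℕ) (a b : R) : hom (k + 1) a b = b * hom k a b + a ^ (k + 1) := by
  rw [hom]; linear_combination sub_mul_hom k a b

lemma hom_comm (k : ℕ) (a b : R) : hom k a b = hom k b a := by
  induction k with
  | zero => rfl
  | succ k ih => rw [hom, ih, ← hom_succ']

lemma hom_self (k : ℕ) (a : R) : hom k a a = (k + 1) * a ^ k := by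
  induction k with
  | zero => simp [hom]
  | succ k ih => rw [hom, ih]; push_cast; ring

/-- `hom` and `hom3` are divided differences of powers. Exact divisibility by c - b is what later
produces a factor ddᶜ(φ - ψ), to which integration by parts applies. -/
lemma hom_sub_hom (k : ℕ) (a b c : R) :
    hom (k + 1) a c - hom (k + 1) a b = (c - b) * hom3 k a b c := by
  induction k with
  | zero => simp [hom, hom3]
  | succ k ih =>
    have h (x : R) : hom (k + 2) a x = a * hom (k + 1) a x + x ^ (k + 2) := rfl
    rw [hom3, h, h]
    linear_combination a * ih - sub_mul_hom (k + 1) c b + (c - b) * hom_comm (k + 1) c b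

lemma hom_sub_hom' (k : ℕ) (a b c : R) :
    hom (k + 1) b c - hom (k + 1) b a = (c - a) * hom3 k a b c := by
  induction k with
  | zero => simp [hom, hom3]
  | succ k ih =>
    rw [hom3, hom_succ' (k + 1) b c, hom_succ' (k + 1) b a]; linear_combination a * ih

lemma hom_mul_mul (k : ℕ) (c a b : R) : hom k (c * a) (c * b) = c ^ k * hom k a b := by
  induction k with
  | zero => simp [hom]
  | succ k ih => rw [hom, ih, hom]; ring

variable [Preorder R] [IsOrderedAddMonoid R] [PosMulMono R] [ZeroLEOneClass R]

lemma hom_nonneg (k : ℕ) {a b : R} (ha : 0 ≤ a) (hb : 0 ≤ b) : 0 ≤ hom k a b := by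
  induction k with
  | zero => exact zero_le_one
  | succ k ih => exact add_nonneg (mul_nonneg ha ih) (pow_nonneg hb _)

lemma hom3_nonneg (k : ℕ) {a b c : R} (ha : 0 ≤ a) (hb : 0 ≤ b) (hc : 0 ≤ c) :
    0 ≤ hom3 k a b c := by
  induction k with
  | zero => exact zero_le_one
  | succ k ih => exact add_nonneg (mul_nonneg ha ih) (hom_nonneg _ hb hc)

lemma pow_le_hom (k : ℕ) {a b : R} (ha : 0 ≤ a) (hb : 0 ≤ b) : a ^ k ≤ hom k a b := by
  cases k with
  | zero => simp [hom]
  | succ k => rw [hom_succ']; exact le_add_of_nonneg_left (mul_nonneg hb (hom_nonneg _ ha hb))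

lemma pow_le_hom3 (k : ℕ) {a b c : R} (ha : 0 ≤ a) (hb : 0 ≤ b) (hc : 0 ≤ c) :
    a ^ k ≤ hom3 k a b c := by
  induction k with
  | zero => simp [hom3]
  | succ k ih =>
    rw [pow_succ', hom3]
    exact le_add_of_le_of_nonneg (mul_le_mul_of_nonneg_left ih ha) (hom_nonneg _ hb hc)

variable [MulPosMono R]

lemma hom_mono (k : ℕ) {a b a' b' : R} (ha : 0 ≤ a) (hb : 0 ≤ b) (haa : a ≤ a') (hbb : b ≤ b') :
    hom k a b ≤ hom k a' b' := by
  induction k with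
  | zero => exact le_rfl
  | succ k ih =>
    exact add_le_add (mul_le_mul haa ih (hom_nonneg _ ha hb) (ha.trans haa))
      (pow_le_pow_left₀ hb hbb _)

lemma hom_le (k : ℕ) {a b c : R} (ha : 0 ≤ a) (hb : 0 ≤ b) (hac : a ≤ c) (hbc : b ≤ c) :
    hom k a b ≤ (k + 1) * c ^ k :=
  (hom_mono k ha hb hac hbc).trans_eq (hom_self k c)

end Homogeneous

end

section

/-! ### Energy calculus -/

variable {X : Type*} [TopologicalSpace X]
  {R : Type*} [CommRing R] [Algebra ℝ R] [Preorder R]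

/-- A commutative algebra of forms, paired with functions by integration, and an operator `d`
satisfying integration by parts and seminegativity. -/
structure Calculus (D : Submodule ℝ C(X, ℝ)) (R : Type*) [CommRing R] [Algebra ℝ R]
    [Preorder R] where
  /-- the integral `∫ f P` -/
  I : R →ₗ[ℝ] C(X, ℝ) →ₗ[ℝ] ℝ
  /-- the operator `ddᶜ` -/
  d : D →ₗ[ℝ] R
  pos : ∀ P, 0 ≤ P → ∀ f, 0 ≤ f → 0 ≤ I P f
  symm : ∀ (P : R) (φ ψ : D), I (d ψ * P) φ = I (d φ * P) ψ
  semineg : ∀ P, 0 ≤ P → ∀ φ : D, I (d φ * P) φ ≤ 0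
  one_mem : 1 ∈ D
  d_one : d ⟨1, one_mem⟩ = 0

namespace Calculus

variable {D : Submodule ℝ C(X, ℝ)} (K : Calculus D R)

/-- Rescaling of the integral by a nonnegative number. -/
@[simps]
def scale (c : ℝ) (hc : 0 ≤ c) : Calculus D R where
  I := c • K.I
  d := K.d
  pos P hP f hf := mul_nonneg hc (K.pos P hP f hf)
  symm P φ ψ := by simp [K.symm P φ ψ]
  semineg P hP φ := mul_nonpos_of_nonneg_of_nonpos hc (K.semineg P hP φ)
  one_mem := K.one_mem
  d_one := K.d_one

/-- The Dirichlet seminorm `-∫ u du ∧ P`. -/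
def q (u : D) (P : R) : ℝ := -K.I (K.d u * P) u

/-- The energy of `φ` with respect to `w`, in dimension `p + 1`. -/
def E (p : ℕ) (w : R) (φ : D) : ℝ :=
  ((p : ℝ) + 2)⁻¹ * K.I (hom (p + 1) (w + K.d φ) w) φ

@[simp] lemma E_zero (p : ℕ) (w : R) : K.E p w 0 = 0 := by simp [E]

lemma I_mul_d_one (P : R) (u : D) : K.I (K.d u * P) 1 = 0 := by
  have := K.symm P ⟨1, K.one_mem⟩ u
  rw [K.d_one] at this
  simpa using this

lemma q_nonneg {P : R} (hP : 0 ≤ P) (u : D) : 0 ≤ K.q u P :=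
  neg_nonneg.2 (K.semineg P hP u)

lemma q_add (u : D) (P Q : R) : K.q u (P + Q) = K.q u P + K.q u Q := by
  simp [q, mul_add]; ring

lemma q_sub (u : D) (P Q : R) : K.q u (P - Q) = K.q u P - K.q u Q := by
  simp [q, mul_sub]; ring

lemma q_smul (u : D) (c : ℝ) (P : R) : K.q u (c • P) = c * K.q u P := by
  simp [q]

/-- The Cauchy–Schwarz inequality. -/
lemma sq_le_q_mul_q {P : R} (hP : 0 ≤ P) (u v : D) :
    K.I (K.d u * P) v ^ 2 ≤ K.q u P * K.q v P := by
  let b : LinearMap.BilinForm ℝ D := LinearMap.mk₂ ℝ (fun u v : D => -K.I (K.d u * P) v)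
    (by intros; simp [add_mul]; ring) (by intros; simp)
    (by intros; simp; ring) (by intros; simp)
  have h := LinearMap.BilinForm.apply_sq_le_of_symm b (fun x => K.q_nonneg hP x)
    ⟨fun x y => by simp [b, K.symm P x y]⟩ u v
  simpa [b, q] using h

lemma q_sub_left_le {P : R} (hP : 0 ≤ P) (u v : D) :
    K.q (u - v) P ≤ 2 * (K.q u P + K.q v P) := by
  have h := K.q_nonneg hP (u + v)
  have e : K.q (u + v) P + K.q (u - v) P = 2 * (K.q u P + K.q v P) := by
    simp [q, add_mul, sub_mul]; ring
  linarith

/-- Replacing w by the form of the other function inside `hom` creates one error term for φ and one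
for ψ; they are exchanged by integration by parts, hence cancel. This is the path independence of
energies. -/
lemma cocycle (k : ℕ) (P w : R) (φ ψ : D) :
    K.I (P * hom k (w + K.d φ) w) φ - K.I (P * hom k (w + K.d ψ) w) ψ =
      K.I (P * hom k (w + K.d φ) (w + K.d ψ)) ((φ - ψ : D) : C(X, ℝ)) := by
  cases k with
  | zero => simp [hom]
  | succ k =>
    set g := hom3 k (w + K.d φ) (w + K.d ψ) w
    have h1 : P * hom (k + 1) (w + K.d φ) w =
        P * hom (k + 1) (w + K.d φ) (w + K.d ψ) - K.d ψ * (P * g) := by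
      linear_combination P * hom_sub_hom k (w + K.d φ) (w + K.d ψ) w
    have h2 : P * hom (k + 1) (w + K.d ψ) w =
        P * hom (k + 1) (w + K.d φ) (w + K.d ψ) - K.d φ * (P * g) := by
      rw [hom_comm _ (w + K.d φ)]
      linear_combination P * hom_sub_hom' k (w + K.d φ) (w + K.d ψ) w
    have h3 := K.symm (P * g) φ ψ
    rw [h1, h2]
    simp only [map_sub, LinearMap.sub_apply, Submodule.coe_sub]
    linear_combination -h3

lemma E_sub (p : ℕ) (w : R) (φ ψ : D) : K.E p w φ - K.E p w ψ =
    ((p : ℝ) + 2)⁻¹ * K.I (hom (p + 1) (w + K.d φ) (w + K.d ψ)) ((φ - ψ : D) : C(X, ℝ)) := by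
  have := K.cocycle (p + 1) 1 w φ ψ
  simp only [one_mul] at this
  rw [E, E, ← mul_sub, this]

variable [IsOrderedAddMonoid R] [PosMulMono R] [MulPosMono R] [ZeroLEOneClass R] [PosSMulMono ℝ R]

lemma I_mono {P Q : R} (h : P ≤ Q) {f : C(X, ℝ)} (hf : 0 ≤ f) : K.I P f ≤ K.I Q f := by
  have := K.pos (Q - P) (sub_nonneg.2 h) f hf
  simpa using this

lemma I_mono_right {P : R} (h : 0 ≤ P) {f g : C(X, ℝ)} (hf : f ≤ g) : K.I P f ≤ K.I P g := by
  have := K.pos P h (g - f) (sub_nonneg.2 hf)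
  simpa using this

lemma q_mono {P Q : R} (h : P ≤ Q) (u : D) : K.q u P ≤ K.q u Q := by
  have := K.q_nonneg (sub_nonneg.2 h) u
  rw [q_sub] at this; linarith

lemma natCast_add_one_mul (k : ℕ) (P : R) : ((k : R) + 1) * P = ((k : ℝ) + 1) • P := by
  rw [Algebra.smul_def]; simp

/-- The tangent inequality expressing concavity of the energy. -/
lemma E_le_tangent (p : ℕ) {w : R} {φ ψ : D} (hφ : 0 ≤ w + K.d φ) (hψ : 0 ≤ w + K.d ψ) :
    K.E p w φ ≤ K.E p w ψ +
      K.I ((w + K.d ψ) ^ (p + 1)) ((φ - ψ : D) : C(X, ℝ)) := by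
  set a := w + K.d φ with ha
  set b := w + K.d ψ with hb
  -- The deviation of the energy from its tangent at ψ is a multiple of ∫ u du ∧ P with u = φ - ψ
  -- and P ≥ 0, so seminegativity gives concavity.
  have h1 : hom (p + 1) a b - ((p : ℝ) + 2) • b ^ (p + 1) = K.d (φ - ψ) * hom3 p b b a := by
    have e := hom_sub_hom p b b a
    have : ((p : ℝ) + 2) • b ^ (p + 1) = hom (p + 1) b b := by
      rw [hom_self, natCast_add_one_mul]; push_cast; congr 1; ring
    rw [this, hom_comm _ a b, e, map_sub, ha, hb]; ring
  have h2 := K.semineg _ (hom3_nonneg p hψ hψ hφ) (φ - ψ)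
  rw [← h1, map_sub, map_smul, LinearMap.sub_apply, LinearMap.smul_apply, smul_eq_mul] at h2
  have h3 := K.E_sub p w φ ψ
  have hp : (0 : ℝ) < (p : ℝ) + 2 := by positivity
  rw [← ha, ← hb] at h3
  have : K.E p w φ - K.E p w ψ ≤ K.I (b ^ (p + 1)) ((φ - ψ : D) : C(X, ℝ)) := by
    rw [h3, inv_mul_le_iff₀ hp]; linarith
  linarith

/-- Uniform concavity of the energy. -/
lemma q_le_E_mid (p : ℕ) {w : R} {φ ψ : D} (hφ : 0 ≤ w + K.d φ) (hψ : 0 ≤ w + K.d ψ) :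
    K.q (φ - ψ) ((w + K.d ((1 / 2 : ℝ) • (φ + ψ))) ^ p) ≤
      2 * ((p : ℝ) + 2) * (2 * K.E p w ((1 / 2 : ℝ) • (φ + ψ)) - K.E p w φ - K.E p w ψ) := by
  set m : D := (1 / 2 : ℝ) • (φ + ψ) with hm
  have hc : 0 ≤ w + K.d m := by
    have : w + K.d m = (1 / 2 : ℝ) • (w + K.d φ) + (1 / 2 : ℝ) • (w + K.d ψ) := by
      rw [hm, map_smul, map_add]; module
    rw [this]
    exact add_nonneg (smul_nonneg (by norm_num) hφ) (smul_nonneg (by norm_num) hψ)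
  refine (K.q_mono (pow_le_hom3 p hc hφ hψ) _).trans ?_
  have h1 := K.E_sub p w m φ
  have h2 := K.E_sub p w m ψ
  have e1 : m - φ = (-1 / 2 : ℝ) • (φ - ψ) := by rw [hm]; module
  have e2 : m - ψ = (1 / 2 : ℝ) • (φ - ψ) := by rw [hm]; module
  rw [e1, Submodule.coe_smul, map_smul, smul_eq_mul] at h1
  rw [e2, Submodule.coe_smul, map_smul, smul_eq_mul] at h2
  -- The second difference of the energy at the midpoint is exactly a Dirichlet seminorm of φ - ψ;
  -- its weight `hom3` dominates the p-th power of the midpoint form.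
  have h3 : K.q (φ - ψ) (hom3 p (w + K.d m) (w + K.d φ) (w + K.d ψ)) =
      K.I (hom (p + 1) (w + K.d m) (w + K.d ψ)) ((φ - ψ : D) : C(X, ℝ)) -
      K.I (hom (p + 1) (w + K.d m) (w + K.d φ)) ((φ - ψ : D) : C(X, ℝ)) := by
    rw [← LinearMap.sub_apply, ← map_sub, hom_sub_hom, q, ← LinearMap.neg_apply, ← map_neg,
      ← neg_mul]
    congr 3; rw [map_sub]; ring
  have hp : (0 : ℝ) < (p : ℝ) + 2 := by positivity
  have : 2 * K.E p w m - K.E p w φ - K.E p w ψ = (K.E p w m - K.E p w φ) +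
    (K.E p w m - K.E p w ψ) := by ring
  rw [this, h1, h2, h3]
  apply le_of_eq
  field_simp
  ring

lemma E_nonpos (p : ℕ) {w : R} (hw : 0 ≤ w) {φ : D} (hφ : 0 ≤ w + K.d φ) (h0 : (φ : C(X, ℝ)) ≤ 0) :
    K.E p w φ ≤ 0 := by
  have := K.I_mono_right (hom_nonneg (p + 1) hφ hw) h0
  rw [map_zero] at this
  exact mul_nonpos_of_nonneg_of_nonpos (by positivity) this

lemma I_pow_neg_le (p : ℕ) {w : R} (hw : 0 ≤ w) {φ : D} (hφ : 0 ≤ w + K.d φ)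
    (h0 : (φ : C(X, ℝ)) ≤ 0) :
    K.I ((w + K.d φ) ^ (p + 1)) (-(φ : C(X, ℝ))) ≤ ((p : ℝ) + 2) * -K.E p w φ := by
  have h := K.I_mono (pow_le_hom (p + 1) hφ hw) (neg_nonneg.2 h0)
  refine h.trans_eq ?_
  rw [E, map_neg]
  field_simp

lemma neg_E_le (p : ℕ) {w : R} (hw : 0 ≤ w) {φ : D} (hφ : 0 ≤ w + K.d φ) :
    -K.E p w φ ≤ K.I ((w + K.d φ) ^ (p + 1)) (-(φ : C(X, ℝ))) := by
  have := K.E_le_tangent p (φ := 0) (ψ := φ) (by simpa using hw) hφ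
  simp only [E_zero, zero_sub, Submodule.coe_neg] at this
  linarith

/-- The difference of the two sides is ∫ (-φ) w P ≥ 0. Dirichlet seminorms of nonpositive functions
are thereby controlled by energies. -/
lemma q_le_I_neg {w : R} (hw : 0 ≤ w) {φ : D} (h0 : (φ : C(X, ℝ)) ≤ 0) {P : R} (hP : 0 ≤ P) :
    K.q φ P ≤ K.I ((w + K.d φ) * P) (-(φ : C(X, ℝ))) := by
  have := K.pos (w * P) (mul_nonneg hw hP) _ (neg_nonneg.2 h0)
  rw [add_mul, map_add, LinearMap.add_apply, q, map_neg (K.I (K.d φ * P))]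
  linarith

end Calculus

end

/-! ### Domination and the Hölder estimate for Dirichlet seminorms -/

section

namespace Calculus

variable {X : Type*} [TopologicalSpace X]
  {R : Type*} [CommRing R] [Algebra ℝ R] [Preorder R]
  {D : Submodule ℝ C(X, ℝ)} (K : Calculus D R)
variable [IsOrderedAddMonoid R] [PosMulMono R] [MulPosMono R] [ZeroLEOneClass R] [PosSMulMono ℝ R]

/-- The function `φ` and the form `w + dφ` are dominated by `4 m` and `4 (w + dm)`. -/
structure Dom (w : R) (m φ : D) : Prop where
  nonneg : 0 ≤ w + K.d φ
  le : w + K.d φ ≤ (4 : ℝ) • (w + K.d m)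
  nonpos : (φ : C(X, ℝ)) ≤ 0
  ge : (4 : ℝ) • (m : C(X, ℝ)) ≤ φ

variable {K}

lemma Dom.mid {w : R} {m φ ψ : D} (h : K.Dom w m φ) (h' : K.Dom w m ψ) :
    K.Dom w m ((1 / 2 : ℝ) • (φ + ψ)) := by
  have e : w + K.d ((1 / 2 : ℝ) • (φ + ψ)) =
      (1 / 2 : ℝ) • (w + K.d φ) + (1 / 2 : ℝ) • (w + K.d ψ) := by
    rw [map_smul, map_add]; module
  refine ⟨?_, ?_, ?_, ?_⟩
  · rw [e]
    exact add_nonneg (smul_nonneg (by norm_num) h.nonneg) (smul_nonneg (by norm_num) h'.nonneg)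
  · rw [e]
    calc _ ≤ (1 / 2 : ℝ) • (4 : ℝ) • (w + K.d m) + (1 / 2 : ℝ) • (4 : ℝ) • (w + K.d m) :=
          add_le_add (smul_le_smul_of_nonneg_left h.le (by norm_num))
            (smul_le_smul_of_nonneg_left h'.le (by norm_num))
      _ = _ := by module
  · intro x
    have h1 := h.nonpos x
    have h2 := h'.nonpos x
    simp at h1 h2 ⊢; linarith
  · intro x
    have h1 := h.ge x
    have h2 := h'.ge x
    simp at h1 h2 ⊢; linarith

lemma nonneg_of_smul {P : R} (h : 0 ≤ (4 : ℝ) • P) : 0 ≤ P := by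
  have := smul_nonneg (a := (1 / 4 : ℝ)) (by norm_num) h
  rwa [smul_smul, show (1 / 4 : ℝ) * 4 = 1 by norm_num, one_smul] at this

lemma Dom.nonneg_bound {w : R} {m φ : D} (h : K.Dom w m φ) : 0 ≤ w + K.d m :=
  nonneg_of_smul (h.nonneg.trans h.le)

lemma Dom.bound_nonpos {w : R} {m φ : D} (h : K.Dom w m φ) : (m : C(X, ℝ)) ≤ 0 := by
  intro x
  have h1 := h.ge x
  have h2 := h.nonpos x
  simp at h1 h2 ⊢; linarith

lemma le_four_smul {P : R} (h : 0 ≤ P) : P ≤ (4 : ℝ) • P := by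
  have : 0 ≤ (3 : ℝ) • P := smul_nonneg (by norm_num) h
  calc P ≤ P + (3 : ℝ) • P := le_add_of_nonneg_right this
    _ = _ := by module

lemma Dom.I_le {w : R} {m φ : D} (h : K.Dom w m φ) {P : R} {c : ℝ} {k : ℕ}
    (hP : 0 ≤ P) (hPm : P ≤ c • (w + K.d m) ^ k) :
    K.I P (-(φ : C(X, ℝ))) ≤ 4 * c * K.I ((w + K.d m) ^ k) (-(m : C(X, ℝ))) := by
  have h1 : -(φ : C(X, ℝ)) ≤ (4 : ℝ) • -(m : C(X, ℝ)) := by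
    rw [smul_neg]; exact neg_le_neg h.ge
  calc _ ≤ K.I P ((4 : ℝ) • -(m : C(X, ℝ))) := K.I_mono_right hP h1
    _ = 4 * K.I P (-(m : C(X, ℝ))) := by simp
    _ ≤ 4 * K.I (c • (w + K.d m) ^ k) (-(m : C(X, ℝ))) := by
        gcongr; exact K.I_mono hPm (neg_nonneg.2 h.bound_nonpos)
    _ = _ := by simp; ring

lemma Dom.q_le {w : R} (hw : 0 ≤ w) {m φ : D} (h : K.Dom w m φ) (p : ℕ) :
    K.q φ ((w + K.d m) ^ p) ≤ 16 * K.I ((w + K.d m) ^ (p + 1)) (-(m : C(X, ℝ))) := by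
  have h0 := h.nonneg_bound
  refine (K.q_le_I_neg hw h.nonpos (pow_nonneg h0 p)).trans ?_
  refine (h.I_le (c := 4) (k := p + 1) (mul_nonneg h.nonneg (pow_nonneg h0 p)) ?_).trans_eq
    (by ring)
  rw [pow_succ', ← smul_mul_assoc]
  exact mul_le_mul_of_nonneg_right h.le (pow_nonneg h0 p)

lemma Dom.q_sub_le {w : R} (hw : 0 ≤ w) {m φ ψ : D} (h : K.Dom w m φ) (h' : K.Dom w m ψ) (p : ℕ) :
    K.q (φ - ψ) ((w + K.d m) ^ p) ≤ 64 * K.I ((w + K.d m) ^ (p + 1)) (-(m : C(X, ℝ))) := by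
  have h1 := K.q_sub_left_le (pow_nonneg h.nonneg_bound p) φ ψ
  have h2 := h.q_le hw p
  have h3 := h'.q_le hw p
  linarith

/-- One step of the Hölder estimate: exchanging one factor of a mixed Dirichlet seminorm. -/
lemma q_exchange {w : R} (hw : 0 ≤ w) {m φ ψ : D} (h : K.Dom w m φ) (h' : K.Dom w m ψ)
    (hm : K.Dom w m m) (i j : ℕ) :
    K.q (φ - ψ) ((w + K.d ((1 / 2 : ℝ) • (φ + ψ))) ^ i * (w + K.d m) ^ (j + 1)) ^ 2 ≤
      15 * (4 ^ (i + j + 1) * (64 * K.I ((w + K.d m) ^ (i + j + 2)) (-(m : C(X, ℝ))))) *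
      K.q (φ - ψ) ((w + K.d ((1 / 2 : ℝ) • (φ + ψ))) ^ (i + 1) * (w + K.d m) ^ j) := by
  have hη := h.mid h'
  set e : D := (1 / 2 : ℝ) • (φ + ψ) with he
  set u := φ - ψ with hu
  set P := (w + K.d e) ^ i * (w + K.d m) ^ j with hP
  set S := K.I ((w + K.d m) ^ (i + j + 2)) (-(m : C(X, ℝ)))
  have hP0 : 0 ≤ P := mul_nonneg (pow_nonneg hη.nonneg _) (pow_nonneg hm.nonneg _)
  have hPle : P ≤ ((4 : ℝ) • (w + K.d m)) ^ (i + j) := by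
    rw [pow_add]
    exact mul_le_mul (pow_le_pow_left₀ hη.nonneg hη.le _) (pow_le_pow_left₀ hm.nonneg hm.le _)
      (pow_nonneg hm.nonneg _) (pow_nonneg (hm.nonneg.trans hm.le) _)
  have hle {x : D} (hx : K.Dom w m x) :
      (w + K.d x) * P ≤ (4 : ℝ) ^ (i + j + 1) • (w + K.d m) ^ (i + j + 1) := by
    rw [← smul_pow, pow_succ' _ (i + j)]
    exact mul_le_mul hx.le hPle hP0 (hm.nonneg.trans hm.le)
  have hqx {x : D} (hx : K.Dom w m x) {v : D}
      (hv : K.q v ((w + K.d m) ^ (i + j + 1)) ≤ 64 * S) :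
      K.q v ((w + K.d x) * P) ≤ 4 ^ (i + j + 1) * (64 * S) := by
    refine (K.q_mono (hle hx) v).trans ?_
    rw [q_smul]; gcongr
  have hu1 := h.q_sub_le hw h' (i + j + 1)
  have hv1 := hm.q_sub_le hw hη (i + j + 1)
  set A := K.q u ((w + K.d e) ^ (i + 1) * (w + K.d m) ^ j)
  have hA : A = K.q u ((w + K.d e) * P) := by rw [hP, ← mul_assoc, ← pow_succ']
  have hA0 : 0 ≤ A := by rw [hA]; exact K.q_nonneg (mul_nonneg hη.nonneg hP0) u
  have hAle : A ≤ 4 ^ (i + j + 1) * (64 * S) := by rw [hA]; exact hqx hη hu1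
  -- This is the reason for using the midpoint form: the seminorms of u weighted by the forms of φ
  -- and of ψ are each at most 2 A.
  have hab : (w + K.d φ) * P + (w + K.d ψ) * P = (2 : ℝ) • ((w + K.d e) * P) := by
    rw [he, map_smul, map_add, ← smul_mul_assoc, ← add_mul]; congr 1; module
  have hqa : K.q u ((w + K.d φ) * P) + K.q u ((w + K.d ψ) * P) = 2 * A := by
    rw [← q_add, hab, q_smul, hA]
  have hqa0 := K.q_nonneg (mul_nonneg h.nonneg hP0) u
  have hqb0 := K.q_nonneg (mul_nonneg h'.nonneg hP0) u
  -- Exchanging one factor costs -∫ u du ∧ d(m - e) ∧ P. Moving d from m - e to u leaves du ∧ du,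
  -- where one du is written as the difference of the positive forms of φ and ψ, so that
  -- Cauchy–Schwarz applies to each term.
  have key : K.q u ((w + K.d e) ^ i * (w + K.d m) ^ (j + 1)) - A =
      K.I (K.d u * ((w + K.d ψ) * P)) ((m - e : D) : C(X, ℝ)) -
      K.I (K.d u * ((w + K.d φ) * P)) ((m - e : D) : C(X, ℝ)) := by
    have h1 := K.symm (K.d u * P) u (m - e)
    have e1 : (w + K.d e) ^ i * (w + K.d m) ^ (j + 1) - (w + K.d e) * P = K.d (m - e) * P := by
      rw [hP, map_sub]; ring
    have e2 : K.d u * (K.d (m - e) * P) = K.d (m - e) * (K.d u * P) := by ring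
    have e3 : K.d u * (K.d u * P) = K.d u * ((w + K.d φ) * P) - K.d u * ((w + K.d ψ) * P) := by
      rw [hu, map_sub]; ring
    rw [hA, ← q_sub, e1, q, e2, h1, e3, map_sub, LinearMap.sub_apply, neg_sub]
  have hs := K.sq_le_q_mul_q (mul_nonneg h.nonneg hP0) u (m - e)
  have ht := K.sq_le_q_mul_q (mul_nonneg h'.nonneg hP0) u (m - e)
  set s := K.I (K.d u * ((w + K.d φ) * P)) ((m - e : D) : C(X, ℝ))
  set t := K.I (K.d u * ((w + K.d ψ) * P)) ((m - e : D) : C(X, ℝ))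
  have hvφ := hqx h hv1
  have hvψ := hqx h' hv1
  set B := 4 ^ (i + j + 1) * (64 * S)
  have hs' : s ^ 2 ≤ 2 * A * B := hs.trans (mul_le_mul (by linarith) hvφ
    (K.q_nonneg (mul_nonneg h.nonneg hP0) _) (by linarith))
  have ht' : t ^ 2 ≤ 2 * A * B := ht.trans (mul_le_mul (by linarith) hvψ
    (K.q_nonneg (mul_nonneg h'.nonneg hP0) _) (by linarith))
  have hY : K.q u ((w + K.d e) ^ i * (w + K.d m) ^ (j + 1)) = A + t - s := by linarith
  rw [hY]
  have hAA : A ^ 2 ≤ A * B := by rw [sq]; gcongr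
  -- (A + t - s)² ≤ 3 (A² + t² + s²) ≤ 3 (1 + 2 + 2) A B, whence the factor 15.
  nlinarith [sq_nonneg (A - t), sq_nonneg (A + s), sq_nonneg (s + t)]

/-- The Hölder estimate for Dirichlet seminorms. -/
lemma q_pow_le {w : R} (hw : 0 ≤ w) {m φ ψ : D} (h : K.Dom w m φ) (h' : K.Dom w m ψ)
    (hm : K.Dom w m m) (p : ℕ) {B r : ℝ}
    (hB : 15 * (4 ^ p * (64 * K.I ((w + K.d m) ^ (p + 1)) (-(m : C(X, ℝ))))) ≤ B) (hB0 : 0 ≤ B)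
    (h0 : K.q (φ - ψ) ((w + K.d ((1 / 2 : ℝ) • (φ + ψ))) ^ p) ≤ r * B) :
    K.q (φ - ψ) ((w + K.d m) ^ p) ^ 2 ^ p ≤ B ^ 2 ^ p * r := by
  have hη := h.mid h'
  -- After j exchanges the exponent of r is 2^{-j}; everything is stated with powers 2^j to avoid
  -- roots.
  suffices H : ∀ j ≤ p, K.q (φ - ψ) ((w + K.d ((1 / 2 : ℝ) • (φ + ψ))) ^ (p - j) *
      (w + K.d m) ^ j) ^ 2 ^ j ≤ B ^ 2 ^ j * r by simpa using H p le_rfl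
  intro j
  induction j with
  | zero => intro _; simpa [mul_comm] using h0
  | succ j ih =>
    intro hj
    obtain ⟨i, rfl⟩ : ∃ i, p = i + j + 1 := ⟨p - j - 1, by omega⟩
    have h1 := q_exchange hw h h' hm i j
    have h2 := ih (by omega)
    rw [show i + j + 1 - j = i + 1 by omega] at h2
    rw [show i + j + 1 - (j + 1) = i by omega]
    have hA0 := K.q_nonneg (mul_nonneg (pow_nonneg hη.nonneg (i + 1)) (pow_nonneg hm.nonneg j))
      (φ - ψ)
    set A := K.q (φ - ψ) ((w + K.d ((1 / 2 : ℝ) • (φ + ψ))) ^ (i + 1) * (w + K.d m) ^ j)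
    have h3 := h1.trans (mul_le_mul_of_nonneg_right hB hA0)
    rw [pow_succ' 2 j, pow_mul]
    calc _ ≤ (B * A) ^ 2 ^ j := by gcongr
      _ = B ^ 2 ^ j * A ^ 2 ^ j := mul_pow _ _ _
      _ ≤ B ^ 2 ^ j * (B ^ 2 ^ j * r) := by gcongr
      _ = _ := by rw [pow_mul]; ring

end Calculus

end

/-! ### Hölder continuity of mixed integrals, coercivity of the energy -/

section

/-- The constant of the Hölder estimate for mixed Monge–Ampère measures. -/
def holderConst (p : ℕ) : ℝ := (((p : ℝ) + 1) * 4 ^ p) ^ 2 * (960 * ((p : ℝ) + 2))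

/-- The constant of the coercivity estimates. -/
def coerConst (p : ℕ) : ℝ := ((p : ℝ) + 1) * ((p : ℝ) + 2) * 2 ^ (p + 1)

/-- The constant bounding integrals against mixed measures. -/
def mixConst (p : ℕ) : ℝ := 2 * 4 ^ (p + 1) * ((p : ℝ) + 2)

lemma coerConst_ge_one (p : ℕ) : 1 ≤ coerConst p := by
  have h1 : (1 : ℝ) ≤ (p : ℝ) + 1 := by simp
  have h2 : (1 : ℝ) ≤ (p : ℝ) + 2 := by linarith
  have h3 : (1 : ℝ) ≤ 2 ^ (p + 1) := one_le_pow₀ (by norm_num)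
  exact one_le_mul_of_one_le_of_one_le (one_le_mul_of_one_le_of_one_le h1 h2) h3

lemma mixConst_ge_one (p : ℕ) : 1 ≤ mixConst p := by
  have h2 : (1 : ℝ) ≤ (p : ℝ) + 2 := by linarith [Nat.cast_nonneg (α := ℝ) p]
  have h3 : (1 : ℝ) ≤ 4 ^ (p + 1) := one_le_pow₀ (by norm_num)
  exact one_le_mul_of_one_le_of_one_le (one_le_mul_of_one_le_of_one_le (by norm_num) h3) h2

lemma holderConst_nonneg (p : ℕ) : 0 ≤ holderConst p := by unfold holderConst; positivity

lemma abs_le_mul_rpow_of_pow_le {z c r : ℝ} (hc : 0 ≤ c) (hr : 0 ≤ r) (k : ℕ)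
    (h : |z| ^ 2 ^ k ≤ c ^ 2 ^ k * r) : |z| ≤ c * r ^ ((2 : ℝ)⁻¹ ^ k) := by
  have e : (r ^ ((2 : ℝ)⁻¹ ^ k)) ^ 2 ^ k = r := by
    rw [← Real.rpow_natCast, ← Real.rpow_mul hr]
    push_cast
    rw [← mul_pow]; norm_num
  refine le_of_pow_le_pow_left₀ (n := 2 ^ k) (by positivity) (by positivity) ?_
  rwa [mul_pow, e]

namespace Calculus

variable {X : Type*} [TopologicalSpace X]
  {R : Type*} [CommRing R] [Algebra ℝ R] [Preorder R]
  {D : Submodule ℝ C(X, ℝ)} (K : Calculus D R)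
variable [IsOrderedAddMonoid R] [PosMulMono R] [MulPosMono R] [ZeroLEOneClass R] [PosSMulMono ℝ R]

/-- A function dominating three given ones, with control of its energy. -/
lemma exists_dom (p : ℕ) {w : R} (hw : 0 ≤ w) {φ ψ χ : D} (hφ : 0 ≤ w + K.d φ)
    (hψ : 0 ≤ w + K.d ψ) (hχ : 0 ≤ w + K.d χ) (hφ0 : (φ : C(X, ℝ)) ≤ 0)
    (hψ0 : (ψ : C(X, ℝ)) ≤ 0) (hχ0 : (χ : C(X, ℝ)) ≤ 0) :
    ∃ m : D, K.Dom w m φ ∧ K.Dom w m ψ ∧ K.Dom w m χ ∧ K.Dom w m m ∧ K.Dom w m 0 ∧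
      K.I ((w + K.d m) ^ (p + 1)) (-(m : C(X, ℝ))) ≤
        ((p : ℝ) + 2) / 4 * (-K.E p w φ - K.E p w ψ - K.E p w χ) := by
  -- The barycentre of 0, φ, ψ, χ: four times its form is the sum of the four positive forms, hence
  -- dominates each of them.
  set m : D := (1 / 4 : ℝ) • (φ + ψ + χ) with hm
  have e : (4 : ℝ) • (w + K.d m) = w + (w + K.d φ) + (w + K.d ψ) + (w + K.d χ) := by
    rw [hm, map_smul, map_add, map_add]; module
  have s0 : 0 ≤ w + (w + K.d φ) := add_nonneg hw hφ
  have s1 : 0 ≤ w + (w + K.d φ) + (w + K.d ψ) := add_nonneg s0 hψ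
  have h4 : 0 ≤ (4 : ℝ) • (w + K.d m) := by rw [e]; exact add_nonneg s1 hχ
  have h1 : 0 ≤ w + K.d m := nonneg_of_smul h4
  have d0 : K.Dom w m 0 := by
    refine ⟨by simpa using hw, ?_, le_rfl, ?_⟩
    · rw [e, map_zero, add_zero]
      exact le_add_of_le_of_nonneg (le_add_of_le_of_nonneg (le_add_of_nonneg_right hφ) hψ) hχ
    · intro x
      have a1 := hφ0 x; have a2 := hψ0 x; have a3 := hχ0 x
      simp [hm] at a1 a2 a3 ⊢; linarith
  refine ⟨m, ⟨hφ, ?_, hφ0, ?_⟩, ⟨hψ, ?_, hψ0, ?_⟩, ⟨hχ, ?_, hχ0, ?_⟩,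
    ⟨h1, le_four_smul h1, ?_, ?_⟩, d0, ?_⟩
  · rw [e]
    exact le_add_of_le_of_nonneg (le_add_of_le_of_nonneg (le_add_of_nonneg_left hw) hψ) hχ
  · intro x
    have a1 := hφ0 x; have a2 := hψ0 x; have a3 := hχ0 x
    simp [hm] at a1 a2 a3 ⊢; linarith
  · rw [e]
    exact le_add_of_le_of_nonneg (le_add_of_nonneg_left s0) hχ
  · intro x
    have a1 := hφ0 x; have a2 := hψ0 x; have a3 := hχ0 x
    simp [hm] at a1 a2 a3 ⊢; linarith
  · rw [e]
    exact le_add_of_nonneg_left s1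
  · intro x
    have a1 := hφ0 x; have a2 := hψ0 x; have a3 := hχ0 x
    simp [hm] at a1 a2 a3 ⊢; linarith
  · intro x
    have a1 := hφ0 x; have a2 := hψ0 x; have a3 := hχ0 x
    simp [hm] at a1 a2 a3 ⊢; linarith
  · intro x
    have a1 := hφ0 x; have a2 := hψ0 x; have a3 := hχ0 x
    simp [hm] at a1 a2 a3 ⊢; linarith
  · have hm0 : (m : C(X, ℝ)) ≤ 0 := d0.bound_nonpos
    refine (K.I_pow_neg_le p hw h1 hm0).trans ?_
    -- Concavity at the barycentre: in the sum of the four tangent inequalities the first order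
    -- terms cancel, so -E(m) is at most the mean of the four values of -E.
    have t1 := K.E_le_tangent p hφ h1
    have t2 := K.E_le_tangent p hψ h1
    have t3 := K.E_le_tangent p hχ h1
    have t4 := K.E_le_tangent p (φ := 0) (by simpa using hw) h1
    have hsum : K.I ((w + K.d m) ^ (p + 1)) ((φ - m : D) : C(X, ℝ)) +
        K.I ((w + K.d m) ^ (p + 1)) ((ψ - m : D) : C(X, ℝ)) +
        K.I ((w + K.d m) ^ (p + 1)) ((χ - m : D) : C(X, ℝ)) +
        K.I ((w + K.d m) ^ (p + 1)) ((0 - m : D) : C(X, ℝ)) = 0 := by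
      rw [← map_add, ← map_add, ← map_add, ← Submodule.coe_add, ← Submodule.coe_add,
        ← Submodule.coe_add]
      have : φ - m + (ψ - m) + (χ - m) + (0 - m) = 0 := by rw [hm]; module
      rw [this]; simp
    rw [E_zero] at t4
    have hp : (0 : ℝ) < (p : ℝ) + 2 := by positivity
    have : -K.E p w m ≤ (-K.E p w φ - K.E p w ψ - K.E p w χ) / 4 := by linarith
    calc _ ≤ ((p : ℝ) + 2) * ((-K.E p w φ - K.E p w ψ - K.E p w χ) / 4) := by gcongr
      _ = _ := by ring

/-- Hölder continuity of mixed Monge–Ampère measures. -/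
lemma abs_I_pow_sub_E_le (p : ℕ) {w : R} (hw : 0 ≤ w) {φ ψ χ : D} (hφ : 0 ≤ w + K.d φ)
    (hψ : 0 ≤ w + K.d ψ) (hχ : 0 ≤ w + K.d χ) (hφ0 : (φ : C(X, ℝ)) ≤ 0)
    (hψ0 : (ψ : C(X, ℝ)) ≤ 0) (hχ0 : (χ : C(X, ℝ)) ≤ 0) {M r : ℝ} (hM : 0 ≤ M) (hr : 0 ≤ r)
    (hφM : -K.E p w φ ≤ M) (hψM : -K.E p w ψ ≤ M) (hχM : -K.E p w χ ≤ M)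
    (h : K.q (φ - ψ) ((w + K.d ((1 / 2 : ℝ) • (φ + ψ))) ^ p) ≤ r * M) :
    |K.I ((w + K.d χ) ^ (p + 1)) ((φ - ψ : D) : C(X, ℝ)) - (K.E p w φ - K.E p w ψ)| ≤
      holderConst p * M * r ^ ((2 : ℝ)⁻¹ ^ (p + 1)) := by
  obtain ⟨m, dφ, dψ, dχ, dm, d0, hS⟩ := K.exists_dom p hw hφ hψ hχ hφ0 hψ0 hχ0
  set S := K.I ((w + K.d m) ^ (p + 1)) (-(m : C(X, ℝ)))
  set u := φ - ψ with hu
  have hp : (0 : ℝ) < (p : ℝ) + 2 := by positivity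
  have hSM : S ≤ ((p : ℝ) + 2) * M := by
    refine hS.trans ?_
    rw [div_mul_eq_mul_div, div_le_iff₀ (by norm_num), mul_assoc]
    gcongr; linarith
  have hS0 : 0 ≤ S := K.pos _ (pow_nonneg dm.nonneg _) _ (neg_nonneg.2 dm.nonpos)
  set g : ℝ := ((p : ℝ) + 1) * 4 ^ p with hg
  have h4 : (1 : ℝ) ≤ 4 ^ p := one_le_pow₀ (by norm_num)
  have hg4 : (4 : ℝ) ^ p ≤ g := by rw [hg]; nlinarith [Nat.cast_nonneg (α := ℝ) p]
  have hg2 : (4 : ℝ) ^ p ≤ g ^ 2 := by nlinarith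
  set B := holderConst p * M with hB
  have hBe : B = g ^ 2 * (960 * (((p : ℝ) + 2) * M)) := by rw [hB, holderConst]; ring
  have hB0 : 0 ≤ B := mul_nonneg (holderConst_nonneg p) hM
  have hX0 : 0 ≤ K.q u ((w + K.d m) ^ p) := K.q_nonneg (pow_nonneg dm.nonneg _) _
  have hMB : M ≤ B := by
    have : 1 ≤ holderConst p := by
      unfold holderConst
      have : (1 : ℝ) ≤ g ^ 2 := h4.trans hg2
      nlinarith [Nat.cast_nonneg (α := ℝ) p]
    rw [hB]; nlinarith
  have hX : K.q u ((w + K.d m) ^ p) ^ 2 ^ p ≤ B ^ 2 ^ p * r := by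
    refine q_pow_le hw dφ dψ dm p ?_ hB0 (h.trans (by gcongr))
    rw [hBe]
    calc (15 : ℝ) * (4 ^ p * (64 * S)) ≤ 15 * (g ^ 2 * (64 * (((p : ℝ) + 2) * M))) := by gcongr
      _ = _ := by ring
  set Q := K.q u ((w + K.d m) ^ p)
  -- The change of measure from χ to x is d(χ - x) ∧ `hom`. Integrating by parts and applying
  -- Cauchy–Schwarz bounds its square by B times the seminorm Q of u, and Q carries r to the power
  -- 2^{-p}; hence the final exponent 2^{-(p+1)}.
  have main {x : D} (dx : K.Dom w m x) :
      |K.I ((w + K.d χ) ^ (p + 1)) (u : C(X, ℝ)) - K.I ((w + K.d x) ^ (p + 1)) (u : C(X, ℝ))| ≤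
        B * r ^ ((2 : ℝ)⁻¹ ^ (p + 1)) := by
    apply abs_le_mul_rpow_of_pow_le hB0 hr
    have hom0 := hom_nonneg p dχ.nonneg dx.nonneg
    have home : hom p (w + K.d χ) (w + K.d x) ≤ g • (w + K.d m) ^ p := by
      refine (hom_le p dχ.nonneg dx.nonneg dχ.le dx.le).trans_eq ?_
      rw [natCast_add_one_mul, smul_pow, smul_smul, hg]
    have e : K.I ((w + K.d χ) ^ (p + 1)) (u : C(X, ℝ)) -
        K.I ((w + K.d x) ^ (p + 1)) (u : C(X, ℝ)) =
        K.I (K.d u * hom p (w + K.d χ) (w + K.d x)) ((χ - x : D) : C(X, ℝ)) := by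
      rw [← K.symm, ← LinearMap.sub_apply, ← map_sub, ← sub_mul_hom, map_sub]
      congr 3; ring
    rw [e]
    have h1 := K.sq_le_q_mul_q hom0 u (χ - x)
    set z := K.I (K.d u * hom p (w + K.d χ) (w + K.d x)) ((χ - x : D) : C(X, ℝ))
    have h2 : z ^ 2 ≤ B * Q := by
      refine h1.trans ?_
      have a1 := K.q_mono home u
      have a2 := K.q_mono home (χ - x)
      rw [q_smul] at a1 a2
      have a3 := dχ.q_sub_le hw dx p
      have hg0 : 0 ≤ g := by positivity
      calc _ ≤ (g * Q) * (g * (64 * S)) := mul_le_mul a1 (a2.trans (by gcongr))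
            (K.q_nonneg hom0 _) (by positivity)
        _ ≤ (g * Q) * (g * (64 * (((p : ℝ) + 2) * M))) := by gcongr
        _ ≤ B * Q := by
            rw [hBe]
            have : 0 ≤ g ^ 2 * (((p : ℝ) + 2) * M) * Q := by positivity
            linarith
    calc |z| ^ 2 ^ (p + 1) = (z ^ 2) ^ 2 ^ p := by rw [pow_succ', pow_mul, sq_abs]
      _ ≤ (B * Q) ^ 2 ^ p := by gcongr
      _ = B ^ 2 ^ p * Q ^ 2 ^ p := mul_pow _ _ _
      _ ≤ B ^ 2 ^ p * (B ^ 2 ^ p * r) := by gcongr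
      _ = _ := by rw [pow_succ 2 p, pow_mul]; ring
  have m1 := abs_le.1 (main dφ)
  have m2 := abs_le.1 (main dψ)
  -- By concavity E(φ) - E(ψ) lies between the integrals of u against the measures of φ and of ψ, so
  -- `main` for x = φ and x = ψ suffices.
  have t1 := K.E_le_tangent p hφ hψ
  have t2 := K.E_le_tangent p hψ hφ
  have t3 : K.I ((w + K.d φ) ^ (p + 1)) ((ψ - φ : D) : C(X, ℝ)) =
      -K.I ((w + K.d φ) ^ (p + 1)) (u : C(X, ℝ)) := by
    rw [← map_neg, ← Submodule.coe_neg, hu, neg_sub]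
  rw [t3] at t2
  rw [abs_le]
  constructor <;> linarith [m1.1, m1.2, m2.1, m2.2]

lemma nonneg_smul_d {w : R} (hw : 0 ≤ w) {φ : D} (hφ : 0 ≤ w + K.d φ) {s : ℝ} (hs : 0 ≤ s)
    (hs1 : s ≤ 1) : 0 ≤ w + K.d (s • φ) := by
  have : w + K.d (s • φ) = s • (w + K.d φ) + (1 - s) • w := by rw [map_smul]; module
  rw [this]
  exact add_nonneg (smul_nonneg hs hφ) (smul_nonneg (by linarith) hw)

/-- Concavity on the segment from 0 to φ, where E vanishes at 0. -/
lemma E_smul_ge (p : ℕ) {w : R} (hw : 0 ≤ w) {φ : D} (hφ : 0 ≤ w + K.d φ) {s : ℝ} (hs : 0 ≤ s)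
    (hs1 : s ≤ 1) : s * K.E p w φ ≤ K.E p w (s • φ) := by
  have h := K.nonneg_smul_d hw hφ hs hs1
  have t1 := K.E_le_tangent p hφ h
  have t2 := K.E_le_tangent p (φ := 0) (by simpa using hw) h
  have e1 : φ - s • φ = (1 - s) • φ := by module
  have e2 : 0 - s • φ = -s • φ := by module
  rw [e1, Submodule.coe_smul, map_smul, smul_eq_mul] at t1
  rw [e2, Submodule.coe_smul, map_smul, smul_eq_mul, E_zero] at t2
  nlinarith

lemma pow_mul_d (p : ℕ) (w : R) (φ χ : D) (f : C(X, ℝ)) :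
    K.I ((w + K.d φ) ^ (p + 1)) f - K.I ((w + K.d χ) ^ (p + 1)) f =
      K.I (K.d (φ - χ) * hom p (w + K.d φ) (w + K.d χ)) f := by
  rw [← LinearMap.sub_apply, ← map_sub, ← sub_mul_hom, map_sub]
  congr 3; ring

lemma half_two_smul (w : R) (φ : D) :
    (2 : ℝ) • (w + K.d ((1 / 2 : ℝ) • φ)) = (w + K.d φ) + w := by
  rw [map_smul]; module

/-- A bound of the energy along rays. -/
lemma neg_E_smul_le (p : ℕ) {w : R} (hw : 0 ≤ w) {φ : D} (hφ : 0 ≤ w + K.d φ)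
    (h0 : (φ : C(X, ℝ)) ≤ 0) {s : ℝ} (hs : 0 ≤ s) (hs1 : s ≤ 1) :
    -K.E p w (s • φ) ≤ s * K.I (w ^ (p + 1)) (-(φ : C(X, ℝ))) +
      s ^ 2 * (coerConst p * -K.E p w φ) := by
  have h := K.nonneg_smul_d hw hφ hs hs1
  have hh := K.nonneg_smul_d hw hφ (s := 1 / 2) (by norm_num) (by norm_num)
  have hh0 : (((1 / 2 : ℝ) • φ : D) : C(X, ℝ)) ≤ 0 := by
    intro x; have := h0 x; simp at this ⊢; linarith
  have hsum : 0 ≤ (w + K.d φ) + w := add_nonneg hφ hw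
  refine (K.neg_E_le p hw h).trans ?_
  -- Expanding the measure of sφ around that of 0 gains a second factor s. The quadratic remainder
  -- is what allows later arguments to absorb the energy by choosing s small.
  have e1 := K.pow_mul_d p w (s • φ) 0 (-(φ : C(X, ℝ)))
  rw [sub_zero, map_zero, add_zero, map_smul (K.d)] at e1
  have e2 : K.I (s • K.d φ * hom p (w + s • K.d φ) w) (-(φ : C(X, ℝ))) =
      s * K.q φ (hom p (w + s • K.d φ) w) := by simp [q]
  have h' : 0 ≤ w + s • K.d φ := by rwa [map_smul] at h
  have hle : hom p (w + s • K.d φ) w ≤ ((p : ℝ) + 1) • ((w + K.d φ) + w) ^ p := by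
    rw [← natCast_add_one_mul]
    refine hom_le p h' hw ?_ (le_add_of_nonneg_left hφ)
    have : (w + K.d φ) + w - (w + s • K.d φ) = (1 - s) • (w + K.d φ) + s • w := by module
    rw [← sub_nonneg, this]
    exact add_nonneg (smul_nonneg (by linarith) hφ) (smul_nonneg hs hw)
  have h1 : K.q φ (hom p (w + s • K.d φ) w) ≤ coerConst p * -K.E p w φ := by
    refine (K.q_mono hle φ).trans ?_
    rw [q_smul]
    have a1 : K.q φ (((w + K.d φ) + w) ^ p) ≤
        K.I (((w + K.d φ) + w) ^ (p + 1)) (-(φ : C(X, ℝ))) := by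
      refine (K.q_le_I_neg hw h0 (pow_nonneg hsum p)).trans (K.I_mono ?_ (neg_nonneg.2 h0))
      rw [pow_succ']
      exact mul_le_mul_of_nonneg_right (le_add_of_nonneg_right hw) (pow_nonneg hsum p)
    have a2 : K.I (((w + K.d φ) + w) ^ (p + 1)) (-(φ : C(X, ℝ))) =
        2 ^ (p + 1) * (2 * K.I ((w + K.d ((1 / 2 : ℝ) • φ)) ^ (p + 1))
          (-(((1 / 2 : ℝ) • φ : D) : C(X, ℝ)))) := by
      rw [← half_two_smul, smul_pow]; simp
    have a3 := K.I_pow_neg_le p hw hh hh0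
    have a4 := K.E_smul_ge p hw hφ (s := 1 / 2) (by norm_num) (by norm_num)
    have hp : (0 : ℝ) < (p : ℝ) + 2 := by positivity
    calc _ ≤ ((p : ℝ) + 1) * (2 ^ (p + 1) * (2 * (((p : ℝ) + 2) * -(1 / 2 * K.E p w φ)))) := by
          gcongr
          refine (a1.trans_eq a2).trans ?_
          gcongr
          refine a3.trans ?_
          gcongr
      _ = _ := by rw [coerConst]; ring
  calc K.I ((w + K.d (s • φ)) ^ (p + 1)) (-((s • φ : D) : C(X, ℝ)))
      = s * K.I ((w + s • K.d φ) ^ (p + 1)) (-(φ : C(X, ℝ))) := by simp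
    _ = s * K.I (w ^ (p + 1)) (-(φ : C(X, ℝ))) +
        s * (s * K.q φ (hom p (w + s • K.d φ) w)) := by rw [← e2, ← e1]; ring
    _ ≤ s * K.I (w ^ (p + 1)) (-(φ : C(X, ℝ))) + s * (s * (coerConst p * -K.E p w φ)) := by
        gcongr
    _ = _ := by ring

/-- Coercivity: near maximizers have bounded energy. -/
lemma neg_E_le_of_near_max (p : ℕ) {w : R} (hw : 0 ≤ w) {φ : D} (hφ : 0 ≤ w + K.d φ)
    {μφ j ε : ℝ} (h1 : K.E p w ((1 / 2 : ℝ) • φ) - 1 / 2 * μφ ≤ j) (h2 : j - ε ≤ K.E p w φ - μφ) :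
    -K.E p w φ ≤ K.I (w ^ (p + 1)) (-(φ : C(X, ℝ))) + coerConst p * (j + ε) := by
  have hh := K.nonneg_smul_d hw hφ (s := 1 / 2) (by norm_num) (by norm_num)
  refine (K.neg_E_le p hw hφ).trans ?_
  have e1 := K.pow_mul_d p w φ 0 (-(φ : C(X, ℝ)))
  rw [sub_zero, map_zero, add_zero] at e1
  have e2 : K.I (K.d φ * hom p (w + K.d φ) w) (-(φ : C(X, ℝ))) =
      K.q φ (hom p (w + K.d φ) w) := by simp [q]
  have hle : hom p (w + K.d φ) w ≤
      (((p : ℝ) + 1) * 2 ^ p) • (w + K.d ((1 / 2 : ℝ) • φ)) ^ p := by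
    rw [mul_smul, ← smul_pow, half_two_smul, ← natCast_add_one_mul]
    exact hom_le p hφ hw (le_add_of_nonneg_right hw) (le_add_of_nonneg_left hφ)
  have h3 := K.q_mono hle φ
  rw [q_smul] at h3
  -- Uniform concavity between φ and 0: the competitor φ/2 has value at most j while φ has value at
  -- least j - ε, so 2E(φ/2) - E(φ) ≤ j + ε.
  have h4 := K.q_le_E_mid p hφ (ψ := 0) (by simpa using hw)
  rw [sub_zero, add_zero, E_zero] at h4
  have hp : (0 : ℝ) < (p : ℝ) + 2 := by positivity
  have h5 : K.q φ ((w + K.d ((1 / 2 : ℝ) • φ)) ^ p) ≤ 2 * ((p : ℝ) + 2) * (j + ε) :=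
    h4.trans (mul_le_mul_of_nonneg_left (by linarith) (by positivity))
  have h6 : K.q φ (hom p (w + K.d φ) w) ≤ coerConst p * (j + ε) := by
    refine h3.trans ?_
    calc _ ≤ ((p : ℝ) + 1) * 2 ^ p * (2 * ((p : ℝ) + 2) * (j + ε)) := by gcongr
      _ = _ := by rw [coerConst]; ring
  linarith

/-- The energy bound for mixed measures `θ (w + dφ)ⁱ (w + dψ)ʲ`. -/
lemma E_add_I_mixed_le (p : ℕ) {w : R} (hw : 0 ≤ w) {θ : R} (hθ0 : 0 ≤ θ) (hθ : θ ≤ (2 : ℝ) • w)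
    {φ ψ ρ : D} (hφ : 0 ≤ w + K.d φ) (hψ : 0 ≤ w + K.d ψ) (hρ : 0 ≤ w + K.d ρ)
    (hφ0 : (φ : C(X, ℝ)) ≤ 0) (hψ0 : (ψ : C(X, ℝ)) ≤ 0) (hρ0 : (ρ : C(X, ℝ)) ≤ 0) {M : ℝ}
    (hφM : -K.E p w φ ≤ M) (hψM : -K.E p w ψ ≤ M)
    (hT : K.I (w ^ (p + 1)) (-(ρ : C(X, ℝ))) ≤ M) {i j : ℕ} (hij : i + j = p) :
    K.E p w ρ + K.I (θ * ((w + K.d φ) ^ i * (w + K.d ψ) ^ j)) (-(ρ : C(X, ℝ))) ≤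
      3 * mixConst p ^ 2 * coerConst p * M := by
  have hκ := mixConst_ge_one p
  have hc := coerConst_ge_one p
  have hM : 0 ≤ M := (K.pos _ (pow_nonneg hw _) _ (neg_nonneg.2 hρ0)).trans hT
  set κ := mixConst p with hκd
  set c := coerConst p
  -- Chosen so that, after division by s, the quadratic term s² c (-E(ρ)) of the energy of sρ
  -- contributes exactly -E(ρ), which cancels against the term E(ρ) on the left.
  set s : ℝ := (κ * c)⁻¹ with hs
  have hκc : 1 ≤ κ * c := one_le_mul_of_one_le_of_one_le hκ hc
  have hs0 : 0 < s := by positivity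
  have hs1 : s ≤ 1 := inv_le_one_of_one_le₀ hκc
  have hsρ := K.nonneg_smul_d hw hρ hs0.le hs1
  have hsρ0 : ((s • ρ : D) : C(X, ℝ)) ≤ 0 := by
    intro x; have := hρ0 x; simp at this ⊢; exact mul_nonpos_of_nonneg_of_nonpos hs0.le this
  obtain ⟨m, dφ, dψ, dρ, dm, d0, hS⟩ := K.exists_dom p hw hφ hψ hsρ hφ0 hψ0 hsρ0
  have hE := K.neg_E_smul_le p hw hρ hρ0 hs0.le hs1
  have d0' : w ≤ (4 : ℝ) • (w + K.d m) := by simpa using d0.le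
  have hm4 := dm.nonneg.trans dm.le
  set P := θ * ((w + K.d φ) ^ i * (w + K.d ψ) ^ j) with hP
  have hprod0 : 0 ≤ (w + K.d φ) ^ i * (w + K.d ψ) ^ j :=
    mul_nonneg (pow_nonneg hφ _) (pow_nonneg hψ _)
  have hP0 : 0 ≤ P := mul_nonneg hθ0 hprod0
  have hPle : P ≤ ((2 : ℝ) * 4 ^ (p + 1)) • (w + K.d m) ^ (p + 1) := by
    rw [mul_smul, ← smul_pow, pow_succ', ← smul_mul_assoc, hP, ← hij, pow_add]
    refine mul_le_mul (hθ.trans (smul_le_smul_of_nonneg_left d0' (by norm_num))) ?_ hprod0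
      (smul_nonneg (by norm_num) hm4)
    exact mul_le_mul (pow_le_pow_left₀ hφ dφ.le _) (pow_le_pow_left₀ hψ dψ.le _)
      (pow_nonneg hψ _) (pow_nonneg hm4 _)
  have h1 := dρ.I_le hP0 hPle
  have e1 : K.I P (-((s • ρ : D) : C(X, ℝ))) = s * K.I P (-(ρ : C(X, ℝ))) := by simp
  rw [e1] at h1
  set y := K.I P (-(ρ : C(X, ℝ)))
  set Rr := -K.E p w ρ with hR
  have hp : (0 : ℝ) < (p : ℝ) + 2 := by positivity
  have hsT : s * K.I (w ^ (p + 1)) (-(ρ : C(X, ℝ))) ≤ M := by nlinarith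
  have h2 : s * y ≤ κ * (3 * M + s ^ 2 * (c * Rr)) := by
    refine h1.trans ?_
    calc _ ≤ 4 * (2 * 4 ^ (p + 1)) * (((p : ℝ) + 2) / 4 *
          (-K.E p w φ - K.E p w ψ - K.E p w (s • ρ))) := by gcongr
      _ ≤ 4 * (2 * 4 ^ (p + 1)) * (((p : ℝ) + 2) / 4 * (3 * M + s ^ 2 * (c * Rr))) := by
          gcongr; linarith
      _ = _ := by rw [hκd, mixConst]; ring
  have hsk : κ * c * s = 1 := by rw [hs]; exact mul_inv_cancel₀ (by positivity)
  have h3 : y ≤ 3 * κ ^ 2 * c * M + Rr := by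
    have : κ * c * (s * y) ≤ κ * c * (κ * (3 * M + s ^ 2 * (c * Rr))) := by gcongr
    have e3 : κ * c * (s * y) = y := by rw [← mul_assoc, hsk, one_mul]
    have e4 : κ * c * (κ * (3 * M + s ^ 2 * (c * Rr))) =
      3 * κ ^ 2 * c * M + (κ * c * s) ^ 2 * Rr := by ring
    rw [e3, e4, hsk] at this
    linarith
  linarith

end Calculus

end

section

/-! ### The commutative algebra generated by the forms -/

section FormAlg

variable (Z : Type*) [AddCommGroup Z] [Module ℝ Z]

/-- The symmetric algebra of the space of forms, realised as a polynomial ring over a basis. -/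
abbrev FormAlg : Type _ := MvPolynomial (Module.Basis.ofVectorSpaceIndex ℝ Z) ℝ

variable {Z}

/-- The inclusion of forms into the algebra. -/
def FormAlg.ι : Z →ₗ[ℝ] FormAlg Z :=
  (Module.Basis.ofVectorSpace ℝ Z).constr ℝ
    (fun i => (MvPolynomial.X i : MvPolynomial (Module.Basis.ofVectorSpaceIndex ℝ Z) ℝ))

open FormAlg

lemma FormAlg.ι_basis (i : Module.Basis.ofVectorSpaceIndex ℝ Z) :
    ι (Module.Basis.ofVectorSpace ℝ Z i) =
      (MvPolynomial.X i : MvPolynomial (Module.Basis.ofVectorSpaceIndex ℝ Z) ℝ) :=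
  Module.Basis.constr_basis _ _ _ _

/-- Identities linear in P, such as integration by parts, need only be checked on products of forms.
-/
lemma FormAlg.span_prod :
    Submodule.span ℝ (Set.range fun l : List Z => (l.map (ι (Z := Z))).prod) = ⊤ := by
  rw [eq_top_iff]
  rintro P -
  refine MvPolynomial.induction_on (motive := fun P => (P : FormAlg Z) ∈ Submodule.span ℝ
    (Set.range fun l : List Z => (l.map (ι (Z := Z))).prod)) P ?_ ?_ ?_
  · intro c
    have h : (1 : FormAlg Z) ∈ Submodule.span ℝ
        (Set.range fun l : List Z => (l.map (ι (Z := Z))).prod) :=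
      Submodule.subset_span ⟨[], by simp⟩
    have := Submodule.smul_mem _ c h
    rw [Algebra.smul_def, mul_one] at this
    exact this
  · intro P Q hP hQ
    exact Submodule.add_mem _ hP hQ
  · intro P i hP
    rw [← ι_basis]
    refine Submodule.span_induction (p := fun P _ => P * ι (Module.Basis.ofVectorSpace ℝ Z i) ∈
      Submodule.span ℝ (Set.range fun l : List Z => (l.map (ι (Z := Z))).prod)) ?_ ?_ ?_ ?_ hP
    · rintro _ ⟨l, rfl⟩
      exact Submodule.subset_span ⟨Module.Basis.ofVectorSpace ℝ Z i :: l, by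
        simp [mul_comm]⟩
    · simp
    · intro x y _ _ hx hy
      rw [add_mul]; exact Submodule.add_mem _ hx hy
    · intro c x _ hx
      rw [smul_mul_assoc]; exact Submodule.smul_mem _ c hx

variable [PartialOrder Z] [IsOrderedAddMonoid Z] [PosSMulMono ℝ Z]

variable (Z) in
/-- The positive cone of the algebra, generated by positive forms and nonnegative scalars. -/
def FormAlg.cone : Subsemiring (FormAlg Z) :=
  Subsemiring.closure ({P | ∃ θ : Z, 0 ≤ θ ∧ ι θ = P} ∪
    {P | ∃ c : ℝ, 0 ≤ c ∧ algebraMap ℝ (FormAlg Z) c = P})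

/-- The order is the one defined by `cone`; antisymmetry plays no role in the energy calculus. -/
instance : Preorder (FormAlg Z) where
  le P Q := Q - P ∈ cone Z
  le_refl P := by simp
  le_trans P Q T h1 h2 := by simpa using (cone Z).add_mem h1 h2

lemma FormAlg.le_def {P Q : FormAlg Z} : P ≤ Q ↔ Q - P ∈ cone Z := Iff.rfl

lemma FormAlg.nonneg_iff {P : FormAlg Z} : 0 ≤ P ↔ P ∈ cone Z := by rw [le_def, sub_zero]

instance : IsOrderedAddMonoid (FormAlg Z) where
  add_le_add_left P Q h T := by rw [le_def] at *; simpa using h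

instance : PosMulMono (FormAlg Z) where
  mul_le_mul_of_nonneg_left P hP Q T h := by
    rw [le_def] at *; rw [← mul_sub]
    exact (cone Z).mul_mem (by simpa using hP) h

instance : MulPosMono (FormAlg Z) where
  mul_le_mul_of_nonneg_right P hP Q T h := by
    rw [le_def] at *; rw [← sub_mul]
    exact (cone Z).mul_mem h (by simpa using hP)

instance : ZeroLEOneClass (FormAlg Z) where
  zero_le_one := nonneg_iff.2 (cone Z).one_mem

instance : PosSMulMono ℝ (FormAlg Z) where
  smul_le_smul_of_nonneg_left c hc P Q h := by
    rw [le_def] at *; rw [← smul_sub, Algebra.smul_def]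
    exact (cone Z).mul_mem (Subsemiring.subset_closure (Or.inr ⟨c, hc, rfl⟩)) h

lemma FormAlg.ι_nonneg {θ : Z} (h : 0 ≤ θ) : 0 ≤ ι θ :=
  nonneg_iff.2 (Subsemiring.subset_closure (Or.inl ⟨θ, h, rfl⟩))

lemma FormAlg.ι_mono {θ θ' : Z} (h : θ ≤ θ') : ι θ ≤ ι θ' := by
  have := ι_nonneg (sub_nonneg.2 h)
  rwa [map_sub, sub_nonneg] at this

/-- A closure as a semiring consists of sums of products of generators, and the scalar factors of a
product can be collected into one coefficient. Positivity statements thus reduce to the axioms for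
products of positive forms. -/
lemma FormAlg.nonneg_induction {p : FormAlg Z → Prop} (h0 : p 0)
    (hadd : ∀ P Q, p P → p Q → p (P + Q))
    (hprod : ∀ (c : ℝ) (l : List Z), 0 ≤ c → (∀ θ ∈ l, 0 ≤ θ) → p (c • (l.map ι).prod))
    {P : FormAlg Z} (hP : 0 ≤ P) : p P := by
  rw [nonneg_iff, cone, Subsemiring.mem_closure_iff] at hP
  refine AddSubmonoid.closure_induction (motive := fun P _ => p P) ?_ h0
    (fun P Q _ _ => hadd P Q) hP
  intro Q hQ
  suffices h : ∃ (c : ℝ) (l : List Z), 0 ≤ c ∧ (∀ θ ∈ l, 0 ≤ θ) ∧ Q = c • (l.map ι).prod by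
    obtain ⟨c, l, hc, hl, rfl⟩ := h
    exact hprod c l hc hl
  refine Submonoid.closure_induction (motive := fun Q _ => ∃ (c : ℝ) (l : List Z), 0 ≤ c ∧
    (∀ θ ∈ l, 0 ≤ θ) ∧ Q = c • (l.map ι).prod) ?_ ?_ ?_ hQ
  · rintro _ (⟨θ, hθ, rfl⟩ | ⟨c, hc, rfl⟩)
    · exact ⟨1, [θ], zero_le_one, by simpa using hθ, by simp⟩
    · exact ⟨c, [], hc, by simp, by simp [Algebra.smul_def]⟩
  · exact ⟨1, [], zero_le_one, by simp, by simp⟩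
  · rintro _ _ _ _ ⟨c, l, hc, hl, rfl⟩ ⟨c', l', hc', hl', rfl⟩
    refine ⟨c * c', l ++ l', mul_nonneg hc hc', ?_, ?_⟩
    · intro θ hθ
      rcases List.mem_append.1 hθ with h | h
      exacts [hl _ h, hl' _ h]
    · simp [smul_smul, mul_comm]

end FormAlg

/-- Families with the same multiset of values differ by a permutation. -/
lemma exists_perm_of_map_eq {k : ℕ} {σ : Type*} {f g : Fin k → σ}
    (h : Multiset.map f Finset.univ.val = Multiset.map g Finset.univ.val) :
    ∃ e : Equiv.Perm (Fin k), ∀ i, g (e i) = f i := by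
  classical
  have hc (c : σ) : Nonempty ({a // f a = c} ≃ {b // g b = c}) := by
    rw [← Fintype.card_eq, Fintype.card_subtype, Fintype.card_subtype]
    have := congrArg (Multiset.count c) h
    rw [Multiset.count_map, Multiset.count_map] at this
    simpa [Finset.card, eq_comm] using this
  exact ⟨Equiv.ofFiberEquiv fun c => (hc c).some, fun i => Equiv.ofFiberEquiv_map _ i⟩

namespace Setup

variable {n : ℕ} {X : Type*} [TopologicalSpace X] [CompactSpace X] [T2Space X]
  {Z : Type*} [AddCommGroup Z] [Module ℝ Z] [PartialOrder Z] [IsOrderedAddMonoid Z]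
  [PosSMulMono ℝ Z] (S : Setup n X Z)

open FormAlg

open Classical in
/-- The value of the wedge product on a monomial of basis elements. -/
def wedgeMonomial (m : Module.Basis.ofVectorSpaceIndex ℝ Z →₀ ℕ) : SignedRadon X :=
  if h : ∃ v : Fin n → Module.Basis.ofVectorSpaceIndex ℝ Z, ∑ i, Finsupp.single (v i) 1 = m
  then S.wedge (fun i => Module.Basis.ofVectorSpace ℝ Z (h.choose i)) else 0

/-- The linear extension of the wedge product to the algebra of forms. -/
def wedgeAlg : FormAlg Z →ₗ[ℝ] SignedRadon X :=
  (MvPolynomial.basisMonomials (Module.Basis.ofVectorSpaceIndex ℝ Z) ℝ).constr ℝ S.wedgeMonomial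

lemma wedgeAlg_prod_basis {k : ℕ} (v : Fin k → Module.Basis.ofVectorSpaceIndex ℝ Z) :
    S.wedgeAlg (∏ i, ι (Module.Basis.ofVectorSpace ℝ Z (v i))) =
      S.wedgeMonomial (∑ i, Finsupp.single (v i) 1) := by
  have : (∏ i, ι (Module.Basis.ofVectorSpace ℝ Z (v i)) : FormAlg Z) =
      MvPolynomial.basisMonomials (Module.Basis.ofVectorSpaceIndex ℝ Z) ℝ
        (∑ i, Finsupp.single (v i) 1) := by
    rw [MvPolynomial.coe_basisMonomials]
    dsimp only
    rw [MvPolynomial.monomial_sum_one]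
    exact Finset.prod_congr rfl fun i _ => ι_basis _
  rw [this, wedgeAlg]
  exact Module.Basis.constr_basis _ _ _ _

lemma map_univ_eq_of_sum_single {k l : ℕ} {σ : Type*} {f : Fin k → σ} {g : Fin l → σ}
    (h : ∑ i, Finsupp.single (f i) 1 = ∑ i, Finsupp.single (g i) (1 : ℕ)) :
    Multiset.map f Finset.univ.val = Multiset.map g Finset.univ.val := by
  have := congrArg Finsupp.toMultiset h
  have e {k : ℕ} (f : Fin k → σ) : ∑ x, ({f x} : Multiset σ) = Multiset.map f Finset.univ.val := by
    rw [← Multiset.bind_singleton, Multiset.bind, Multiset.join]; rfl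
  simpa [map_sum, Finsupp.toMultiset_single, e] using this

/-- Both sides are multilinear, so basis vectors suffice. There the tuple chosen in `wedgeMonomial`
differs from the given one by a permutation, which `wedge_symm` makes harmless. -/
lemma wedgeAlg_prod (θ : Fin n → Z) : S.wedgeAlg (∏ i, ι (θ i)) = S.wedge θ := by
  suffices h : S.wedgeAlg.compMultilinearMap
      ((MultilinearMap.mkPiAlgebra ℝ (Fin n) (FormAlg Z)).compLinearMap fun _ => ι) = S.wedge by
    have := congrArg (fun f => f θ) h
    simpa using this
  refine Module.Basis.ext_multilinear (fun _ => Module.Basis.ofVectorSpace ℝ Z) fun v => ?_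
  simp only [LinearMap.compMultilinearMap_apply, MultilinearMap.compLinearMap_apply,
    MultilinearMap.mkPiAlgebra_apply]
  rw [wedgeAlg_prod_basis]
  have h : ∃ v' : Fin n → Module.Basis.ofVectorSpaceIndex ℝ Z,
    ∑ i, Finsupp.single (v' i) 1 = ∑ i, Finsupp.single (v i) (1 : ℕ) := ⟨v, rfl⟩
  rw [wedgeMonomial, dif_pos h]
  obtain ⟨e, he⟩ := exists_perm_of_map_eq (map_univ_eq_of_sum_single h.choose_spec)
  rw [← S.wedge_symm e (fun i => Module.Basis.ofVectorSpace ℝ Z (v i))]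
  simp only [he]

/-- Monomials of degree other than n receive the default value 0, so only degree n contributes to
integrals. -/
lemma wedgeAlg_prod_of_ne {k : ℕ} (hk : k ≠ n) (θ : Fin k → Z) :
    S.wedgeAlg (∏ i, ι (θ i)) = 0 := by
  suffices h : S.wedgeAlg.compMultilinearMap
      ((MultilinearMap.mkPiAlgebra ℝ (Fin k) (FormAlg Z)).compLinearMap fun _ => ι) = 0 by
    have := congrArg (fun f => f θ) h
    simpa using this
  refine Module.Basis.ext_multilinear (fun _ => Module.Basis.ofVectorSpace ℝ Z) fun v => ?_
  simp only [LinearMap.compMultilinearMap_apply, MultilinearMap.compLinearMap_apply,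
    MultilinearMap.mkPiAlgebra_apply]
  rw [wedgeAlg_prod_basis, wedgeMonomial, dif_neg]
  · rfl
  · rintro ⟨v', h⟩
    have := congrArg Multiset.card (map_univ_eq_of_sum_single h)
    simp at this
    exact hk this.symm

lemma wedgeAlg_list_of_ne {l : List Z} (hl : l.length ≠ n) :
    S.wedgeAlg (l.map ι).prod = 0 := by
  rw [← S.wedgeAlg_prod_of_ne hl l.get, ← Fin.prod_univ_fun_getElem l ι]; rfl

end Setup

end

/-! ### The setup as an instance of the energy calculus -/

section

namespace Setup

variable {n : ℕ} {X : Type*} [TopologicalSpace X] [CompactSpace X] [T2Space X]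
  {Z : Type*} [AddCommGroup Z] [Module ℝ Z] [PartialOrder Z] [IsOrderedAddMonoid Z]
  [PosSMulMono ℝ Z] (S : Setup n X Z)

open FormAlg

/-- Matches the `Function.update` form of the axioms `ibp` and `seminegative`. The entry 0 in the
first slot is a placeholder that is overwritten; being nonnegative, it also meets the hypothesis of
`seminegative`. -/
lemma wedgeAlg_cons {l : List Z} (hl : l.length + 1 = n) (θ₀ : Z) :
    S.wedgeAlg (ι θ₀ * (l.map ι).prod) =
      S.wedge (Function.update (fun i => (Fin.cons (0 : Z) l.get : Fin (l.length + 1) → Z)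
        (i.cast hl.symm)) (Fin.cast hl 0) θ₀) := by
  subst hl
  rw [← S.wedgeAlg_prod]
  congr 1
  have e : (Function.update (fun i => (Fin.cons (0 : Z) l.get : Fin (l.length + 1) → Z)
      (i.cast rfl)) (Fin.cast rfl 0) θ₀) = (Fin.cons θ₀ l.get : Fin (l.length + 1) → Z) := by
    have := Fin.update_cons_zero (α := fun _ => Z) (0 : Z) l.get θ₀
    exact this
  rw [e, Fin.prod_univ_succ, Fin.cons_zero, ← Fin.prod_univ_fun_getElem l ι]
  rfl

lemma wedgeAlg_cons_of_ne {l : List Z} (hl : l.length + 1 ≠ n) (θ₀ : Z) :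
    S.wedgeAlg (ι θ₀ * (l.map ι).prod) = 0 := by
  have := S.wedgeAlg_list_of_ne (l := θ₀ :: l) (by simpa using hl)
  simpa using this

/-- The energy calculus attached to the setup. -/
def calculus : Calculus S.D (FormAlg Z) where
  I := LinearMap.mk₂ ℝ (fun P f => S.wedgeAlg P f) (by intros; rw [map_add]; rfl)
    (by intros; rw [map_smul]; rfl) (by intros; rw [map_add]) (by intros; rw [map_smul])
  d := ι ∘ₗ S.ddc
  pos P hP f hf := by
    simp only [LinearMap.mk₂_apply]
    refine nonneg_induction (p := fun P => 0 ≤ S.wedgeAlg P f) ?_ ?_ ?_ hP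
    · rw [map_zero]; exact le_rfl
    · intro P Q hP hQ
      rw [map_add]; exact add_nonneg hP hQ
    · intro c l hc hl
      rw [map_smul]
      refine mul_nonneg hc ?_
      by_cases h : l.length = n
      · subst h
        have := S.wedgeAlg_prod l.get
        rw [show ∏ i, ι (l.get i) = (l.map (ι (Z := Z))).prod from
          Fin.prod_univ_fun_getElem l ι] at this
        rw [this]
        exact S.wedge_pos _ (fun i => hl _ (l.get_mem i)) f hf
      · rw [S.wedgeAlg_list_of_ne h]; exact le_rfl
  symm P φ ψ := by
    simp only [LinearMap.mk₂_apply, LinearMap.comp_apply]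
    have hP : P ∈ Submodule.span ℝ (Set.range fun l : List Z => (l.map (ι (Z := Z))).prod) := by
      rw [span_prod]; trivial
    refine Submodule.span_induction (p := fun P _ => S.wedgeAlg (ι (S.ddc ψ) * P) (φ : C(X, ℝ)) =
      S.wedgeAlg (ι (S.ddc φ) * P) (ψ : C(X, ℝ))) ?_ ?_ ?_ ?_ hP
    · rintro _ ⟨l, rfl⟩
      by_cases h : l.length + 1 = n
      · simp only [S.wedgeAlg_cons h]
        exact S.ibp _ _ _ _
      · simp only [S.wedgeAlg_cons_of_ne h]; rfl
    · rw [mul_zero, mul_zero, map_zero]; rfl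
    · intro P Q _ _ hP hQ
      rw [mul_add, mul_add, map_add, map_add]
      exact congrArg₂ (· + ·) hP hQ
    · intro c P _ hP
      rw [mul_smul_comm, mul_smul_comm, map_smul, map_smul]
      exact congrArg (c * ·) hP
  semineg P hP φ := by
    simp only [LinearMap.mk₂_apply, LinearMap.comp_apply]
    refine nonneg_induction (p := fun P => S.wedgeAlg (ι (S.ddc φ) * P) (φ : C(X, ℝ)) ≤ 0)
      ?_ ?_ ?_ hP
    · rw [mul_zero, map_zero]; exact le_rfl
    · intro P Q hP hQ
      rw [mul_add, map_add]; exact add_nonpos hP hQ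
    · intro c l hc hl
      rw [mul_smul_comm, map_smul]
      refine mul_nonpos_of_nonneg_of_nonpos hc ?_
      by_cases h : l.length + 1 = n
      · rw [S.wedgeAlg_cons h]
        refine S.seminegative _ _ (fun i => ?_) φ
        subst h
        refine Fin.cases ?_ (fun j => ?_) i
        · exact le_rfl
        · exact hl _ (l.get_mem j)
      · rw [S.wedgeAlg_cons_of_ne h]; exact le_rfl
  one_mem := S.const_mem 1
  d_one := by
    have := S.ddc_const 1
    rw [LinearMap.comp_apply]
    exact (congrArg ι this).trans (map_zero _)

lemma calculus_I (P : FormAlg Z) (f : C(X, ℝ)) : S.calculus.I P f = S.wedgeAlg P f := rfl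

lemma calculus_d (φ : S.D) : S.calculus.d φ = ι (S.ddc φ) := rfl

lemma wedge_const (θ : Z) (f : C(X, ℝ)) : S.wedge (fun _ => θ) f = S.calculus.I (ι θ ^ n) f := by
  rw [calculus_I, ← S.wedgeAlg_prod]; simp

lemma vol_eq (ω : Z) : S.vol ω = S.calculus.I (ι ω ^ n) 1 := S.wedge_const ω 1

lemma MA_eq (ω : Z) (φ : S.D) (f : C(X, ℝ)) :
    S.MA ω φ f = (S.vol ω)⁻¹ * S.calculus.I ((ι ω + S.calculus.d φ) ^ n) f := by
  rw [calculus_d, ← map_add, ← S.wedge_const]; rfl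

lemma refMeasure_eq (ω : Z) (f : C(X, ℝ)) :
    S.refMeasure ω f = (S.vol ω)⁻¹ * S.calculus.I (ι ω ^ n) f := by
  rw [← S.wedge_const]; rfl

/-- In the i-th summand exactly i slots carry ω and the other n - i carry ω + ddᶜφ, so the sum is a
complete homogeneous polynomial. -/
lemma energyPairing_eq (ω : Z) (φ : S.D) :
    S.energyPairing (fun _ => (ω, φ)) = S.calculus.I (hom n (ι ω + S.calculus.d φ) (ι ω)) φ := by
  rw [hom_comm, hom_eq_sum, map_sum, LinearMap.sum_apply, energyPairing,
    ← Fin.sum_univ_eq_sum_range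
      (fun i => S.calculus.I (ι ω ^ i * (ι ω + S.calculus.d φ) ^ (n - i)) φ)]
  refine Finset.sum_congr rfl fun i _ => ?_
  rw [calculus_I, ← S.wedgeAlg_prod]
  congr 2
  have hc : (Finset.univ.filter fun j : Fin n => j.castSucc < i).card = i := by
    have : (Finset.univ.filter fun j : Fin n => j.castSucc < i) =
        Finset.univ.filter fun j : Fin n => (j : ℕ) < i := by
      ext j; simp [Fin.lt_def]
    rw [this, Fin.card_filter_val_lt]
    exact min_eq_right (Nat.lt_succ_iff.1 i.2)
  have hc' : (Finset.univ.filter fun j : Fin n => ¬ j.castSucc < i).card = n - i := by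
    have := Finset.card_filter_add_card_filter_not (s := Finset.univ)
      fun j : Fin n => j.castSucc < i
    rw [hc, Finset.card_univ, Fintype.card_fin] at this
    omega
  simp only [apply_ite (ι (Z := Z)), Finset.prod_ite, Finset.prod_const, hc, hc', map_add,
    calculus_d]

lemma energy_eq (ω : Z) (φ : S.D) : S.energy ω φ =
    (((n : ℝ) + 1) * S.vol ω)⁻¹ * S.calculus.I (hom n (ι ω + S.calculus.d φ) (ι ω)) φ := by
  rw [energy, energyPairing_eq, div_eq_inv_mul]

end Setup

/-! ### Differentiation of polynomial expressions in the form -/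

section Deriv

variable {R : Type*} [CommRing R]

lemma map_hom {R' : Type*} [CommRing R'] (f : R →+* R') (k : ℕ) (a b : R) :
    f (hom k a b) = hom k (f a) (f b) := by
  induction k with
  | zero => simp [hom]
  | succ k ih => simp [hom, ih]

-- Euler-type identity (∂_a + ∂_b) h_{k+1} = (k + 2) h_k, in the formal variable of R[X].
open Polynomial in
lemma derivative_hom (k : ℕ) (θ a b : R) :
    derivative (hom (k + 1) (C a + X * C θ) (C b + X * C θ)) =
      ((k : R[X]) + 2) * (C θ * hom k (C a + X * C θ) (C b + X * C θ)) := by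
  induction k with
  | zero => simp [hom]; ring
  | succ k ih =>
    rw [hom, derivative_add, derivative_mul, ih, derivative_pow]
    simp only [derivative_add, derivative_C, derivative_mul, derivative_X, zero_add, one_mul,
      mul_zero, add_zero]
    set A := C a + X * C θ
    set B := C b + X * C θ
    rw [hom, show k + 1 + 1 - 1 = k + 1 by omega]
    push_cast
    simp only [map_add, map_natCast, map_one]
    ring

variable [Algebra ℝ R]

-- Transfers formal derivatives in R[X] to real derivatives after applying a linear form; no
-- topology on R is required.
open Polynomial in
lemma hasDerivAt_eval (ℓ : R →ₗ[ℝ] ℝ) (q : R[X]) :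
    HasDerivAt (fun t : ℝ => ℓ (q.eval (algebraMap ℝ R t))) (ℓ ((derivative q).eval 0)) 0 := by
  induction q using Polynomial.induction_on' with
  | add p q hp hq =>
    simp only [eval_add, map_add]
    exact hp.add hq
  | monomial k a =>
    have e (t : ℝ) : ℓ ((monomial k a).eval (algebraMap ℝ R t)) = t ^ k * ℓ a := by
      rw [eval_monomial, ← map_pow, mul_comm, ← Algebra.smul_def, map_smul, smul_eq_mul]
    simp only [e]
    have h := (hasDerivAt_pow k (0 : ℝ)).mul_const (ℓ a)
    refine h.congr_deriv ?_
    rw [derivative_monomial, eval_monomial]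
    rcases k with _ | _ | k <;> simp

lemma hasDerivAt_hom (ℓ : R →ₗ[ℝ] ℝ) (k : ℕ) (θ a b : R) :
    HasDerivAt (fun t : ℝ => ℓ (hom (k + 1) (a + t • θ) (b + t • θ)))
      (((k : ℝ) + 2) * ℓ (θ * hom k a b)) 0 := by
  have h := hasDerivAt_eval ℓ (hom (k + 1) (Polynomial.C a + Polynomial.X * Polynomial.C θ)
    (Polynomial.C b + Polynomial.X * Polynomial.C θ))
  rw [derivative_hom] at h
  have e (t : R) (k : ℕ) : (hom k (Polynomial.C a + Polynomial.X * Polynomial.C θ)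
      (Polynomial.C b + Polynomial.X * Polynomial.C θ)).eval t = hom k (a + t * θ) (b + t * θ) := by
    have := map_hom (Polynomial.evalRingHom t) k
      (Polynomial.C a + Polynomial.X * Polynomial.C θ)
      (Polynomial.C b + Polynomial.X * Polynomial.C θ)
    simpa [mul_comm t] using this
  simp only [e, Polynomial.eval_mul, ← Algebra.smul_def] at h
  refine h.congr_deriv ?_
  rw [← smul_eq_mul ((k : ℝ) + 2), ← map_smul, Algebra.smul_def]
  rw [map_add, map_natCast, map_ofNat]
  simp

lemma hasDerivAt_pow_add (ℓ : R →ₗ[ℝ] ℝ) (k : ℕ) (θ a : R) :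
    HasDerivAt (fun t : ℝ => ℓ ((a + t • θ) ^ (k + 1))) (((k : ℝ) + 1) * ℓ (θ * a ^ k)) 0 := by
  have h := (hasDerivAt_hom ℓ k θ a a).mul_const ((k : ℝ) + 2)⁻¹
  have e (k : ℕ) (x : R) : hom k x x = ((k : ℝ) + 1) • x ^ k := by
    rw [hom_self, Algebra.smul_def]; simp
  simp only [e, mul_smul_comm, map_smul, smul_eq_mul] at h
  have hk : (k : ℝ) + 2 ≠ 0 := by positivity
  refine (h.congr_of_eventuallyEq ?_).congr_deriv ?_
  · filter_upwards with t
    push_cast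
    field_simp
    ring
  · field_simp

end Deriv

namespace Setup

open FormAlg

variable {p : ℕ} {X : Type*} [TopologicalSpace X] [CompactSpace X] [T2Space X]
  {Z : Type*} [AddCommGroup Z] [Module ℝ Z] [PartialOrder Z] [IsOrderedAddMonoid Z]
  [PosSMulMono ℝ Z] (S : Setup (p + 1) X Z)

/-- The quotient rule: the first term differentiates the integral, the second the volume in the
denominator. -/
lemma nablaEnergy_eq {ω : Z} (hω : S.vol ω ≠ 0) (θ : Z) (φ : S.D) : S.nablaEnergy ω θ φ =
    (S.vol ω)⁻¹ * S.calculus.I (ι θ * hom p (ι ω + S.calculus.d φ) (ι ω)) φ -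
    ((p : ℝ) + 1) * ((S.vol ω)⁻¹ * S.calculus.I (ι θ * ι ω ^ p) 1) * S.energy ω φ := by
  have h1 := hasDerivAt_hom ((LinearMap.applyₗ (φ : C(X, ℝ))) ∘ₗ S.calculus.I) p (ι θ)
    (ι ω + S.calculus.d φ) (ι ω)
  have h2 := hasDerivAt_pow_add ((LinearMap.applyₗ (1 : C(X, ℝ))) ∘ₗ S.calculus.I) p (ι θ) (ι ω)
  have hp : ((p + 1 : ℕ) : ℝ) + 1 ≠ 0 := by positivity
  have h3 := h1.div (h2.const_mul (((p + 1 : ℕ) : ℝ) + 1)) (by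
    simp only [zero_smul, add_zero, LinearMap.comp_apply, LinearMap.applyₗ_apply_apply]
    rw [← vol_eq]; exact mul_ne_zero hp hω)
  rw [nablaEnergy, energy_eq]
  refine (HasDerivAt.deriv (h3.congr_of_eventuallyEq ?_)).trans ?_
  · filter_upwards with t
    rw [energy_eq, vol_eq]
    simp only [LinearMap.comp_apply, LinearMap.applyₗ_apply_apply, Pi.div_apply, map_add, map_smul]
    rw [div_eq_inv_mul, add_right_comm]
  · simp only [zero_smul, add_zero, LinearMap.comp_apply, LinearMap.applyₗ_apply_apply]
    rw [← vol_eq]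
    push_cast at hp ⊢
    have hp' : (p : ℝ) + 2 ≠ 0 := by positivity
    field_simp
    ring

end Setup

end

/-! ### Masses, the derivative of the energy, elementary bounds -/

section

namespace Calculus

variable {X : Type*} [TopologicalSpace X]
  {R : Type*} [CommRing R] [Algebra ℝ R] [Preorder R]
  {D : Submodule ℝ C(X, ℝ)} (K : Calculus D R)

/-- The constant functions, as test functions. -/
def const (c : ℝ) : D := c • ⟨1, K.one_mem⟩

@[simp] lemma coe_const (c : ℝ) : (K.const c : C(X, ℝ)) = c • 1 := rfl

@[simp] lemma d_const (c : ℝ) : K.d (K.const c) = 0 := by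
  rw [const, map_smul, d_one, smul_zero]

/-- Exact forms have mass zero, so total masses depend on Bott–Chern classes only. -/
lemma mass_pow (Q w : R) (φ : D) (i : ℕ) : K.I (Q * (w + K.d φ) ^ i) 1 = K.I (Q * w ^ i) 1 := by
  induction i generalizing Q with
  | zero => simp
  | succ i ih =>
    have e : Q * (w + K.d φ) * w ^ i = Q * w ^ (i + 1) + K.d φ * (Q * w ^ i) := by ring
    rw [pow_succ', ← mul_assoc, ih, e, map_add, LinearMap.add_apply, I_mul_d_one, add_zero]

lemma mass_mixed (Q w : R) (φ ψ : D) (i j : ℕ) :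
    K.I (Q * ((w + K.d φ) ^ i * (w + K.d ψ) ^ j)) 1 = K.I (Q * w ^ (i + j)) 1 := by
  rw [← mul_assoc, mass_pow, mul_right_comm, mass_pow, mul_right_comm, mul_assoc, ← pow_add]

lemma mass_hom (Q w : R) (φ ψ : D) (k : ℕ) :
    K.I (Q * hom k (w + K.d φ) (w + K.d ψ)) 1 = ((k : ℝ) + 1) * K.I (Q * w ^ k) 1 := by
  rw [hom_eq_sum, Finset.mul_sum, map_sum, LinearMap.sum_apply,
    Finset.sum_congr rfl (g := fun _ => K.I (Q * w ^ k) 1)]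
  · simp
  · intro i hi
    rw [mass_mixed, Nat.add_sub_cancel' (Nat.lt_succ_iff.1 (Finset.mem_range.1 hi))]

lemma mass_pow' (w : R) (φ : D) (i : ℕ) : K.I ((w + K.d φ) ^ i) 1 = K.I (w ^ i) 1 := by
  simpa using K.mass_pow 1 w φ i

lemma E_add_const (p : ℕ) (w : R) (φ : D) (c : ℝ) :
    K.E p w (φ + K.const c) = K.E p w φ + c * K.I (w ^ (p + 1)) 1 := by
  have h := K.E_sub p w (φ + K.const c) φ
  have hm := K.mass_hom 1 w φ φ (p + 1)
  simp only [one_mul] at hm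
  rw [map_add, d_const, add_zero, add_sub_cancel_left, coe_const, map_smul, smul_eq_mul, hm] at h
  have hp : (p : ℝ) + 2 ≠ 0 := by positivity
  have : ((p : ℝ) + 2)⁻¹ * (c * (((p + 1 : ℕ) + 1 : ℝ) * K.I (w ^ (p + 1)) 1)) =
      c * K.I (w ^ (p + 1)) 1 := by push_cast; field_simp; ring
  linarith

/-- The derivative of the energy in the direction `θ`. -/
def nab (p : ℕ) (w θ : R) (φ : D) : ℝ :=
  K.I (θ * hom p (w + K.d φ) w) φ - ((p : ℝ) + 1) * K.I (θ * w ^ p) 1 * K.E p w φ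

/-- By `cocycle` only mixed products of the forms of φ and ψ remain, tested against φ - ψ. The
second term subtracts their total mass times the energy difference, which is the shape estimated in
`abs_mixed_sub_le`. -/
lemma nab_sub (p : ℕ) (w θ : R) (φ ψ : D) : K.nab p w θ φ - K.nab p w θ ψ =
    K.I (θ * hom p (w + K.d φ) (w + K.d ψ)) ((φ - ψ : D) : C(X, ℝ)) -
      ((p : ℝ) + 1) * K.I (θ * w ^ p) 1 * (K.E p w φ - K.E p w ψ) := by
  rw [nab, nab, ← K.cocycle]; ring

lemma nab_add_const (p : ℕ) {w : R} (hw : K.I (w ^ (p + 1)) 1 = 1) (θ : R) (φ : D) (c : ℝ) :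
    K.nab p w θ (φ + K.const c) = K.nab p w θ φ := by
  have h := K.nab_sub p w θ (φ + K.const c) φ
  rw [E_add_const, hw, map_add, d_const, add_zero, add_sub_cancel_left, coe_const, map_smul,
    smul_eq_mul, mass_hom] at h
  linarith

lemma nab_add_left (p : ℕ) (w θ θ' : R) (φ : D) :
    K.nab p w (θ + θ') φ = K.nab p w θ φ + K.nab p w θ' φ := by
  simp only [nab, add_mul, map_add, LinearMap.add_apply]; ring

lemma nab_smul_left (p : ℕ) (w θ : R) (c : ℝ) (φ : D) :
    K.nab p w (c • θ) φ = c * K.nab p w θ φ := by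
  simp only [nab, smul_mul_assoc, map_smul, LinearMap.smul_apply, smul_eq_mul]; ring

variable [IsOrderedAddMonoid R] [PosMulMono R] [MulPosMono R] [ZeroLEOneClass R] [PosSMulMono ℝ R]

lemma abs_I_le {P : R} (hP : 0 ≤ P) {f : C(X, ℝ)} {c : ℝ} (hf : ∀ x, |f x| ≤ c) :
    |K.I P f| ≤ c * K.I P 1 := by
  have h1 := K.I_mono_right hP (f := f) (g := c • 1) (fun x => by
    simpa using (abs_le.1 (hf x)).2)
  have h2 := K.I_mono_right hP (f := (-c) • 1) (g := f) (fun x => by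
    simpa using (abs_le.1 (hf x)).1)
  rw [map_smul, smul_eq_mul] at h1 h2
  exact abs_le.2 ⟨by linarith, h1⟩

lemma abs_I_mul_le {θ w : R} {C : ℝ} (h1 : θ ≤ C • w) (h2 : -θ ≤ C • w) {Q : R} (hQ : 0 ≤ Q)
    {f : C(X, ℝ)} (hf : 0 ≤ f) : |K.I (θ * Q) f| ≤ C * K.I (w * Q) f := by
  have a1 := K.I_mono (mul_le_mul_of_nonneg_right h1 hQ) hf
  have a2 := K.I_mono (mul_le_mul_of_nonneg_right h2 hQ) hf
  simp only [smul_mul_assoc, neg_mul, map_smul, map_neg, LinearMap.smul_apply,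
    LinearMap.neg_apply, smul_eq_mul] at a1 a2
  exact abs_le.2 ⟨by linarith, a1⟩

lemma abs_I_mul_le' {θ w : R} {C : ℝ} (h1 : θ ≤ C • w) (h2 : -θ ≤ C • w) {Q : R} (hQ : 0 ≤ Q)
    {f : C(X, ℝ)} (hf : f ≤ 0) : |K.I (θ * Q) f| ≤ C * K.I (w * Q) (-f) := by
  have := K.abs_I_mul_le h1 h2 hQ (neg_nonneg.2 hf)
  rwa [map_neg, abs_neg] at this

lemma zero_le_one' : (0 : C(X, ℝ)) ≤ 1 := fun _ => zero_le_one

lemma abs_I_hom_le (p : ℕ) {w : R} (hw : 0 ≤ w) {θ : R} {C : ℝ} (hC : 0 ≤ C) (h1 : θ ≤ C • w)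
    (h2 : -θ ≤ C • w) {φ : D} (hφ : 0 ≤ w + K.d φ) (h0 : (φ : C(X, ℝ)) ≤ 0) :
    |K.I (θ * hom p (w + K.d φ) w) φ| ≤ C * (((p : ℝ) + 2) * -K.E p w φ) := by
  have hp : (p : ℝ) + 2 ≠ 0 := by positivity
  refine (K.abs_I_mul_le' h1 h2 (hom_nonneg p hφ hw) h0).trans ?_
  gcongr
  have : w * hom p (w + K.d φ) w ≤ hom (p + 1) (w + K.d φ) w := by
    rw [hom_succ']; exact le_add_of_nonneg_right (pow_nonneg hφ _)
  refine (K.I_mono this (neg_nonneg.2 h0)).trans_eq ?_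
  rw [E, map_neg]; field_simp

lemma abs_mass_le (p : ℕ) {w : R} (hw : 0 ≤ w) {θ : R} {C : ℝ} (h1 : θ ≤ C • w)
    (h2 : -θ ≤ C • w) : |K.I (θ * w ^ p) 1| ≤ C * K.I (w ^ (p + 1)) 1 := by
  rw [pow_succ']
  exact K.abs_I_mul_le h1 h2 (pow_nonneg hw p) zero_le_one'

lemma abs_nab_le (p : ℕ) {w : R} (hw : 0 ≤ w) (hw1 : K.I (w ^ (p + 1)) 1 = 1) {θ : R} {C : ℝ}
    (hC : 0 ≤ C) (h1 : θ ≤ C • w) (h2 : -θ ≤ C • w) {φ : D} (hφ : 0 ≤ w + K.d φ)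
    (h0 : (φ : C(X, ℝ)) ≤ 0) {M : ℝ} (hM : -K.E p w φ ≤ M) :
    |K.nab p w θ φ| ≤ (2 * (p : ℝ) + 3) * C * M := by
  have a1 := K.abs_I_hom_le p hw hC h1 h2 hφ h0
  have a2 := K.abs_mass_le p hw h1 h2
  rw [hw1, mul_one] at a2
  have hE := K.E_nonpos p hw hφ h0
  have a3 : |((p : ℝ) + 1) * K.I (θ * w ^ p) 1 * K.E p w φ| ≤ ((p : ℝ) + 1) * C * M := by
    rw [abs_mul, abs_mul, abs_of_nonneg (by positivity : (0 : ℝ) ≤ (p : ℝ) + 1),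
      abs_of_nonpos hE]
    gcongr
    linarith
  have a4 : C * (((p : ℝ) + 2) * -K.E p w φ) ≤ C * (((p : ℝ) + 2) * M) := by gcongr
  calc _ ≤ _ := abs_sub _ _
    _ ≤ C * (((p : ℝ) + 2) * M) + ((p : ℝ) + 1) * C * M := add_le_add (a1.trans a4) a3
    _ = _ := by ring

/-- Weak Lipschitz continuity of the Monge–Ampère operator. -/
lemma abs_I_pow_sub_le (p : ℕ) {w : R} {φ τ : D} (hφ : 0 ≤ w + K.d φ)
    (hτ : 0 ≤ w + K.d τ) (f : D) {θ₁ θ₂ : R} (hθ₁ : 0 ≤ θ₁) (hθ₂ : 0 ≤ θ₂)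
    (hf : K.d f = θ₁ - θ₂) {κ : ℝ}
    (hκ : ∀ x, |((τ - φ : D) : C(X, ℝ)) x| ≤ κ) :
    |K.I ((w + K.d τ) ^ (p + 1)) f - K.I ((w + K.d φ) ^ (p + 1)) f| ≤
      κ * (((p : ℝ) + 1) * (K.I (θ₁ * w ^ p) 1 + K.I (θ₂ * w ^ p) 1)) := by
  have hom0 := hom_nonneg p hτ hφ
  -- Moving d onto the fixed function f leaves τ - φ undifferentiated, so only its sup norm matters.
  rw [K.pow_mul_d, K.symm, hf, sub_mul, map_sub, LinearMap.sub_apply]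
  have a1 := K.abs_I_le (mul_nonneg hθ₁ hom0) hκ
  have a2 := K.abs_I_le (mul_nonneg hθ₂ hom0) hκ
  rw [mass_hom] at a1 a2
  calc _ ≤ _ := abs_sub _ _
    _ ≤ _ := add_le_add a1 a2
    _ = _ := by ring

lemma I_add_pow_le (p : ℕ) {w : R} (hw : 0 ≤ w) {φ : D} (hφ : 0 ≤ w + K.d φ)
    (h0 : (φ : C(X, ℝ)) ≤ 0) :
    K.I (((w + K.d φ) + w) ^ (p + 1)) (-(φ : C(X, ℝ))) ≤
      2 ^ (p + 1) * (((p : ℝ) + 2) * -K.E p w φ) := by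
  have hh := K.nonneg_smul_d hw hφ (s := 1 / 2) (by norm_num) (by norm_num)
  have hh0 : (((1 / 2 : ℝ) • φ : D) : C(X, ℝ)) ≤ 0 := by
    intro x; have := h0 x; simp at this ⊢; linarith
  have a2 : K.I (((w + K.d φ) + w) ^ (p + 1)) (-(φ : C(X, ℝ))) =
      2 ^ (p + 1) * (2 * K.I ((w + K.d ((1 / 2 : ℝ) • φ)) ^ (p + 1))
        (-(((1 / 2 : ℝ) • φ : D) : C(X, ℝ)))) := by
    rw [← half_two_smul, smul_pow]; simp
  have a3 := K.I_pow_neg_le p hw hh hh0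
  have a4 := K.E_smul_ge p hw hφ (s := 1 / 2) (by norm_num) (by norm_num)
  have hp : (0 : ℝ) < (p : ℝ) + 2 := by positivity
  calc _ ≤ 2 ^ (p + 1) * (2 * (((p : ℝ) + 2) * -(1 / 2 * K.E p w φ))) := by
        rw [a2]; gcongr; refine a3.trans ?_; gcongr
    _ = _ := by ring

/-! ### Comparison of two forms -/

lemma hom_smul_smul (k : ℕ) (c : ℝ) (a b : R) : hom k (c • a) (c • b) = c ^ k • hom k a b := by
  rw [Algebra.smul_def, Algebra.smul_def, hom_mul_mul, Algebra.smul_def, map_pow]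

/-- Monotonicity reduces to w₁ = k w, where kw + dφ = k (w + d(φ/k)); homogeneity and concavity
along the ray to φ/k then give the power of k. -/
lemma E_ge_of_le_smul (p : ℕ) {w w₁ : R} {k : ℝ} (hk : 1 ≤ k) (hw : 0 ≤ w) (h1 : w ≤ w₁)
    (h2 : w₁ ≤ k • w) {φ : D} (hφ : 0 ≤ w + K.d φ) (h0 : (φ : C(X, ℝ)) ≤ 0) :
    k ^ (p + 1) * K.E p w φ ≤ K.E p w₁ φ := by
  have hk0 : k ≠ 0 := by positivity
  have hmono : hom (p + 1) (w₁ + K.d φ) w₁ ≤ hom (p + 1) (k • w + K.d φ) (k • w) :=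
    hom_mono _ (hφ.trans (by gcongr)) (hw.trans h1) (by gcongr) h2
  have e1 : k • w + K.d φ = k • (w + K.d (k⁻¹ • φ)) := by
    rw [map_smul, smul_add, smul_smul, mul_inv_cancel₀ hk0, one_smul]
  have a1 := K.I_mono hmono (neg_nonneg.2 h0)
  have a2 := K.E_smul_ge p hw hφ (s := k⁻¹) (by positivity) (inv_le_one_of_one_le₀ hk)
  have hp : (0 : ℝ) < (p : ℝ) + 2 := by positivity
  rw [e1, hom_smul_smul, map_smul, LinearMap.smul_apply, smul_eq_mul, map_neg, map_neg] at a1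
  have e2 : K.I (hom (p + 1) (w + K.d (k⁻¹ • φ)) w) φ =
      k * (((p : ℝ) + 2) * K.E p w (k⁻¹ • φ)) := by
    rw [E, Submodule.coe_smul, map_smul (K.I _), smul_eq_mul]; field_simp
  have e3 : K.I (hom (p + 1) (w₁ + K.d φ) w₁) φ = ((p : ℝ) + 2) * K.E p w₁ φ := by
    rw [E]; field_simp
  rw [e2, e3] at a1
  have a3 : k * (k⁻¹ * K.E p w φ) ≤ k * K.E p w (k⁻¹ • φ) := by gcongr
  rw [← mul_assoc, mul_inv_cancel₀ hk0, one_mul] at a3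
  have a4 : ((p : ℝ) + 2) * (k ^ (p + 1) * K.E p w φ) ≤ ((p : ℝ) + 2) * K.E p w₁ φ := by
    have : k ^ (p + 1) * K.E p w φ ≤ k ^ (p + 1) * (k * K.E p w (k⁻¹ • φ)) := by gcongr
    nlinarith
  exact le_of_mul_le_mul_left a4 hp

lemma E_le_of_le (p : ℕ) {w w₁ : R} (hw : 0 ≤ w) (h1 : w ≤ w₁)
    {φ : D} (hφ : 0 ≤ w + K.d φ) (h0 : (φ : C(X, ℝ)) ≤ 0) : K.E p w₁ φ ≤ K.E p w φ := by
  have hmono : hom (p + 1) (w + K.d φ) w ≤ hom (p + 1) (w₁ + K.d φ) w₁ :=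
    hom_mono _ hφ hw (by gcongr) h1
  have a1 := K.I_mono hmono (neg_nonneg.2 h0)
  rw [map_neg, map_neg, neg_le_neg_iff] at a1
  unfold E; gcongr

/-- Products of nonnegative increasing convex functions are convex: the defect is σ(1 - σ)(f₁ -
f₀)(g₁ - g₀). -/
lemma convex_mul {σ : ℝ} (hσ0 : 0 ≤ σ) (hσ1 : σ ≤ 1) {f f₀ f₁ g g₀ g₁ : R} (hf : f₀ ≤ f₁)
    (hg : g₀ ≤ g₁) (hf0 : 0 ≤ f) (hg0 : 0 ≤ g₀) (h1 : f ≤ (1 - σ) • f₀ + σ • f₁)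
    (h2 : g ≤ (1 - σ) • g₀ + σ • g₁) :
    f * g ≤ (1 - σ) • (f₀ * g₀) + σ • (f₁ * g₁) := by
  have hg1 : 0 ≤ (1 - σ) • g₀ + σ • g₁ :=
    add_nonneg (smul_nonneg (by linarith) hg0) (smul_nonneg hσ0 (hg0.trans hg))
  refine ((mul_le_mul_of_nonneg_left h2 hf0).trans (mul_le_mul_of_nonneg_right h1 hg1)).trans ?_
  rw [← sub_nonneg]
  have : (1 - σ) • (f₀ * g₀) + σ • (f₁ * g₁) -
      ((1 - σ) • f₀ + σ • f₁) * ((1 - σ) • g₀ + σ • g₁) =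
      (σ * (1 - σ)) • ((f₁ - f₀) * (g₁ - g₀)) := by
    simp only [Algebra.smul_def, map_sub, map_mul, map_one]; ring
  rw [this]
  exact smul_nonneg (mul_nonneg hσ0 (by linarith))
    (mul_nonneg (sub_nonneg.2 hf) (sub_nonneg.2 hg))

/-- Convexity in σ turns a crude bound at σ = 1 into an increment linear in σ. -/
lemma hom_convex (k : ℕ) {σ : ℝ} (hσ0 : 0 ≤ σ) (hσ1 : σ ≤ 1) {a b c : R} (ha : 0 ≤ a) (hb : 0 ≤ b)
    (hc : 0 ≤ c) : hom k (a + σ • c) (b + σ • c) ≤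
      (1 - σ) • hom k a b + σ • hom k (a + c) (b + c) := by
  have hσc : 0 ≤ σ • c := smul_nonneg hσ0 hc
  have e (x : R) : x + σ • c = (1 - σ) • x + σ • (x + c) := by module
  have hp (j : ℕ) : (b + σ • c) ^ j ≤ (1 - σ) • b ^ j + σ • (b + c) ^ j := by
    induction j with
    | zero => apply le_of_eq; simp only [pow_zero]; module
    | succ j ih =>
      rw [pow_succ', pow_succ', pow_succ']
      exact convex_mul hσ0 hσ1 (le_add_of_nonneg_right hc)
        (pow_le_pow_left₀ hb (le_add_of_nonneg_right hc) _) (add_nonneg hb hσc)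
        (pow_nonneg hb _) (e b).le ih
  induction k with
  | zero => apply le_of_eq; simp only [hom]; module
  | succ k ih =>
    have h1 := convex_mul hσ0 hσ1 (le_add_of_nonneg_right hc)
      (hom_mono k ha hb (le_add_of_nonneg_right hc) (le_add_of_nonneg_right hc))
      (add_nonneg ha hσc) (hom_nonneg k ha hb) (e a).le ih
    refine (add_le_add h1 (hp (k + 1))).trans_eq ?_
    rw [hom, hom]; module

/-- Variation of the mixed integrals with the form `w`. -/
lemma abs_I_hom_sub_le (p : ℕ) {w w₁ : R} {σ s : ℝ} (hσ0 : 0 ≤ σ) (hσ1 : σ ≤ 1) (hs : 0 ≤ s)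
    (hw : 0 ≤ w) (h1 : w ≤ w₁) (h2 : w₁ ≤ w + σ • s • w) {θ : R} {C : ℝ} (hC : 0 ≤ C)
    (hθ1 : θ ≤ C • w) (hθ2 : -θ ≤ C • w) {φ : D} (hφ : 0 ≤ w + K.d φ) (h0 : (φ : C(X, ℝ)) ≤ 0) :
    |K.I (θ * hom p (w₁ + K.d φ) w₁) φ - K.I (θ * hom p (w + K.d φ) w) φ| ≤
      C * (σ * (((p : ℝ) + 1) * (1 + s) ^ p * (2 ^ (p + 1) * (((p : ℝ) + 2) * -K.E p w φ)))) := by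
  set a := w + K.d φ with ha
  have hsw : 0 ≤ s • w := smul_nonneg hs hw
  have hmono : hom p a w ≤ hom p (w₁ + K.d φ) w₁ := hom_mono _ hφ hw (by rw [ha]; gcongr) h1
  have hle : hom p (w₁ + K.d φ) w₁ - hom p a w ≤
      σ • (((p : ℝ) + 1) * (1 + s) ^ p) • (a + w) ^ p := by
    have b1 : hom p (w₁ + K.d φ) w₁ ≤ hom p (a + σ • s • w) (w + σ • s • w) := by
      refine hom_mono _ (hφ.trans (by rw [ha]; gcongr)) (hw.trans h1) ?_ h2
      rw [ha, add_right_comm]; gcongr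
    have b2 := hom_convex p hσ0 hσ1 hφ hw hsw
    have b3 : hom p (a + s • w) (w + s • w) ≤ (((p : ℝ) + 1) * (1 + s) ^ p) • (a + w) ^ p := by
      have c1 : a + s • w ≤ (1 + s) • (a + w) := by
        rw [← sub_nonneg, show (1 + s) • (a + w) - (a + s • w) = s • a + w by module]
        exact add_nonneg (smul_nonneg hs hφ) hw
      have c2 : w + s • w ≤ (1 + s) • (a + w) := by
        rw [← sub_nonneg, show (1 + s) • (a + w) - (w + s • w) = (1 + s) • a by module]
        exact smul_nonneg (by linarith) hφ
      refine (hom_le p (add_nonneg hφ hsw) (add_nonneg hw hsw) c1 c2).trans_eq ?_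
      rw [natCast_add_one_mul, smul_pow, smul_smul]
    have b4 : 0 ≤ σ • hom p a w := smul_nonneg hσ0 (hom_nonneg p hφ hw)
    have b5 := smul_le_smul_of_nonneg_left b3 hσ0
    have b6 := b1.trans (b2.trans (add_le_add le_rfl b5))
    rw [sub_le_iff_le_add]
    refine b6.trans ?_
    rw [← sub_nonneg]
    refine b4.trans_eq ?_
    module
  rw [← LinearMap.sub_apply, ← map_sub, ← mul_sub]
  refine (K.abs_I_mul_le' hθ1 hθ2 (sub_nonneg.2 hmono) h0).trans ?_
  gcongr
  have c0 : 0 ≤ a + w := add_nonneg hφ hw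
  have d1 : w * (hom p (w₁ + K.d φ) w₁ - hom p a w) ≤
      (σ * (((p : ℝ) + 1) * (1 + s) ^ p)) • (a + w) ^ (p + 1) := by
    refine (mul_le_mul_of_nonneg_left hle hw).trans ?_
    rw [smul_smul, mul_smul_comm, pow_succ']
    refine smul_le_smul_of_nonneg_left ?_ (by positivity)
    exact mul_le_mul_of_nonneg_right (le_add_of_nonneg_left hφ) (pow_nonneg c0 _)
  refine (K.I_mono d1 (neg_nonneg.2 h0)).trans ?_
  rw [map_smul, LinearMap.smul_apply, smul_eq_mul]
  have d2 := K.I_add_pow_le p hw hφ h0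
  calc _ ≤ (σ * (((p : ℝ) + 1) * (1 + s) ^ p)) * (2 ^ (p + 1) * (((p : ℝ) + 2) * -K.E p w φ)) := by
        gcongr
    _ = _ := by ring

end Calculus

end

/-! ### Polarizations and positivity of the volume -/

section

namespace Setup

open FormAlg

section Polarization

variable {n : ℕ} {X : Type*} [TopologicalSpace X] [CompactSpace X] [T2Space X]
  {Z : Type*} [AddCommGroup Z] [Module ℝ Z] [PartialOrder Z] [IsOrderedAddMonoid Z]
  [PosSMulMono ℝ Z] (S : Setup n X Z)

lemma nonempty_space (S : Setup n X Z) : Nonempty X := by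
  by_contra h
  rw [not_nonempty_iff] at h
  refine S.wedge_ne_zero (MultilinearMap.ext fun θ => ?_)
  refine DFunLike.ext _ _ fun f => ?_
  rw [show f = 0 from ContinuousMap.ext fun x => h.elim x]
  simp

lemma exists_sub (S : Setup n X Z) (z : Z) : ∃ θ₁ θ₂ : Z, 0 ≤ θ₁ ∧ 0 ≤ θ₂ ∧ z = θ₁ - θ₂ := by
  have hz : z ∈ Submodule.span ℝ {θ : Z | 0 ≤ θ} := by rw [S.span_pos]; trivial
  induction hz using Submodule.span_induction with
  | mem x hx => exact ⟨x, 0, hx, le_rfl, by simp⟩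
  | zero => exact ⟨0, 0, le_rfl, le_rfl, by simp⟩
  | add x y _ _ hx hy =>
    obtain ⟨a, b, ha, hb, rfl⟩ := hx
    obtain ⟨c, d, hc, hd, rfl⟩ := hy
    exact ⟨a + c, b + d, add_nonneg ha hc, add_nonneg hb hd, by abel⟩
  | smul c x _ hx =>
    obtain ⟨a, b, ha, hb, rfl⟩ := hx
    rcases le_total 0 c with hc | hc
    · exact ⟨c • a, c • b, smul_nonneg hc ha, smul_nonneg hc hb, smul_sub _ _ _⟩
    · refine ⟨(-c) • b, (-c) • a, smul_nonneg (by linarith) hb, smul_nonneg (by linarith) ha, ?_⟩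
      module

/-- An interior point for the finest topology can be moved slightly in any direction: the trace of
the open set on the combinations of [ω] and [θ] contains [ω] + ε[θ] for small ε, and a class in the
image of the cone has a nonnegative representative. -/
lemma IsPolarization.exists_nonneg {S : Setup n X Z} {ω : Z} (hω : S.IsPolarization ω) (θ : Z) :
    ∃ ε : ℝ, 0 < ε ∧ ∃ f : S.D, 0 ≤ ω + ε • θ + S.ddc f := by
  obtain ⟨U, hU, hUo, hωU⟩ := (@mem_interior _ (finestTopology S.HBC) _ _).1 hω.2
  let L : (Fin 2 → ℝ) →ₗ[ℝ] S.HBC :=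
    (LinearMap.proj 0).smulRight (S.cls ω) + (LinearMap.proj 1).smulRight (S.cls θ)
  have h1 : IsOpen (L ⁻¹' U) := by
    have := isOpen_iSup_iff.1 (isOpen_iSup_iff.1 hUo 2) L
    exact isOpen_coinduced.1 this
  have hc : Continuous fun t : ℝ => (![1, t] : Fin 2 → ℝ) := by
    refine continuous_pi fun i => ?_
    fin_cases i
    · exact continuous_const
    · exact continuous_id
  have h2 := h1.preimage hc
  have h3 : (0 : ℝ) ∈ (fun t : ℝ => (![1, t] : Fin 2 → ℝ)) ⁻¹' (L ⁻¹' U) := by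
    simpa [L] using hωU
  obtain ⟨ε, hε, hball⟩ := Metric.isOpen_iff.1 h2 0 h3
  have h4 : ε / 2 ∈ Metric.ball (0 : ℝ) ε := by
    simp [abs_of_pos hε, hε]
  obtain ⟨z, hz, hzL⟩ := hU (hball h4)
  have h5 : S.cls z = S.cls (ω + (ε / 2) • θ) := by
    rw [hzL]
    simp only [L, LinearMap.add_apply, LinearMap.smulRight_apply, LinearMap.proj_apply]
    simp [cls]
  obtain ⟨f, hf⟩ := (Submodule.Quotient.eq _).1 h5
  refine ⟨ε / 2, by positivity, f, ?_⟩
  rw [hf]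
  simpa using hz

lemma smul_list_prod_le {ε : ℝ} (hε : 0 ≤ ε) {v : FormAlg Z} (hv : 0 ≤ v) {l : List Z}
    (hl : ∀ θ ∈ l, 0 ≤ θ) (h : ∀ θ ∈ l, ε • ι θ ≤ v) :
    0 ≤ (l.map ι).prod ∧ ε ^ l.length • (l.map ι).prod ≤ v ^ l.length := by
  induction l with
  | nil => simp [zero_le_one]
  | cons θ l ih =>
    obtain ⟨h0, h1⟩ := ih (fun x hx => hl x (List.mem_cons_of_mem _ hx))
      (fun x hx => h x (List.mem_cons_of_mem _ hx))
    have hθ := ι_nonneg (hl θ List.mem_cons_self)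
    simp only [List.map_cons, List.prod_cons, List.length_cons]
    refine ⟨mul_nonneg hθ h0, ?_⟩
    rw [pow_succ', mul_smul, pow_succ', ← mul_smul_comm, ← smul_mul_assoc]
    exact mul_le_mul (h θ List.mem_cons_self) h1 (smul_nonneg (pow_nonneg hε _) h0) hv

lemma list_prod_eq_sub (S : Setup n X Z) (l : List Z) :
    ∃ P Q : FormAlg Z, 0 ≤ P ∧ 0 ≤ Q ∧ (l.map ι).prod = P - Q := by
  induction l with
  | nil => exact ⟨1, 0, zero_le_one, le_rfl, by simp⟩
  | cons θ l ih =>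
    obtain ⟨P, Q, hP, hQ, e⟩ := ih
    obtain ⟨a, b, ha, hb, rfl⟩ := S.exists_sub θ
    have ha' := ι_nonneg ha
    have hb' := ι_nonneg hb
    refine ⟨ι a * P + ι b * Q, ι a * Q + ι b * P, add_nonneg (mul_nonneg ha' hP)
      (mul_nonneg hb' hQ), add_nonneg (mul_nonneg ha' hQ) (mul_nonneg hb' hP), ?_⟩
    simp only [List.map_cons, List.prod_cons, e, map_sub]
    ring

lemma vol_nonneg {ω : Z} (hω : 0 ≤ ω) : 0 ≤ S.vol ω := by
  rw [vol_eq]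
  exact S.calculus.pos _ (pow_nonneg (ι_nonneg hω) _) _ (fun _ => zero_le_one)

/-- Finitely many positive forms, scaled by some ε > 0, are all dominated by one representative of
[ω]. If the volume vanished, all products of n positive forms would have mass zero, and since the
positive cone spans, the wedge product would vanish. -/
lemma IsPolarization.vol_pos {S : Setup n X Z} {ω : Z} (hω : S.IsPolarization ω) :
    0 < S.vol ω := by
  refine (S.vol_nonneg hω.1).lt_of_ne fun h0 => S.wedge_ne_zero ?_
  have key (l : List Z) (hl : ∀ θ ∈ l, 0 ≤ θ) : S.calculus.I (l.map ι).prod 1 = 0 := by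
    by_cases hn : l.length = n
    swap
    · rw [calculus_I, S.wedgeAlg_list_of_ne hn]; rfl
    obtain ⟨ε, hε, f, hf⟩ := hω.exists_nonneg (-l.sum)
    have hv : ∀ θ ∈ l, ε • ι θ ≤ ι ω + S.calculus.d f := by
      intro θ hθ
      rw [calculus_d, ← map_add, ← map_smul]
      apply ι_mono
      have h1 : θ ≤ l.sum := List.single_le_sum hl θ hθ
      have h2 := smul_le_smul_of_nonneg_left h1 hε.le
      refine h2.trans (sub_nonneg.1 (hf.trans_eq ?_))
      rw [smul_neg]; abel
    have hv0 : 0 ≤ ι ω + S.calculus.d f := by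
      rw [calculus_d, ← map_add]
      apply ι_nonneg
      have h2 : 0 ≤ ε • l.sum := smul_nonneg hε.le (List.sum_nonneg hl)
      refine h2.trans (sub_nonneg.1 (hf.trans_eq ?_))
      rw [smul_neg]; abel
    obtain ⟨h1, h2⟩ := smul_list_prod_le hε.le hv0 hl hv
    have h3 := S.calculus.I_mono h2 (f := 1) (fun _ => zero_le_one)
    have h4 := S.calculus.pos _ h1 1 (fun _ => zero_le_one)
    rw [S.calculus.mass_pow', hn, ← vol_eq, ← h0, map_smul, LinearMap.smul_apply,
      smul_eq_mul] at h3
    have : 0 < ε ^ n := by positivity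
    exact le_antisymm (by nlinarith) h4
  have hI {P : FormAlg Z} (hP : 0 ≤ P) (f : C(X, ℝ)) : S.calculus.I P f = 0 := by
    refine nonneg_induction (p := fun P => S.calculus.I P f = 0) (by simp) ?_ ?_ hP
    · intro P Q hP hQ
      rw [map_add, LinearMap.add_apply, hP, hQ, add_zero]
    · intro c l hc hl
      have h1 : 0 ≤ (l.map (ι (Z := Z))).prod := by
        have := smul_list_prod_le (ε := 0) le_rfl le_rfl hl
          (by intro θ _; simp only [zero_smul]; exact le_rfl)
        exact this.1
      have h2 := S.calculus.abs_I_le h1 (f := f) (c := ‖f‖) (fun x => f.norm_coe_le_norm x)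
      rw [key l hl, mul_zero, abs_nonpos_iff] at h2
      rw [map_smul, LinearMap.smul_apply, h2, smul_zero]
  refine MultilinearMap.ext fun θ => ?_
  refine DFunLike.ext _ _ fun f => ?_
  obtain ⟨P, Q, hP, hQ, e⟩ := S.list_prod_eq_sub (List.ofFn θ)
  rw [← S.wedgeAlg_prod, ← calculus_I, ← List.prod_ofFn,
    show (List.ofFn fun i => ι (θ i)) = (List.ofFn θ).map (ι (Z := Z)) from List.map_ofFn.symm, e,
      map_sub,
    LinearMap.sub_apply, hI hP, hI hQ, sub_zero]
  rfl

end Polarization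

end Setup

end

/-! ### Normalised energy, near maximizers and orthogonality -/

section

namespace Setup

open FormAlg

variable {p : ℕ} {X : Type*} [TopologicalSpace X] [CompactSpace X] [T2Space X]
  {Z : Type*} [AddCommGroup Z] [Module ℝ Z] [PartialOrder Z] [IsOrderedAddMonoid Z]
  [PosSMulMono ℝ Z] (S : Setup (p + 1) X Z) {ω : Z}

/-- The energy calculus normalised by the volume of `ω`. -/
def ncalc {S : Setup (p + 1) X Z} (hω : S.IsPolarization ω) : Calculus S.D (FormAlg Z) :=
  S.calculus.scale (S.vol ω)⁻¹ (inv_nonneg.2 hω.vol_pos.le)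

/-- The constant `c` as a test function. -/
def cst (c : ℝ) : S.D := S.calculus.const c

/-- `T` bounds the submean value constant. -/
def IsSubmeanBound (ω : Z) (T : ℝ) : Prop :=
  ∀ φ ∈ S.psh ω, ∀ x, (φ : C(X, ℝ)) x - S.refMeasure ω φ ≤ T

/-- `j` bounds the energy of `μ`. -/
def IsEnergyBound (ω : Z) (μ : SignedRadon X) (j : ℝ) : Prop :=
  ∀ ρ ∈ S.psh ω, S.energy ω ρ - μ (ρ : C(X, ℝ)) ≤ j

/-- The functions computing the energy of `μ` up to `ε`. -/
def nearMax (ω : Z) (μ : SignedRadon X) (j ε : ℝ) : Set S.D :=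
  {χ | χ ∈ S.psh ω ∧ j - ε ≤ S.energy ω χ - μ (χ : C(X, ℝ))}

/-- `μ` has energy `j`. -/
structure HasEnergy (ω : Z) (μ : SignedRadon X) (j : ℝ) : Prop where
  bound : S.IsEnergyBound ω μ j
  nonempty : ∀ ε, 0 < ε → (S.nearMax ω μ j ε).Nonempty

variable {S}

lemma ncalc_I (hω : S.IsPolarization ω) (P : FormAlg Z) (f : C(X, ℝ)) :
    (ncalc hω).I P f = (S.vol ω)⁻¹ * S.calculus.I P f := rfl

@[simp] lemma ncalc_d (hω : S.IsPolarization ω) (φ : S.D) : (ncalc hω).d φ = S.calculus.d φ := rfl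

lemma ncalc_const (hω : S.IsPolarization ω) (c : ℝ) : (ncalc hω).const c = S.cst c := rfl

lemma ncalc_mass (hω : S.IsPolarization ω) : (ncalc hω).I (ι ω ^ (p + 1)) 1 = 1 := by
  rw [ncalc_I, ← vol_eq]; exact inv_mul_cancel₀ hω.vol_pos.ne'

lemma energy_eq_E (hω : S.IsPolarization ω) (φ : S.D) : S.energy ω φ = (ncalc hω).E p (ι ω) φ := by
  rw [energy_eq, Calculus.E, ncalc_I, ncalc_d, mul_inv]
  push_cast
  ring

lemma MA_eq_I (hω : S.IsPolarization ω) (φ : S.D) (f : C(X, ℝ)) :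
    S.MA ω φ f = (ncalc hω).I ((ι ω + (ncalc hω).d φ) ^ (p + 1)) f := S.MA_eq ω φ f

lemma refMeasure_eq_I (hω : S.IsPolarization ω) (f : C(X, ℝ)) :
    S.refMeasure ω f = (ncalc hω).I (ι ω ^ (p + 1)) f := S.refMeasure_eq ω f

lemma nablaEnergy_eq_nab (hω : S.IsPolarization ω) (θ : Z) (φ : S.D) :
    S.nablaEnergy ω θ φ = (ncalc hω).nab p (ι ω) (ι θ) φ := by
  rw [S.nablaEnergy_eq hω.vol_pos.ne', Calculus.nab, energy_eq_E hω]; rfl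

lemma nonneg_of_psh (hω : S.IsPolarization ω) {φ : S.D} (hφ : φ ∈ S.psh ω) :
    0 ≤ ι ω + (ncalc hω).d φ := by
  rw [ncalc_d, calculus_d, ← map_add]; exact ι_nonneg hφ

lemma ι_pos (hω : S.IsPolarization ω) : 0 ≤ (ι ω : FormAlg Z) := ι_nonneg hω.1

lemma ddc_cst (c : ℝ) : S.ddc (S.cst c) = 0 := by
  have := S.ddc_const c
  rwa [show (⟨ContinuousMap.const X c, S.const_mem c⟩ : S.D) = S.cst c from
    Subtype.ext (ContinuousMap.ext fun x => by simp [cst])] at this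

@[simp] lemma coe_cst (c : ℝ) : (S.cst c : C(X, ℝ)) = c • 1 := rfl

lemma psh_add_cst {φ : S.D} (hφ : φ ∈ S.psh ω) (c : ℝ) : φ + S.cst c ∈ S.psh ω := by
  show 0 ≤ ω + S.ddc (φ + S.cst c)
  rwa [map_add, ddc_cst, add_zero]

lemma zero_mem_psh (hω : 0 ≤ ω) : (0 : S.D) ∈ S.psh ω := by
  show 0 ≤ ω + S.ddc 0
  simpa using hω

lemma smul_mem_psh (hω : 0 ≤ ω) {φ : S.D} (hφ : φ ∈ S.psh ω) {s : ℝ} (hs : 0 ≤ s) (hs1 : s ≤ 1) :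
    s • φ ∈ S.psh ω := by
  show 0 ≤ ω + S.ddc (s • φ)
  have e : ω + S.ddc (s • φ) = s • (ω + S.ddc φ) + (1 - s) • ω := by rw [map_smul]; module
  rw [e]
  exact add_nonneg (smul_nonneg hs hφ) (smul_nonneg (by linarith) hω)

lemma mid_mem_psh {φ ψ : S.D} (hφ : φ ∈ S.psh ω) (hψ : ψ ∈ S.psh ω) :
    (1 / 2 : ℝ) • (φ + ψ) ∈ S.psh ω := by
  show 0 ≤ ω + S.ddc ((1 / 2 : ℝ) • (φ + ψ))
  have e : ω + S.ddc ((1 / 2 : ℝ) • (φ + ψ)) =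
      (1 / 2 : ℝ) • (ω + S.ddc φ) + (1 / 2 : ℝ) • (ω + S.ddc ψ) := by
    rw [map_smul, map_add]; module
  rw [e]
  exact add_nonneg (smul_nonneg (by norm_num) hφ) (smul_nonneg (by norm_num) hψ)

lemma energy_add_cst (hω : S.IsPolarization ω) (φ : S.D) (c : ℝ) :
    S.energy ω (φ + S.cst c) = S.energy ω φ + c := by
  rw [energy_eq_E hω, energy_eq_E hω, ← ncalc_const hω, Calculus.E_add_const, ncalc_mass, mul_one]

lemma nablaEnergy_add_cst (hω : S.IsPolarization ω) (θ : Z) (φ : S.D) (c : ℝ) :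
    S.nablaEnergy ω θ (φ + S.cst c) = S.nablaEnergy ω θ φ := by
  rw [nablaEnergy_eq_nab hω, nablaEnergy_eq_nab hω, ← ncalc_const hω,
    Calculus.nab_add_const _ _ (ncalc_mass hω)]

lemma energy_zero (hω : S.IsPolarization ω) : S.energy ω 0 = 0 := by
  rw [energy_eq_E hω, Calculus.E_zero]

lemma apply_add_cst {μ : SignedRadon X} (hμ : μ 1 = 1) (φ : S.D) (c : ℝ) :
    μ ((φ + S.cst c : S.D) : C(X, ℝ)) = μ (φ : C(X, ℝ)) + c := by
  rw [Submodule.coe_add, coe_cst, map_add, map_smul, hμ, smul_eq_mul, mul_one]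

lemma refMeasure_one (hω : S.IsPolarization ω) : S.refMeasure ω 1 = 1 := by
  rw [refMeasure_eq_I hω, ncalc_mass]

lemma MA_mem_radonProb (hω : S.IsPolarization ω) {φ : S.D} (hφ : φ ∈ S.psh ω) :
    S.MA ω φ ∈ radonProb X := by
  refine ⟨fun f hf => ?_, ?_⟩
  · rw [MA_eq_I hω]
    exact (ncalc hω).pos _ (pow_nonneg (nonneg_of_psh hω hφ) _) f hf
  · rw [MA_eq_I hω, Calculus.mass_pow', ncalc_mass]

lemma radonProb_mono {μ : SignedRadon X} (hμ : μ ∈ radonProb X) {f g : C(X, ℝ)} (h : f ≤ g) :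
    μ f ≤ μ g := by
  have := hμ.1 (g - f) (sub_nonneg.2 h)
  rw [map_sub] at this; linarith

/-- Normalisation of `ω`-psh functions. -/
lemma exists_normalize (hω : S.IsPolarization ω) {T : ℝ} (hT : S.IsSubmeanBound ω T) {χ : S.D}
    (hχ : χ ∈ S.psh ω) :
    ∃ c : ℝ, χ + S.cst c ∈ S.psh ω ∧ ((χ + S.cst c : S.D) : C(X, ℝ)) ≤ 0 ∧
      (ncalc hω).I (ι ω ^ (p + 1)) (-((χ + S.cst c : S.D) : C(X, ℝ))) ≤ T := by
  have := S.nonempty_space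
  obtain ⟨x, -, hx⟩ := isCompact_univ.exists_isMaxOn Set.univ_nonempty
    (χ : C(X, ℝ)).continuous.continuousOn
  refine ⟨-(χ : C(X, ℝ)) x, psh_add_cst hχ _, fun y => ?_, ?_⟩
  · have := hx (Set.mem_univ y)
    simp only [Set.mem_ofPred_eq] at this
    simp; linarith
  · have h := hT χ hχ x
    rw [map_neg, ← refMeasure_eq_I hω, apply_add_cst (refMeasure_one hω)]
    linarith

lemma IsSubmeanBound.nonneg {T : ℝ} (hT : S.IsSubmeanBound ω T) (hω : 0 ≤ ω) : 0 ≤ T := by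
  have := S.nonempty_space
  obtain ⟨x⟩ := ‹Nonempty X›
  simpa using hT 0 (zero_mem_psh hω) x

lemma IsEnergyBound.nonneg {μ : SignedRadon X} {j : ℝ} (hj : S.IsEnergyBound ω μ j)
    (hω : S.IsPolarization ω) : 0 ≤ j := by
  simpa [energy_zero hω] using hj 0 (zero_mem_psh hω.1)

lemma nearMax_add_cst (hω : S.IsPolarization ω) {μ : SignedRadon X} (hμ : μ 1 = 1) {j ε : ℝ}
    {χ : S.D}
    (hχ : χ ∈ S.nearMax ω μ j ε) (c : ℝ) : χ + S.cst c ∈ S.nearMax ω μ j ε := by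
  refine ⟨psh_add_cst hχ.1 c, ?_⟩
  rw [energy_add_cst hω, apply_add_cst hμ]
  linarith [hχ.2]

lemma nearMax_mono {μ : SignedRadon X} {j ε ε' : ℝ} (h : ε ≤ ε') :
    S.nearMax ω μ j ε ⊆ S.nearMax ω μ j ε' := fun _ hχ => ⟨hχ.1, by linarith [hχ.2]⟩

/-- Coercivity with competitor χ/2; this is where J + T, that is J⁺, becomes the natural size of
near maximizers. -/
lemma neg_energy_le (hω : S.IsPolarization ω) {μ : SignedRadon X} {j ε T : ℝ}
    (hj : S.IsEnergyBound ω μ j) {χ : S.D}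
    (hχ : χ ∈ S.nearMax ω μ j ε) (hT : (ncalc hω).I (ι ω ^ (p + 1)) (-(χ : C(X, ℝ))) ≤ T) :
    -(ncalc hω).E p (ι ω) χ ≤ T + coerConst p * (j + ε) := by
  have h1 := hj _ (smul_mem_psh hω.1 hχ.1 (s := 1 / 2) (by norm_num) (by norm_num))
  have h2 := hχ.2
  rw [energy_eq_E hω] at h1 h2
  rw [Submodule.coe_smul, map_smul, smul_eq_mul] at h1
  have := (ncalc hω).neg_E_le_of_near_max p (ι_pos hω) (nonneg_of_psh hω hχ.1) h1 h2
  linarith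

/-- The midpoint cannot exceed the bound j, so uniform concavity forces two near maximizers to be
close. -/
lemma q_nearMax_le (hω : S.IsPolarization ω) {μ : SignedRadon X} {j ε : ℝ}
    (hj : S.IsEnergyBound ω μ j) {φ ψ : S.D}
    (hφ : φ ∈ S.nearMax ω μ j ε) (hψ : ψ ∈ S.nearMax ω μ j ε) :
    (ncalc hω).q (φ - ψ) ((ι ω + (ncalc hω).d ((1 / 2 : ℝ) • (φ + ψ))) ^ p) ≤
      4 * ((p : ℝ) + 2) * ε := by
  refine ((ncalc hω).q_le_E_mid p (nonneg_of_psh hω hφ.1) (nonneg_of_psh hω hψ.1)).trans ?_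
  have h1 := hj _ (mid_mem_psh hφ.1 hψ.1)
  have h2 := hφ.2
  have h3 := hψ.2
  rw [energy_eq_E hω] at h1 h2 h3
  rw [Submodule.coe_smul, map_smul, smul_eq_mul, Submodule.coe_add, map_add] at h1
  have hp : (0 : ℝ) < (p : ℝ) + 2 := by positivity
  nlinarith

/-- Orthogonality implies a second order lower bound for the energy of measures. -/
lemma exists_quadratic_bound (hω : S.IsPolarization ω) (ho : S.OrthogonalityProperty ω) (f : S.D) :
    ∃ C : ℝ, 0 ≤ C ∧ ∀ φ ∈ S.psh ω, ∀ t : ℝ, 0 < t → ∀ μ ∈ radonProb X, ∀ j,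
      S.IsEnergyBound ω μ j →
      S.energy ω φ - μ (φ : C(X, ℝ)) + t * (S.MA ω φ f - μ (f : C(X, ℝ))) - C * t ^ 2 ≤ j := by
  obtain ⟨θ₁, θ₂, hθ₁, hθ₂, hf⟩ := S.exists_sub (S.ddc f)
  have hf' : (ncalc hω).d f = ι θ₁ - ι θ₂ := by rw [ncalc_d, calculus_d, hf, map_sub]
  set N := ncalc hω with hN
  set L := ((p : ℝ) + 1) * (N.I (ι θ₁ * ι ω ^ p) 1 + N.I (ι θ₂ * ι ω ^ p) 1) with hL
  have hL0 : 0 ≤ L := by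
    have h1 := N.pos _ (mul_nonneg (ι_nonneg hθ₁) (pow_nonneg (ι_pos hω) p)) 1
      (fun _ => zero_le_one)
    have h2 := N.pos _ (mul_nonneg (ι_nonneg hθ₂) (pow_nonneg (ι_pos hω) p)) 1
      (fun _ => zero_le_one)
    positivity
  set κ := ‖(f : C(X, ℝ))‖ with hκ
  have hfκ (x : X) : |(f : C(X, ℝ)) x| ≤ κ := (f : C(X, ℝ)).norm_coe_le_norm x
  refine ⟨κ * L, mul_nonneg (norm_nonneg _) hL0, ?_⟩
  intro φ hφ t ht μ hμ j hj
  refine le_of_forall_pos_le_add fun η hη => ?_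
  -- The error e enters twice: directly from orthogonality, and in the sup distance t κ + e between
  -- τ and φ, multiplied by t L.
  obtain ⟨e, he, heη⟩ : ∃ e : ℝ, 0 < e ∧ e + t * (e * L) ≤ η := by
    refine ⟨η / (1 + t * L), by positivity, le_of_eq ?_⟩
    field_simp
  -- g is not ω-psh in general. Orthogonality supplies τ ∈ 𝒟_ω just below g with ∫ (g - τ) MA_ω(τ) ≤
  -- e; τ is a competitor for μ whose energy exceeds that of φ by about t ∫ f MA_ω(φ), with error
  -- O(t²).
  set g : S.D := φ + t • f with hg
  have hgx (x : X) : (g : C(X, ℝ)) x = (φ : C(X, ℝ)) x + t * (f : C(X, ℝ)) x := by simp [hg]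
  obtain ⟨φ₀, hφ₀, hφ₀g, horth⟩ := ho.2 g e he
  -- Keeping τ above this translate of φ ensures that τ stays uniformly close to φ.
  have hψ := psh_add_cst hφ (-(t * κ) - e)
  obtain ⟨τ, hτ, hτx⟩ := ho.1 φ₀ hφ₀ _ hψ g (fun x => by
    refine max_lt (hφ₀g x) ?_
    have := (abs_le.1 (hfκ x)).1
    rw [hgx]
    simp
    nlinarith)
  have hMA := horth τ hτ (fun x => ⟨(le_max_left _ _).trans (hτx x).1, (hτx x).2⟩)
  have hκ' : ∀ x, |((τ - φ : S.D) : C(X, ℝ)) x| ≤ t * κ + e := by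
    intro x
    have h1 := (le_max_right _ _).trans (hτx x).1
    have h2 := (hτx x).2
    have h3 := (abs_le.1 (hfκ x)).2
    rw [hgx] at h2
    simp at h1 ⊢
    rw [abs_le]
    constructor <;> nlinarith
  have hτ' := nonneg_of_psh hω hτ
  have hφ' := nonneg_of_psh hω hφ
  have h1 := N.abs_I_pow_sub_le p hφ' hτ' f (ι_nonneg hθ₁) (ι_nonneg hθ₂) hf' hκ'
  have h2 := N.E_le_tangent p hφ' hτ'
  have h3 := hj τ hτ
  have h4 : μ (τ : C(X, ℝ)) ≤ μ (φ : C(X, ℝ)) + t * μ (f : C(X, ℝ)) := by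
    have := radonProb_mono hμ (f := (τ : C(X, ℝ))) (g := (g : C(X, ℝ))) (fun x => (hτx x).2.le)
    rwa [hg, Submodule.coe_add, Submodule.coe_smul, map_add, map_smul, smul_eq_mul] at this
  rw [MA_eq_I hω, map_sub, hg, Submodule.coe_add, Submodule.coe_smul, map_add, map_smul,
    smul_eq_mul] at hMA
  rw [Submodule.coe_sub, map_sub] at h2
  rw [energy_eq_E hω] at h3 ⊢
  rw [MA_eq_I hω]
  have h5 := (abs_le.1 h1).1
  rw [← hL] at h5
  have h6 : t * -((t * κ + e) * L) ≤ t * (N.I ((ι ω + N.d τ) ^ (p + 1)) f -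
    N.I ((ι ω + N.d φ) ^ (p + 1)) f) := by gcongr
  linarith

/-- At a near maximizer the first variation nearly vanishes: the quadratic lower bound is applied to
f and -f. The tolerance ε depends on f and η only, not on the measure. -/
lemma abs_MA_sub_le (hω : S.IsPolarization ω) (ho : S.OrthogonalityProperty ω) (f : S.D) {η : ℝ}
    (hη : 0 < η) :
    ∃ ε : ℝ, 0 < ε ∧ ∀ μ ∈ radonProb X, ∀ j, S.IsEnergyBound ω μ j →
      ∀ χ ∈ S.nearMax ω μ j ε, |S.MA ω χ f - μ (f : C(X, ℝ))| ≤ η := by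
  obtain ⟨C₁, hC₁, h₁⟩ := exists_quadratic_bound hω ho f
  obtain ⟨C₂, hC₂, h₂⟩ := exists_quadratic_bound hω ho (-f)
  set C := C₁ + C₂ + 1 with hC
  have hC0 : 0 < C := by positivity
  -- With tolerance tη/2, both the tolerance and the quadratic error C t² are half of tη.
  set t := η / (2 * C) with ht
  have ht0 : 0 < t := by positivity
  have htC : C * t = η / 2 := by rw [ht]; field_simp
  refine ⟨t * (η / 2), by positivity, fun μ hμ j hj χ hχ => ?_⟩
  have a1 := h₁ χ hχ.1 t ht0 μ hμ j hj
  have a2 := h₂ χ hχ.1 t ht0 μ hμ j hj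
  rw [Submodule.coe_neg, map_neg, map_neg] at a2
  have a3 := hχ.2
  have b1 : C₁ * t ^ 2 ≤ C * t ^ 2 := by gcongr; linarith
  have b2 : C₂ * t ^ 2 ≤ C * t ^ 2 := by gcongr; linarith
  have b3 : C * t ^ 2 = t * (η / 2) := by rw [← htC]; ring
  rw [abs_le]
  constructor
  · refine le_of_mul_le_mul_left ?_ ht0
    linarith
  · refine le_of_mul_le_mul_left ?_ ht0
    linarith

lemma exists_hasEnergy (hω : S.IsPolarization ω) {μ : SignedRadon X} {j : ℝ}
    (hj : S.IsEnergyBound ω μ j) :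
    ∃ j' ≤ j, S.HasEnergy ω μ j' := by
  set A := (fun ρ : S.D => S.energy ω ρ - μ (ρ : C(X, ℝ))) '' S.psh ω with hA
  have hne : A.Nonempty := ⟨_, 0, zero_mem_psh hω.1, rfl⟩
  have hub : j ∈ upperBounds A := by rintro _ ⟨ρ, hρ, rfl⟩; exact hj ρ hρ
  have hlub := isLUB_csSup hne ⟨j, hub⟩
  refine ⟨sSup A, hlub.2 hub, fun ρ hρ => hlub.1 ⟨ρ, hρ, rfl⟩, fun ε hε => ?_⟩
  obtain ⟨_, ⟨ρ, hρ, rfl⟩, h1, -⟩ := hlub.exists_between (sub_lt_self _ hε)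
  exact ⟨ρ, hρ, h1.le⟩

end Setup

end

/-! ### Hölder estimate for the derivative of the energy -/

section

/-- The constant bounding the energies of the functions entering the Hölder estimate. -/
def fluctConst (p : ℕ) : ℝ := 8 * mixConst p ^ 2 * coerConst p ^ 3

/-- The constant of the Hölder estimate for the twisted energy. -/
def twistConst (p : ℕ) : ℝ := 10 * ((p : ℝ) + 1) * (holderConst p * fluctConst p)

lemma fluctConst_nonneg (p : ℕ) : 0 ≤ fluctConst p := by
  have := coerConst_ge_one p
  unfold fluctConst; positivity

lemma twistConst_nonneg (p : ℕ) : 0 ≤ twistConst p := by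
  have := fluctConst_nonneg p
  have := holderConst_nonneg p
  unfold twistConst; positivity

namespace Setup

open FormAlg

variable {p : ℕ} {X : Type*} [TopologicalSpace X] [CompactSpace X] [T2Space X]
  {Z : Type*} [AddCommGroup Z] [Module ℝ Z] [PartialOrder Z] [IsOrderedAddMonoid Z]
  [PosSMulMono ℝ Z] {S : Setup (p + 1) X Z} {ω : Z}

/-- The normalised mixed measure ν has energy O(M). Orthogonality makes ν(φ - ψ) arbitrarily close
to ∫ (φ - ψ) MA_ω(χ) for near maximizers χ of ν, and χ has energy O(M), so the Hölder estimate for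
pure Monge–Ampère measures applies. -/
lemma abs_mixed_sub_le (hω : S.IsPolarization ω) (ho : S.OrthogonalityProperty ω) {T M r : ℝ}
    (hT : S.IsSubmeanBound ω T) (hTM : T ≤ M) (hM : 0 ≤ M) (hr : 0 ≤ r) {φ ψ : S.D}
    (hφ : φ ∈ S.psh ω) (hψ : ψ ∈ S.psh ω) (hφ0 : (φ : C(X, ℝ)) ≤ 0) (hψ0 : (ψ : C(X, ℝ)) ≤ 0)
    (hφM : -(ncalc hω).E p (ι ω) φ ≤ 2 * coerConst p * M)
    (hψM : -(ncalc hω).E p (ι ω) ψ ≤ 2 * coerConst p * M)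
    (hq : (ncalc hω).q (φ - ψ) ((ι ω + (ncalc hω).d ((1 / 2 : ℝ) • (φ + ψ))) ^ p) ≤
      r * (fluctConst p * M))
    {θ : Z} (hθ1 : ω ≤ θ) (hθ2 : θ ≤ (2 : ℝ) • ω) {i k : ℕ} (hik : i + k = p) :
    |(ncalc hω).I (ι θ * ((ι ω + (ncalc hω).d φ) ^ i * (ι ω + (ncalc hω).d ψ) ^ k))
        ((φ - ψ : S.D) : C(X, ℝ)) -
      (ncalc hω).I (ι θ * ι ω ^ p) 1 * ((ncalc hω).E p (ι ω) φ - (ncalc hω).E p (ι ω) ψ)| ≤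
      2 * (holderConst p * (fluctConst p * M) * r ^ ((2 : ℝ)⁻¹ ^ (p + 1))) := by
  have hκ := mixConst_ge_one p
  have hc := coerConst_ge_one p
  set N := ncalc hω with hN
  set κ := mixConst p
  set c := coerConst p
  set P := ι θ * ((ι ω + N.d φ) ^ i * (ι ω + N.d ψ) ^ k) with hP
  have hw := ι_pos hω
  have hφ' := nonneg_of_psh hω hφ
  have hψ' := nonneg_of_psh hω hψ
  have hθ0 : 0 ≤ ι θ := ι_nonneg (hω.1.trans hθ1)
  have hθ2' : ι θ ≤ (2 : ℝ) • ι ω := by rw [← map_smul]; exact ι_mono hθ2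
  have hprod : 0 ≤ (ι ω + N.d φ) ^ i * (ι ω + N.d ψ) ^ k :=
    mul_nonneg (pow_nonneg hφ' _) (pow_nonneg hψ' _)
  have hP0 : 0 ≤ P := mul_nonneg hθ0 hprod
  set m := N.I (ι θ * ι ω ^ p) 1 with hm
  have hPm : N.I P 1 = m := by rw [hP, N.mass_mixed, hik]
  have hwp := pow_nonneg hw p
  have hm1 : 1 ≤ m := by
    have := N.I_mono (mul_le_mul_of_nonneg_right (ι_mono hθ1) hwp) (f := 1) (fun _ => zero_le_one)
    rwa [← pow_succ', ncalc_mass] at this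
  have hm2 : m ≤ 2 := by
    have := N.I_mono (mul_le_mul_of_nonneg_right hθ2' hwp) (f := 1) (fun _ => zero_le_one)
    rw [smul_mul_assoc, ← pow_succ', map_smul, LinearMap.smul_apply, ncalc_mass] at this
    simpa using this
  have hm0 : 0 < m := by linarith
  set ν : SignedRadon X := (m * S.vol ω)⁻¹ • S.wedgeAlg P with hν
  have hνI (f : C(X, ℝ)) : ν f = m⁻¹ * N.I P f := by
    rw [ncalc_I, calculus_I, ← mul_assoc, ← mul_inv]; rfl
  have hνp : ν ∈ radonProb X := by
    refine ⟨fun f hf => ?_, ?_⟩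
    · rw [hνI]; exact mul_nonneg (by positivity) (N.pos _ hP0 f hf)
    · rw [hνI, hPm]; exact inv_mul_cancel₀ hm0.ne'
  have hc0 : 0 ≤ 2 * c * M := by positivity
  have hMc : M ≤ 2 * c * M := by nlinarith
  have hj : S.IsEnergyBound ω ν (6 * κ ^ 2 * c ^ 2 * M) := by
    intro ρ hρ
    obtain ⟨b, hb1, hb2, hb3⟩ := exists_normalize hω hT hρ
    have h1 := N.E_add_I_mixed_le p hw hθ0 hθ2' hφ' hψ' (nonneg_of_psh hω hb1) hφ0 hψ0 hb2 hφM hψM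
      ((hb3.trans hTM).trans hMc) hik
    have h2 := N.pos P hP0 _ (neg_nonneg.2 hb2)
    rw [← hP, map_neg] at h1
    rw [map_neg] at h2
    have h3 : S.energy ω ρ - ν (ρ : C(X, ℝ)) =
      S.energy ω (ρ + S.cst b) - ν ((ρ + S.cst b : S.D) : C(X, ℝ)) := by
      rw [energy_add_cst hω, apply_add_cst hνp.2]; ring
    rw [h3, hνI, energy_eq_E hω]
    have h4 : m⁻¹ * -N.I P ((ρ + S.cst b : S.D) : C(X, ℝ)) ≤
        1 * -N.I P ((ρ + S.cst b : S.D) : C(X, ℝ)) :=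
      mul_le_mul_of_nonneg_right (inv_le_one_of_one_le₀ hm1) h2
    calc _ ≤ 3 * κ ^ 2 * c * (2 * c * M) := by linarith
      _ = _ := by ring
  obtain ⟨j', hj'1, hj'⟩ := exists_hasEnergy hω hj
  have hfl : 2 * c * M ≤ fluctConst p * M := by
    unfold fluctConst
    have h1 : (1 : ℝ) ≤ κ ^ 2 := one_le_pow₀ hκ
    have h2 : c ≤ c ^ 3 := le_self_pow₀ hc (by norm_num)
    have : 2 * c ≤ 8 * κ ^ 2 * c ^ 3 := by nlinarith
    gcongr
  have hflM : 0 ≤ fluctConst p * M := hc0.trans hfl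
  set B := holderConst p * (fluctConst p * M) * r ^ ((2 : ℝ)⁻¹ ^ (p + 1)) with hB
  have key : |ν ((φ - ψ : S.D) : C(X, ℝ)) - (N.E p (ι ω) φ - N.E p (ι ω) ψ)| ≤ B := by
    refine le_of_forall_pos_le_add fun η hη => ?_
    obtain ⟨ε, hε, happrox⟩ := abs_MA_sub_le hω ho (φ - ψ) hη
    -- The tolerance `min ε M` used below must be positive. If M = 0, the energies of φ, ψ and ν
    -- vanish, and then so do ν(φ) and ν(ψ).
    by_cases hM0 : M = 0
    · have e1 : N.E p (ι ω) φ = 0 := le_antisymm (N.E_nonpos p hw hφ' hφ0) (by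
        rw [hM0, mul_zero] at hφM; linarith)
      have e2 : N.E p (ι ω) ψ = 0 := le_antisymm (N.E_nonpos p hw hψ' hψ0) (by
        rw [hM0, mul_zero] at hψM; linarith)
      have hj0 : j' = 0 := le_antisymm (by rw [hM0, mul_zero] at hj'1; exact hj'1)
        (hj'.bound.nonneg hω)
      have hmem {x : S.D} (hx : x ∈ S.psh ω) (hx0 : (x : C(X, ℝ)) ≤ 0)
          (ex : N.E p (ι ω) x = 0) : ν (x : C(X, ℝ)) = 0 := by
        have h1 := hj'.bound x hx
        rw [energy_eq_E hω, ex, hj0] at h1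
        have h2 := radonProb_mono hνp hx0
        rw [map_zero] at h2
        linarith
      rw [e1, e2, Submodule.coe_sub, map_sub, hmem hφ hφ0 e1, hmem hψ hψ0 e2, hB, hM0]
      simp [hη.le]
    have hMpos : 0 < M := hM.lt_of_ne (Ne.symm hM0)
    -- Tolerance ε serves the approximation of ν, tolerance M the energy bound of χ.
    obtain ⟨χ₁, hχ₁⟩ := hj'.nonempty (min ε M) (lt_min hε hMpos)
    obtain ⟨b, hb1, hb2, hb3⟩ := exists_normalize hω hT hχ₁.1
    have hχ := nearMax_add_cst hω hνp.2 hχ₁ b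
    set χ := χ₁ + S.cst b
    have h1 := happrox ν hνp j' hj'.bound χ (nearMax_mono (min_le_left _ _) hχ)
    have h2 := neg_energy_le hω hj'.bound (nearMax_mono (min_le_right _ _) hχ) (hb3.trans hTM)
    have h3 : -N.E p (ι ω) χ ≤ fluctConst p * M := by
      refine h2.trans ?_
      have hk1 : (1 : ℝ) ≤ κ ^ 2 := one_le_pow₀ hκ
      have hk2 : c ≤ c ^ 3 := le_self_pow₀ hc (by norm_num)
      have hk3 : c ^ 3 ≤ κ ^ 2 * c ^ 3 := le_mul_of_one_le_left (by positivity) hk1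
      calc M + c * (j' + M) ≤ M + c * (6 * κ ^ 2 * c ^ 2 * M + M) := by gcongr
        _ = (1 + c + 6 * (κ ^ 2 * c ^ 3)) * M := by ring
        _ ≤ (8 * (κ ^ 2 * c ^ 3)) * M := by gcongr; linarith
        _ = _ := by unfold fluctConst; ring
    have h4 := N.abs_I_pow_sub_E_le p hw hφ' hψ' (nonneg_of_psh hω hb1) hφ0 hψ0 hb2 hflM hr
      (hφM.trans hfl) (hψM.trans hfl) h3 hq
    rw [MA_eq_I hω] at h1
    have h1' := abs_le.1 h1
    have h4' := abs_le.1 h4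
    rw [abs_le]
    constructor <;> linarith [h1'.1, h1'.2, h4'.1, h4'.2]
  have hB0 : 0 ≤ B := (abs_nonneg _).trans key
  have e : N.I P ((φ - ψ : S.D) : C(X, ℝ)) - m * (N.E p (ι ω) φ - N.E p (ι ω) ψ) =
      m * (ν ((φ - ψ : S.D) : C(X, ℝ)) - (N.E p (ι ω) φ - N.E p (ι ω) ψ)) := by
    rw [hνI]; field_simp
  rw [e, abs_mul, abs_of_pos hm0]
  gcongr

/-- Hölder continuity of the derivative of the energy along near maximizers. -/
theorem abs_nablaEnergy_sub_le (hω : S.IsPolarization ω) (ho : S.OrthogonalityProperty ω)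
    {T j M r : ℝ} (hT : S.IsSubmeanBound ω T) {μ : SignedRadon X} (hμ : μ ∈ radonProb X)
    (hj : S.IsEnergyBound ω μ j) (hM : j + T ≤ M) (hr : 0 ≤ r) (hr1 : r ≤ 1) {φ ψ : S.D}
    (hφ : φ ∈ S.nearMax ω μ j (r * M)) (hψ : ψ ∈ S.nearMax ω μ j (r * M))
    {θ : Z} {C : ℝ} (hC : 0 < C) (hθ1 : θ ≤ C • ω) (hθ2 : -θ ≤ C • ω) :
    |S.nablaEnergy ω θ φ - S.nablaEnergy ω θ ψ| ≤
      twistConst p * C * r ^ ((2 : ℝ)⁻¹ ^ (p + 1)) * M := by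
  have hc := coerConst_ge_one p
  have hκ := mixConst_ge_one p
  have hj0 := hj.nonneg hω
  have hT0 := hT.nonneg hω.1
  have hM0 : 0 ≤ M := by linarith
  obtain ⟨b, hb1, hb2, hb3⟩ := exists_normalize hω hT hφ.1
  obtain ⟨b', hb1', hb2', hb3'⟩ := exists_normalize hω hT hψ.1
  have hφ' := nearMax_add_cst hω hμ.2 hφ b
  have hψ' := nearMax_add_cst hω hμ.2 hψ b'
  rw [← nablaEnergy_add_cst hω θ φ b, ← nablaEnergy_add_cst hω θ ψ b']
  set φ' := φ + S.cst b
  set ψ' := ψ + S.cst b'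
  set N := ncalc hω with hN
  have hE {x : S.D} (hx : x ∈ S.nearMax ω μ j (r * M))
      (hxT : N.I (ι ω ^ (p + 1)) (-(x : C(X, ℝ))) ≤ T) :
      -N.E p (ι ω) x ≤ 2 * coerConst p * M := by
    refine (neg_energy_le hω hj hx hxT).trans ?_
    have h1 : r * M ≤ M := by nlinarith
    nlinarith
  have hq : N.q (φ' - ψ') ((ι ω + N.d ((1 / 2 : ℝ) • (φ' + ψ'))) ^ p) ≤
      r * (fluctConst p * M) := by
    refine (q_nearMax_le hω hj hφ' hψ').trans ?_
    have h1 : 4 * ((p : ℝ) + 2) ≤ mixConst p := by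
      unfold mixConst
      have : (1 : ℝ) ≤ 4 ^ p := one_le_pow₀ (by norm_num)
      rw [pow_succ]; nlinarith [Nat.cast_nonneg (α := ℝ) p]
    have h2 : mixConst p ≤ fluctConst p := by
      unfold fluctConst
      have : (1 : ℝ) ≤ coerConst p ^ 3 := one_le_pow₀ hc
      nlinarith [sq_nonneg (mixConst p)]
    calc 4 * ((p : ℝ) + 2) * (r * M) ≤ fluctConst p * (r * M) := by
          gcongr; exact h1.trans h2
      _ = _ := by ring
  set B := holderConst p * (fluctConst p * M) * r ^ ((2 : ℝ)⁻¹ ^ (p + 1)) with hB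
  have main {ϑ : Z} (h1 : ω ≤ ϑ) (h2 : ϑ ≤ (2 : ℝ) • ω) :
      |N.nab p (ι ω) (ι ϑ) φ' - N.nab p (ι ω) (ι ϑ) ψ'| ≤ ((p : ℝ) + 1) * (2 * B) := by
    rw [N.nab_sub, hom_eq_sum, Finset.mul_sum, map_sum, LinearMap.sum_apply]
    have e : ((p : ℝ) + 1) * N.I (ι ϑ * ι ω ^ p) 1 * (N.E p (ι ω) φ' - N.E p (ι ω) ψ') =
        ∑ i ∈ Finset.range (p + 1),
          N.I (ι ϑ * ι ω ^ p) 1 * (N.E p (ι ω) φ' - N.E p (ι ω) ψ') := by simp; ring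
    rw [e, ← Finset.sum_sub_distrib]
    refine (Finset.abs_sum_le_sum_abs _ _).trans ?_
    refine (Finset.sum_le_sum fun i hi => abs_mixed_sub_le hω ho hT (by linarith) hM0 hr hb1 hb1'
      hb2 hb2' (hE hφ' hb3) (hE hψ' hb3') hq h1 h2
      (Nat.add_sub_cancel' (Nat.lt_succ_iff.1 (Finset.mem_range.1 hi)))).trans ?_
    rw [Finset.sum_const, Finset.card_range, nsmul_eq_mul]
    push_cast
    exact le_rfl
  rw [nablaEnergy_eq_nab hω, nablaEnergy_eq_nab hω]
  -- Since ±θ ≤ C ω, this form lies between ω and 2ω, as `main` requires. Writing θ = C (2ϑ - 3ω)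
  -- costs the factor 2 + 3 = 5.
  set ϑ : Z := (1 / 2 : ℝ) • (C⁻¹ • θ + (3 : ℝ) • ω) with hϑ
  have hθ1' : C⁻¹ • θ ≤ ω := by
    have := smul_le_smul_of_nonneg_left hθ1 (inv_nonneg.2 hC.le)
    rwa [smul_smul, inv_mul_cancel₀ hC.ne', one_smul] at this
  have hθ2' : -(C⁻¹ • θ) ≤ ω := by
    have := smul_le_smul_of_nonneg_left hθ2 (inv_nonneg.2 hC.le)
    rwa [smul_smul, inv_mul_cancel₀ hC.ne', one_smul, smul_neg] at this
  have hϑ1 : ω ≤ ϑ := by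
    have h := smul_nonneg (a := (1 / 2 : ℝ)) (by norm_num)
      (sub_nonneg.2 hθ2')
    rw [← sub_nonneg]
    refine h.trans_eq ?_
    rw [hϑ]; module
  have hϑ2 : ϑ ≤ (2 : ℝ) • ω := by
    have h := smul_nonneg (a := (1 / 2 : ℝ)) (by norm_num)
      (sub_nonneg.2 hθ1')
    rw [← sub_nonneg]
    refine h.trans_eq ?_
    rw [hϑ]; module
  have hω2 : ω ≤ (2 : ℝ) • ω := by
    rw [two_smul]; exact le_add_of_nonneg_right hω.1
  have m1 := main hϑ1 hϑ2
  have m2 := main le_rfl hω2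
  have hθe : ι θ = C • ((2 : ℝ) • ι ϑ + (-3 : ℝ) • ι ω) := by
    rw [← map_smul, ← map_smul, ← map_add, ← map_smul]
    congr 1
    have : C • C⁻¹ • θ = θ := by rw [smul_smul, mul_inv_cancel₀ hC.ne', one_smul]
    rw [hϑ]
    calc θ = C • C⁻¹ • θ := this.symm
      _ = _ := by module
  rw [hθe]
  simp only [Calculus.nab_smul_left, Calculus.nab_add_left]
  rw [← mul_sub, abs_mul, abs_of_pos hC]
  have m1' := abs_le.1 m1
  have m2' := abs_le.1 m2
  have : |2 * N.nab p (ι ω) (ι ϑ) φ' + -3 * N.nab p (ι ω) (ι ω) φ' -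
      (2 * N.nab p (ι ω) (ι ϑ) ψ' + -3 * N.nab p (ι ω) (ι ω) ψ')| ≤
      5 * (((p : ℝ) + 1) * (2 * B)) := by
    rw [abs_le]; constructor <;> linarith [m1'.1, m1'.2, m2'.1, m2'.2]
  calc _ ≤ C * (5 * (((p : ℝ) + 1) * (2 * B))) := by gcongr
    _ = _ := by rw [hB, twistConst]; ring

end Setup

end

/-! ### Real values of the suprema and strong approximation -/

section

namespace Calculus

variable {X : Type*} [TopologicalSpace X]
  {R : Type*} [CommRing R] [Algebra ℝ R] [Preorder R]
  {D : Submodule ℝ C(X, ℝ)} (K : Calculus D R)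
  [IsOrderedAddMonoid R] [PosMulMono R] [MulPosMono R] [ZeroLEOneClass R] [PosSMulMono ℝ R]

/-- Second order expansion of the energy along the segment joining `φ` to `0`. -/
lemma E_le_E_one_sub_smul (p : ℕ) {w : R} (hw : 0 ≤ w) {φ : D} (hφ : 0 ≤ w + K.d φ)
    (h0 : (φ : C(X, ℝ)) ≤ 0) {t : ℝ} (ht : 0 ≤ t) (ht1 : t ≤ 1) :
    K.E p w φ ≤ K.E p w ((1 - t) • φ) + t * K.I ((w + K.d φ) ^ (p + 1)) φ +
      t ^ 2 * (coerConst p * -K.E p w φ) := by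
  have hs := K.nonneg_smul_d hw hφ (s := 1 - t) (by linarith) (by linarith)
  have h1 := K.E_le_tangent p hφ hs
  have e1 : φ - (1 - t) • φ = t • φ := by module
  rw [e1, Submodule.coe_smul, map_smul, smul_eq_mul] at h1
  have h2 := K.pow_mul_d p w ((1 - t) • φ) φ (φ : C(X, ℝ))
  have e2 : (1 - t) • φ - φ = -t • φ := by module
  rw [e2, K.d.map_smul (-t), smul_mul_assoc, K.I.map_smul, LinearMap.smul_apply, smul_eq_mul] at h2
  have hsum : 0 ≤ (w + K.d φ) + w := add_nonneg hφ hw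
  have h3 : hom p (w + K.d ((1 - t) • φ)) (w + K.d φ) ≤
      ((p : ℝ) + 1) • ((w + K.d φ) + w) ^ p := by
    refine (hom_le p hs hφ ?_ (le_add_of_nonneg_right hw)).trans_eq (natCast_add_one_mul _ _)
    rw [← sub_nonneg]
    refine (add_nonneg (smul_nonneg ht hφ) (smul_nonneg (sub_nonneg.2 ht1) hw)).trans_eq ?_
    rw [map_smul]; module
  have h4 := K.q_mono h3 φ
  have h5 := (K.q_le_I_neg hw h0 (pow_nonneg hsum p)).trans
    (K.I_mono (mul_le_mul_of_nonneg_right (le_add_of_nonneg_right hw) (pow_nonneg hsum p))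
      (neg_nonneg.2 h0))
  rw [← pow_succ'] at h5
  have h6 := h5.trans (K.I_add_pow_le p hw hφ h0)
  rw [q_smul] at h4
  have h7 : K.q φ (hom p (w + K.d ((1 - t) • φ)) (w + K.d φ)) ≤
      coerConst p * -K.E p w φ := by
    refine h4.trans ?_
    calc _ ≤ ((p : ℝ) + 1) * (2 ^ (p + 1) * (((p : ℝ) + 2) * -K.E p w φ)) := by gcongr
      _ = _ := by unfold coerConst; ring
  have h8 : K.I (K.d φ * hom p (w + K.d ((1 - t) • φ)) (w + K.d φ)) (φ : C(X, ℝ)) =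
      -K.q φ (hom p (w + K.d ((1 - t) • φ)) (w + K.d φ)) := by rw [q, neg_neg]
  rw [h8] at h2
  have h9 : t ^ 2 * K.q φ (hom p (w + K.d ((1 - t) • φ)) (w + K.d φ)) ≤
      t ^ 2 * (coerConst p * -K.E p w φ) := by gcongr
  have h10 : K.I ((w + K.d ((1 - t) • φ)) ^ (p + 1)) (φ : C(X, ℝ)) =
    K.I ((w + K.d φ) ^ (p + 1)) φ + t * K.q φ (hom p (w + K.d ((1 - t) • φ)) (w + K.d φ)) := by
    linarith
  rw [h10] at h1
  linarith

end Calculus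

namespace Setup

open FormAlg Filter

variable {p : ℕ} {X : Type*} [TopologicalSpace X] [CompactSpace X] [T2Space X]
  {Z : Type*} [AddCommGroup Z] [Module ℝ Z] [PartialOrder Z] [IsOrderedAddMonoid Z]
  [PosSMulMono ℝ Z] {S : Setup (p + 1) X Z} {ω : Z}

/-! ### Extended real valued suprema -/

lemma measureEnergy_le_iff {μ : SignedRadon X} {j : ℝ} :
    S.measureEnergy ω μ ≤ j ↔ S.IsEnergyBound ω μ j := by
  simp only [measureEnergy, iSup_le_iff, EReal.coe_le_coe_iff]
  exact ⟨fun h ρ hρ => h ⟨ρ, hρ⟩, fun h ρ => h ρ.1 ρ.2⟩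

lemma HasEnergy.measureEnergy_eq {μ : SignedRadon X} {j : ℝ} (h : S.HasEnergy ω μ j) :
    S.measureEnergy ω μ = j := by
  refine le_antisymm (measureEnergy_le_iff.2 h.bound) ?_
  have key (ε : ℝ) (hε : 0 < ε) : ((j - ε : ℝ) : EReal) ≤ S.measureEnergy ω μ := by
    obtain ⟨χ, hχ, h1⟩ := h.nonempty ε hε
    exact (EReal.coe_le_coe_iff.2 h1).trans
      (le_iSup (fun φ : S.psh ω => ((S.energy ω φ.1 - μ (φ.1 : C(X, ℝ)) : ℝ) : EReal)) ⟨χ, hχ⟩)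
  have hle := measureEnergy_le_iff.2 h.bound
  have hbot := ((EReal.bot_lt_coe _).trans_le (key 1 one_pos)).ne'
  lift S.measureEnergy ω μ to ℝ using ⟨(hle.trans_lt (EReal.coe_lt_top j)).ne, hbot⟩ with m
  rw [EReal.coe_le_coe_iff]
  refine le_of_forall_pos_le_add fun ε hε => ?_
  have := key ε hε
  rw [EReal.coe_le_coe_iff] at this
  linarith

lemma HasEnergy.mem_finiteEnergy {μ : SignedRadon X} {j : ℝ} (h : S.HasEnergy ω μ j)
    (hμ : μ ∈ radonProb X) : μ ∈ S.finiteEnergy ω :=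
  ⟨hμ, h.measureEnergy_eq ▸ EReal.coe_lt_top j⟩

lemma hasEnergy_of_mem (hω : S.IsPolarization ω) {μ : SignedRadon X}
    (hμ : μ ∈ S.finiteEnergy ω) : S.HasEnergy ω μ (S.measureEnergy ω μ).toReal := by
  obtain ⟨j, hj1, hj2⟩ := EReal.lt_iff_exists_real_btwn.1 hμ.2
  obtain ⟨j', -, hj'⟩ := exists_hasEnergy hω (measureEnergy_le_iff.1 hj1.le)
  rw [hj'.measureEnergy_eq]
  exact hj'

lemma submeanConst_le_iff {T : ℝ} : S.submeanConst ω ≤ T ↔ S.IsSubmeanBound ω T := by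
  have := S.nonempty_space
  have hb (φ : S.D) : BddAbove (Set.range fun x => (φ : C(X, ℝ)) x) :=
    (isCompact_range (φ : C(X, ℝ)).continuous).bddAbove
  simp only [submeanConst, iSup_le_iff, EReal.coe_le_coe_iff, sub_le_iff_le_add]
  refine ⟨fun h ρ hρ x => ?_, fun h ρ => (ciSup_le_iff (hb ρ.1)).2 fun x => ?_⟩
  · have := (ciSup_le_iff (hb ρ)).1 (h ⟨ρ, hρ⟩) x
    linarith
  · linarith [h ρ.1 ρ.2 x]

lemma isSubmeanBound_toReal (h : S.submeanConst ω < ⊤) :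
    S.IsSubmeanBound ω (S.submeanConst ω).toReal := by
  refine submeanConst_le_iff.1 (EReal.le_coe_toReal h.ne)

lemma IsSubmeanBound.toReal_le (hω : 0 ≤ ω) {T : ℝ} (hT : S.IsSubmeanBound ω T) :
    (S.submeanConst ω).toReal ≤ T := by
  have h1 := le_iSup (fun φ : S.psh ω => (((⨆ x : X, (φ.1 : C(X, ℝ)) x) -
    S.refMeasure ω (φ.1 : C(X, ℝ)) : ℝ) : EReal)) ⟨0, zero_mem_psh hω⟩
  exact EReal.toReal_le_toReal (submeanConst_le_iff.2 hT)
    ((EReal.bot_lt_coe _).trans_le h1).ne' (EReal.coe_ne_top T)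

/-! ### Strong approximation by Monge–Ampère measures -/

/-- By the tangent inequality φ itself maximizes the functional defining the energy of MA_ω(φ). -/
lemma hasEnergy_MA (hω : S.IsPolarization ω) {φ : S.D} (hφ : φ ∈ S.psh ω) :
    S.HasEnergy ω (S.MA ω φ) (S.energy ω φ - S.MA ω φ φ) := by
  refine ⟨fun ρ hρ => ?_, fun ε hε => ⟨φ, hφ, by linarith⟩⟩
  have := (ncalc hω).E_le_tangent p (nonneg_of_psh hω hρ) (nonneg_of_psh hω hφ)
  rw [← MA_eq_I hω, Submodule.coe_sub, map_sub, ← energy_eq_E, ← energy_eq_E] at this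
  linarith

/-- Testing near maximality of χ against (1 - t)χ bounds μ(χ) - ∫ χ MA_ω(χ) from above, up to ε/t
and a second order error divided by t. -/
lemma energy_MA_le (hω : S.IsPolarization ω) {T j ε : ℝ} (hT : S.IsSubmeanBound ω T)
    {μ : SignedRadon X} (hμ : μ ∈ radonProb X) (hj : S.IsEnergyBound ω μ j) {χ : S.D}
    (hχ : χ ∈ S.nearMax ω μ j ε) {t : ℝ} (ht : 0 < t) (ht1 : t ≤ 1) :
    S.energy ω χ - S.MA ω χ χ ≤ j + ε / t + t * (coerConst p * (T + coerConst p * (j + ε))) := by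
  obtain ⟨b, hb1, hb2, hb3⟩ := exists_normalize hω hT hχ.1
  have hχ' := nearMax_add_cst hω hμ.2 hχ b
  have hMA : S.MA ω χ = S.MA ω (χ + S.cst b) := by
    rw [MA, MA, map_add, ddc_cst, add_zero]
  have e : S.energy ω χ - S.MA ω χ χ =
      S.energy ω (χ + S.cst b) - S.MA ω (χ + S.cst b) ((χ + S.cst b : S.D) : C(X, ℝ)) := by
    rw [energy_add_cst hω, ← hMA, apply_add_cst (MA_mem_radonProb hω hχ.1).2]; ring
  rw [e]
  set ρ := χ + S.cst b
  have hE := neg_energy_le hω hj hχ' hb3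
  have h1 := (ncalc hω).E_le_E_one_sub_smul p (ι_pos hω) (nonneg_of_psh hω hb1) hb2 ht.le ht1
  have h2 := hj _ (smul_mem_psh hω.1 hb1 (s := 1 - t) (by linarith) (by linarith))
  have h3 := hχ'.2
  have h4 := hj _ hb1
  rw [← MA_eq_I hω] at h1
  rw [Submodule.coe_smul, map_smul, smul_eq_mul] at h2
  simp only [energy_eq_E hω] at h2 h3 h4 ⊢
  have hc := coerConst_ge_one p
  have h5 : t ^ 2 * (coerConst p * -(ncalc hω).E p (ι ω) ρ) ≤
      t ^ 2 * (coerConst p * (T + coerConst p * (j + ε))) := by gcongr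
  have h6 : t * (μ (ρ : C(X, ℝ)) - S.MA ω ρ ρ) ≤
      t * (ε / t + t * (coerConst p * (T + coerConst p * (j + ε)))) := by
    rw [mul_add, mul_div_cancel₀ _ ht.ne']
    linarith
  have h7 := le_of_mul_le_mul_left h6 ht
  linarith

lemma abs_apply_le {μ : SignedRadon X} (hμ : μ ∈ radonProb X) (f : C(X, ℝ)) : |μ f| ≤ ‖f‖ := by
  have h (x : X) := abs_le.1 (f.norm_coe_le_norm x)
  have h1 := radonProb_mono hμ (f := f) (g := ‖f‖ • 1) (fun x => by simpa using (h x).2)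
  have h2 := radonProb_mono hμ (f := (-‖f‖) • 1) (g := f) (fun x => by simpa using (h x).1)
  rw [map_smul, hμ.2, smul_eq_mul, mul_one] at h1 h2
  exact abs_le.2 ⟨h2, h1⟩

/-- The Monge–Ampère measures of near maximizers approximate a measure strongly. -/
lemma tendsto_MA (hω : S.IsPolarization ω) (ho : S.OrthogonalityProperty ω) {T j : ℝ}
    (hT : S.IsSubmeanBound ω T) {μ : SignedRadon X} (hμ : μ ∈ radonProb X)
    (hj : S.HasEnergy ω μ j) {χ : ℕ → S.D} {ε : ℕ → ℝ} (hε : Tendsto ε atTop (𝓝 0))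
    (hχ : ∀ k, χ k ∈ S.nearMax ω μ j (ε k)) :
    Tendsto (fun k => (⟨S.MA ω (χ k), (hasEnergy_MA hω (hχ k).1).mem_finiteEnergy
      (MA_mem_radonProb hω (hχ k).1)⟩ : S.finiteEnergy ω)) atTop
      (@nhds _ (S.strongTopology ω) ⟨μ, hj.mem_finiteEnergy hμ⟩) := by
  have hweak : Tendsto (fun k => S.MA ω (χ k)) atTop (𝓝 μ) := by
    rw [tendsto_iff_forall_eval_tendsto_topDualPairing]
    intro f
    change Tendsto (fun k => S.MA ω (χ k) f) atTop (𝓝 (μ f))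
    refine Metric.tendsto_atTop.2 fun η hη => ?_
    obtain ⟨g, hg, hfg⟩ := Metric.dense_iff.1 S.dense_D f (η / 4) (by positivity)
    obtain ⟨ε', hε', happ⟩ := abs_MA_sub_le hω ho ⟨g, hfg⟩ (η := η / 4) (by positivity)
    obtain ⟨k₀, hk₀⟩ := eventually_atTop.1 (hε.eventually (gt_mem_nhds hε'))
    refine ⟨k₀, fun k hk => ?_⟩
    have h1 := abs_le.1 (happ μ hμ j hj.bound _ (nearMax_mono (hk₀ k hk).le (hχ k)))
    have h2 := abs_le.1 (abs_apply_le hμ (g - f))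
    have h3 := abs_le.1 (abs_apply_le (MA_mem_radonProb hω (hχ k).1) (g - f))
    rw [Metric.mem_ball, dist_eq_norm] at hg
    simp only [map_sub] at h1 h2 h3
    rw [Real.dist_eq, abs_lt]
    constructor <;> linarith [h1.1, h1.2, h2.1, h2.2, h3.1, h3.2]
  rw [nhds_inf, tendsto_inf, nhds_induced, nhds_induced, tendsto_comap_iff, tendsto_comap_iff]
  refine ⟨hweak, ?_⟩
  simp only [Function.comp_def, hj.measureEnergy_eq, (hasEnergy_MA hω (hχ _).1).measureEnergy_eq,
    EReal.toReal_coe]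
  refine tendsto_order.2 ⟨fun a ha => ?_, fun a ha => ?_⟩
  -- Lower semicontinuity of the energy: a fixed competitor ψ and weak convergence.
  · obtain ⟨ψ, hψ, hψj⟩ := hj.nonempty ((j - a) / 2) (by linarith)
    have h1 := (tendsto_iff_forall_eval_tendsto_topDualPairing.1 hweak) ψ
    change Tendsto (fun k => S.MA ω (χ k) ψ) atTop (𝓝 (μ ψ)) at h1
    filter_upwards [h1.eventually (gt_mem_nhds (show μ ψ < μ ψ + (j - a) / 2 by linarith))]
      with k hk
    have := (hasEnergy_MA hω (hχ k).1).bound ψ hψ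
    linarith
  -- For the upper bound t is fixed first, to make the O(t) error small; then ε_k/t tends to 0.
  · obtain ⟨t, ht0, ht1, ht⟩ : ∃ t : ℝ, 0 < t ∧ t ≤ 1 ∧
        j + t * (coerConst p * (T + coerConst p * j)) < a := by
      have h : Tendsto (fun t : ℝ => j + t * (coerConst p * (T + coerConst p * j))) (𝓝[>] 0)
          (𝓝 (j + 0 * (coerConst p * (T + coerConst p * j)))) := by
        refine Tendsto.mono_left (Continuous.tendsto ?_ 0) nhdsWithin_le_nhds
        fun_prop
      rw [zero_mul, add_zero] at h
      obtain ⟨t, h1, h2⟩ := ((h.eventually (gt_mem_nhds ha)).and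
        (Ioc_mem_nhdsGT (zero_lt_one' ℝ))).exists
      exact ⟨t, h2.1, h2.2, h1⟩
    have h : Tendsto (fun k => j + ε k / t + t * (coerConst p * (T + coerConst p * (j + ε k))))
        atTop (𝓝 (j + 0 / t + t * (coerConst p * (T + coerConst p * (j + 0))))) := by
      have hc : Continuous (fun e : ℝ => j + e / t +
        t * (coerConst p * (T + coerConst p * (j + e)))) := by fun_prop
      exact (hc.tendsto 0).comp hε
    simp only [zero_div, add_zero] at h
    filter_upwards [h.eventually (gt_mem_nhds ht)] with k hk
    exact (energy_MA_le hω hT hμ hj.bound (hχ k) ht0 ht1).trans_lt hk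

end Setup

end

/-! ### Existence, continuity and uniqueness of the twisted energy -/

section

namespace Setup

open FormAlg Filter

variable {p : ℕ} {X : Type*} [TopologicalSpace X] [CompactSpace X] [T2Space X]
  {Z : Type*} [AddCommGroup Z] [Module ℝ Z] [PartialOrder Z] [IsOrderedAddMonoid Z]
  [PosSMulMono ℝ Z] {S : Setup (p + 1) X Z} {ω : Z}

lemma tendsto_mul_rpow_mul (c M : ℝ) (k : ℕ) :
    Tendsto (fun r : ℝ => c * r ^ ((2 : ℝ)⁻¹ ^ k) * M) (𝓝[>] 0) (𝓝 0) := by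
  have hα : (0 : ℝ) < (2 : ℝ)⁻¹ ^ k := by positivity
  have h := (((Real.continuousAt_rpow_const 0 _ (Or.inr hα.le)).tendsto.const_mul c).mul_const M)
  rw [Real.zero_rpow hα.ne', mul_zero, zero_mul] at h
  exact h.mono_left nhdsWithin_le_nhds

/-- A value `L` is the limit of the derivative of the energy along near maximizers of `μ`, with
Hölder rate. -/
def IsTwistedValue (S : Setup (p + 1) X Z) (ω : Z) (T C : ℝ) (θ : Z) (μ : SignedRadon X)
    (j L : ℝ) : Prop :=
  ∀ M, 0 < M → j + T ≤ M → ∀ r, 0 < r → r ≤ 1 → ∀ χ ∈ S.nearMax ω μ j (r * M),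
    |S.nablaEnergy ω θ χ - L| ≤ twistConst p * C * r ^ ((2 : ℝ)⁻¹ ^ (p + 1)) * M

/-- The Hölder estimate makes ∇_θE_ω Cauchy along a maximizing sequence; comparing any near
maximizer with the sequence and passing to the limit keeps the same rate. -/
lemma exists_isTwistedValue (hω : S.IsPolarization ω) (ho : S.OrthogonalityProperty ω) {T j C : ℝ}
    (hT : S.IsSubmeanBound ω T) {μ : SignedRadon X} (hμ : μ ∈ radonProb X)
    (hj : S.HasEnergy ω μ j) {θ : Z} (hC : 0 < C) (hθ1 : θ ≤ C • ω) (hθ2 : -θ ≤ C • ω) :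
    ∃ L, S.IsTwistedValue ω T C θ μ j L := by
  have hj0 := hj.bound.nonneg hω
  have hT0 := hT.nonneg hω.1
  have hu := tendsto_one_div_add_atTop_nhds_zero_nat (𝕜 := ℝ)
  choose χ hχ using fun k : ℕ => hj.nonempty (1 / ((k : ℝ) + 1)) (by positivity)
  have hmem {ε : ℝ} (hε : 0 < ε) : ∀ᶠ k in atTop, χ k ∈ S.nearMax ω μ j ε := by
    filter_upwards [hu.eventually (gt_mem_nhds hε)] with k hk
    exact nearMax_mono hk.le (hχ k)
  have hcauchy : CauchySeq fun k => S.nablaEnergy ω θ (χ k) := by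
    refine Metric.cauchySeq_iff.2 fun η hη => ?_
    obtain ⟨r, hr, hr0, hr1⟩ := (((tendsto_mul_rpow_mul (twistConst p * C) (j + T + 1) (p + 1)
      ).eventually (gt_mem_nhds hη)).and (Ioc_mem_nhdsGT (zero_lt_one' ℝ))).exists
    obtain ⟨k₀, hk₀⟩ := eventually_atTop.1 (hmem (ε := r * (j + T + 1)) (by positivity))
    refine ⟨k₀, fun m hm k hk => ?_⟩
    rw [Real.dist_eq]
    exact (abs_nablaEnergy_sub_le hω ho hT hμ hj.bound (by linarith) hr0.le hr1 (hk₀ m hm)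
      (hk₀ k hk) hC hθ1 hθ2).trans_lt hr
  obtain ⟨L, hL⟩ := cauchySeq_tendsto_of_complete hcauchy
  refine ⟨L, fun M hM0 hM r hr hr1 ψ hψ => ?_⟩
  refine le_of_tendsto ((tendsto_const_nhds.sub hL).abs) ?_
  filter_upwards [hmem (ε := r * M) (by positivity)] with k hk
  exact abs_nablaEnergy_sub_le hω ho hT hμ hj.bound hM hr.le hr1 hψ hk hC hθ1 hθ2

/-- The twisted energy of a Monge–Ampère measure. -/
lemma IsTwistedValue.eq_nablaEnergy (hω : S.IsPolarization ω) {T C : ℝ}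
    (hT : S.IsSubmeanBound ω T) {θ : Z} {φ : S.D} (hφ : φ ∈ S.psh ω) {j L : ℝ}
    (hj : S.HasEnergy ω (S.MA ω φ) j) (hL : S.IsTwistedValue ω T C θ (S.MA ω φ) j L) :
    L = S.nablaEnergy ω θ φ := by
  have hj0 := hj.bound.nonneg hω
  have hT0 := hT.nonneg hω.1
  have hj' : j = S.energy ω φ - S.MA ω φ φ := by
    rw [← EReal.coe_eq_coe_iff, ← hj.measureEnergy_eq, (hasEnergy_MA hω hφ).measureEnergy_eq]
  have h := tendsto_mul_rpow_mul (twistConst p * C) (j + T + 1) (p + 1)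
  have h0 : |S.nablaEnergy ω θ φ - L| ≤ 0 := by
    refine ge_of_tendsto h ?_
    filter_upwards [Ioc_mem_nhdsGT (zero_lt_one' ℝ)] with r hr
    have : 0 ≤ r * (j + T + 1) := mul_nonneg hr.1.le (by positivity)
    exact hL _ (by positivity) (by linarith) r hr.1 hr.2 φ ⟨hφ, by linarith⟩
  exact (sub_eq_zero.1 (abs_nonpos_iff.1 h0)).symm

lemma continuous_coe_finiteEnergy :
    Continuous[S.strongTopology ω, inferInstance] fun ν : S.finiteEnergy ω => (ν : SignedRadon X) :=
  continuous_inf_dom_left continuous_induced_dom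

lemma continuous_measureEnergy : Continuous[S.strongTopology ω, inferInstance]
    fun ν : S.finiteEnergy ω => (S.measureEnergy ω ν).toReal :=
  continuous_inf_dom_right continuous_induced_dom

/-- A functional assigning twisted values is strongly continuous. -/
lemma continuous_of_isTwistedValue (hω : S.IsPolarization ω) {T C : ℝ}
    (hT : S.IsSubmeanBound ω T) {θ : Z} {F : S.finiteEnergy ω → ℝ}
    (hF : ∀ μ : S.finiteEnergy ω, S.IsTwistedValue ω T C θ μ (S.measureEnergy ω μ).toReal (F μ)) :
    Continuous[S.strongTopology ω, inferInstance] F := by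
  let _ := S.strongTopology ω
  refine continuous_iff_continuousAt.2 fun μ => Metric.tendsto_nhds.2 fun η hη => ?_
  have hj := hasEnergy_of_mem hω μ.2
  set J : S.finiteEnergy ω → ℝ := fun μ => (S.measureEnergy ω μ).toReal with hJ
  have hj0 := hj.bound.nonneg hω
  have hT0 := hT.nonneg hω.1
  set M := J μ + T + 1 with hM
  have hM0 : 0 < M := by positivity
  obtain ⟨r, hr, hr0, hr1⟩ := (((tendsto_mul_rpow_mul (twistConst p * C) M (p + 1)
      ).eventually (gt_mem_nhds (half_pos hη))).and (Ioc_mem_nhdsGT (zero_lt_one' ℝ))).exists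
  have hrM : 0 < r * M / 3 := by positivity
  -- The same χ is a near maximizer with error rM for every ν strongly close to μ: the other two
  -- thirds of rM absorb the changes of J and of the integral of χ. The summand 1 in M leaves room
  -- for J(ν).
  obtain ⟨χ, hχ⟩ := hj.nonempty (r * M / 3) hrM
  have hJc : Continuous J := continuous_measureEnergy
  have hwc : Continuous fun ν : S.finiteEnergy ω => (ν : SignedRadon X) :=
    continuous_coe_finiteEnergy
  have hχc : Continuous fun ν : S.finiteEnergy ω => (ν : SignedRadon X) χ :=
    (WeakDual.eval_continuous (𝕜 := ℝ) (χ : C(X, ℝ))).comp hwc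
  filter_upwards [hJc.continuousAt.eventually (gt_mem_nhds (lt_add_of_pos_right (J μ) one_pos)),
    hJc.continuousAt.eventually (gt_mem_nhds (lt_add_of_pos_right (J μ) hrM)),
    hχc.continuousAt.eventually (gt_mem_nhds (lt_add_of_pos_right ((μ : SignedRadon X) χ) hrM))]
    with ν h1 h2 h3
  have e1 := hF μ M hM0 (by linarith) r hr0 hr1 χ (nearMax_mono (by linarith) hχ)
  have e2 := hF ν M hM0 (by linarith [show J ν + T ≤ M by linarith]) r hr0 hr1 χ ⟨hχ.1, by
    have : J μ - r * M / 3 ≤ S.energy ω χ - (μ : SignedRadon X) χ := hχ.2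
    change J ν - r * M ≤ _
    linarith⟩
  have e1' := abs_le.1 e1
  have e2' := abs_le.1 e2
  rw [Real.dist_eq, abs_lt]
  constructor <;> linarith [e1'.1, e1'.2, e2'.1, e2'.2]

/-- Any twisted energy has the twisted values. -/
lemma IsTwistedEnergy.eq_of_isTwistedValue (hω : S.IsPolarization ω)
    (ho : S.OrthogonalityProperty ω) {T C : ℝ} (hT : S.IsSubmeanBound ω T)
    {θ : Z} {F : S.finiteEnergy ω → ℝ} (hF : S.IsTwistedEnergy ω θ F) (μ : S.finiteEnergy ω)
    {L : ℝ} (hL : S.IsTwistedValue ω T C θ μ (S.measureEnergy ω μ).toReal L) : F μ = L := by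
  let _ := S.strongTopology ω
  have hj := hasEnergy_of_mem hω μ.2
  set j := (S.measureEnergy ω μ).toReal
  have hj0 := hj.bound.nonneg hω
  have hT0 := hT.nonneg hω.1
  have hu := tendsto_one_div_add_atTop_nhds_zero_nat (𝕜 := ℝ)
  choose χ hχ using fun k : ℕ => hj.nonempty (1 / ((k : ℝ) + 1)) (by positivity)
  -- F is prescribed on Monge–Ampère measures, and those of near maximizers converge strongly to μ.
  have h1 := (hF.1.tendsto _).comp (tendsto_MA hω ho hT μ.2.1 hj hu hχ)
  have h2 : Tendsto (fun k => S.nablaEnergy ω θ (χ k)) atTop (𝓝 (F μ)) :=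
    h1.congr fun k => hF.2 (χ k) (hχ k).1 _ rfl
  have h3 : Tendsto (fun k => S.nablaEnergy ω θ (χ k)) atTop (𝓝 L) := by
    refine Metric.tendsto_atTop'.2 fun η hη => ?_
    obtain ⟨r, hr, hr0, hr1⟩ := (((tendsto_mul_rpow_mul (twistConst p * C) (j + T + 1) (p + 1)
      ).eventually (gt_mem_nhds hη)).and (Ioc_mem_nhdsGT (zero_lt_one' ℝ))).exists
    obtain ⟨k₀, hk₀⟩ := eventually_atTop.1 (hu.eventually (gt_mem_nhds
      (show 0 < r * (j + T + 1) by positivity)))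
    refine ⟨k₀, fun k hk => ?_⟩
    rw [Real.dist_eq]
    exact (hL (j + T + 1) (by positivity) (by linarith) r hr0 hr1 (χ k)
      (nearMax_mono (hk₀ k hk.le).le (hχ k))).trans_lt hr
  exact tendsto_nhds_unique h2 h3

lemma exists_isTwistedEnergy (hω : S.IsPolarization ω)
    (ho : S.OrthogonalityProperty ω) {T C : ℝ} (hT : S.IsSubmeanBound ω T) {θ : Z} (hC : 0 < C)
    (hθ1 : θ ≤ C • ω) (hθ2 : -θ ≤ C • ω) : ∃ F, S.IsTwistedEnergy ω θ F ∧
      ∀ μ : S.finiteEnergy ω, S.IsTwistedValue ω T C θ μ (S.measureEnergy ω μ).toReal (F μ) := by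
  choose F hF using fun μ : S.finiteEnergy ω =>
    exists_isTwistedValue hω ho hT μ.2.1 (hasEnergy_of_mem hω μ.2) hC hθ1 hθ2
  refine ⟨F, ⟨continuous_of_isTwistedValue hω hT hF, fun φ hφ μ hμ => ?_⟩, hF⟩
  have h1 := hF μ
  have h2 := hasEnergy_of_mem hω μ.2
  rw [hμ] at h1 h2
  exact h1.eq_nablaEnergy hω hT hφ h2

/-- Existence and uniqueness of the twisted energy. -/
theorem existsUnique_isTwistedEnergy (hω : S.IsPolarization ω)
    (ho : S.OrthogonalityProperty ω) {T C : ℝ} (hT : S.IsSubmeanBound ω T) {θ : Z} (hC : 0 < C)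
    (hθ1 : θ ≤ C • ω) (hθ2 : -θ ≤ C • ω) : ∃! F, S.IsTwistedEnergy ω θ F := by
  obtain ⟨F, hF, hFv⟩ := exists_isTwistedEnergy hω ho hT hC hθ1 hθ2
  exact ⟨F, hF, fun G hG => funext fun μ => hG.eq_of_isTwistedValue hω ho hT μ (hFv μ)⟩

lemma isTwistedValue_twistedEnergy (hω : S.IsPolarization ω)
    (ho : S.OrthogonalityProperty ω) {T C : ℝ} (hT : S.IsSubmeanBound ω T) {θ : Z} (hC : 0 < C)
    (hθ1 : θ ≤ C • ω) (hθ2 : -θ ≤ C • ω) (μ : S.finiteEnergy ω) :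
    S.IsTwistedValue ω T C θ μ (S.measureEnergy ω μ).toReal (S.twistedEnergy ω θ μ) := by
  obtain ⟨F, hF, hFv⟩ := exists_isTwistedEnergy hω ho hT hC hθ1 hθ2
  have h : ∃ F, S.IsTwistedEnergy ω θ F := ⟨F, hF⟩
  have e : S.twistedEnergy ω θ = h.choose := by rw [twistedEnergy, dif_pos h]
  rw [e, h.choose_spec.eq_of_isTwistedValue hω ho hT μ (hFv μ)]
  exact hFv μ

end Setup

end

/-! ### Finiteness of the submean constants and rescaling -/

section

namespace Calculus

variable {X : Type*} [TopologicalSpace X]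
  {R : Type*} [CommRing R] [Algebra ℝ R] [Preorder R]
  {D : Submodule ℝ C(X, ℝ)} (K : Calculus D R)

lemma smul_add_d_smul (c : ℝ) (w : R) (φ : D) : c • w + K.d (c • φ) = c • (w + K.d φ) := by
  rw [map_smul, smul_add]

lemma E_smul_smul [IsOrderedAddMonoid R] [PosMulMono R] [MulPosMono R] [ZeroLEOneClass R]
    [PosSMulMono ℝ R] (p : ℕ) (c : ℝ) (w : R) (φ : D) :
    K.E p (c • w) (c • φ) = c ^ (p + 2) * K.E p w φ := by
  rw [E, E, smul_add_d_smul, hom_smul_smul, map_smul K.I, LinearMap.smul_apply,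
    Submodule.coe_smul, map_smul, smul_eq_mul, smul_eq_mul]
  ring

variable [IsOrderedAddMonoid R] [PosMulMono R] [MulPosMono R] [ZeroLEOneClass R] [PosSMulMono ℝ R]

/-- After monotonicity, the change from w₀ to w₀ + df is moved by parts onto the bounded function f,
and dφ is the difference of the positive forms w + dφ and w, which have equal mass against `hom`. -/
lemma I_pow_neg_le_of_le_add_d (p : ℕ) {w w₀ w' : R} (hw : 0 ≤ w) (hw₀ : 0 ≤ w₀) (hw' : 0 ≤ w')
    {f φ : D} (h : w' ≤ w₀ + K.d f) (hφ : 0 ≤ w + K.d φ) (h0 : (φ : C(X, ℝ)) ≤ 0) {c : ℝ}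
    (hf : ∀ x, |(f : C(X, ℝ)) x| ≤ c) :
    K.I (w' ^ (p + 1)) (-(φ : C(X, ℝ))) ≤ K.I (w₀ ^ (p + 1)) (-(φ : C(X, ℝ))) +
      2 * c * K.I (w * hom p (w₀ + K.d f) w₀) 1 := by
  set Q := hom p (w₀ + K.d f) w₀ with hQ
  have hQ0 : 0 ≤ Q := hom_nonneg p (hw'.trans h) hw₀
  have h1 := K.I_mono (pow_le_pow_left₀ hw' h (p + 1)) (neg_nonneg.2 h0)
  have h2 := K.pow_mul_d p w₀ f 0 (-(φ : C(X, ℝ)))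
  rw [sub_zero, map_zero, add_zero, map_neg (K.I (K.d f * _)), K.symm] at h2
  have h3 := abs_le.1 (K.abs_I_le (mul_nonneg hφ hQ0) hf)
  have h4 := abs_le.1 (K.abs_I_le (mul_nonneg hw hQ0) hf)
  simp only [add_mul, map_add, LinearMap.add_apply, I_mul_d_one, add_zero] at h3
  rw [← hQ] at h2
  linarith [h3.1, h4.2]

end Calculus

namespace Setup

open FormAlg

variable {p : ℕ} {X : Type*} [TopologicalSpace X] [CompactSpace X] [T2Space X]
  {Z : Type*} [AddCommGroup Z] [Module ℝ Z] [PartialOrder Z] [IsOrderedAddMonoid Z]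
  [PosSMulMono ℝ Z] {S : Setup (p + 1) X Z} {ω ω₁ : Z}

/-! ### Finiteness of the submean value constants -/

lemma refMeasure_mem_radonProb (hω : S.IsPolarization ω) : S.refMeasure ω ∈ radonProb X := by
  have h : S.refMeasure ω = S.MA ω 0 := by rw [refMeasure, MA, map_zero, add_zero]
  rw [h]
  exact MA_mem_radonProb hω (zero_mem_psh hω.1)

/-- To bound the submean value constant, it suffices to consider nonpositive functions attaining
the value zero. -/
lemma isSubmeanBound_of_forall_max (hω : S.IsPolarization ω) {T : ℝ}
    (h : ∀ φ ∈ S.psh ω, (φ : C(X, ℝ)) ≤ 0 → ∀ x, (φ : C(X, ℝ)) x = 0 →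
      S.refMeasure ω (-(φ : C(X, ℝ))) ≤ T) : S.IsSubmeanBound ω T := by
  intro φ hφ y
  have := S.nonempty_space
  obtain ⟨x, -, hx⟩ := isCompact_univ.exists_isMaxOn Set.univ_nonempty
    (φ : C(X, ℝ)).continuous.continuousOn
  have hxy (y : X) : (φ : C(X, ℝ)) y ≤ (φ : C(X, ℝ)) x := hx (Set.mem_univ y)
  have := h _ (psh_add_cst hφ (-(φ : C(X, ℝ)) x)) (fun y => by simpa using hxy y) x (by simp)
  rw [map_neg, apply_add_cst (refMeasure_one hω)] at this
  linarith [hxy y]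

/-- Positivity of [ω₀] gives aω ≤ ω₀ + ddᶜf with a > 0, so φ ↦ aφ + f maps ω-psh to ω₀-psh
functions, to which T_{ω₀} applies; the integrals against the two reference measures are compared by
`I_pow_neg_le_of_le_add_d`. -/
theorem SubmeanProperty.exists_isSubmeanBound (hS : S.SubmeanProperty) (hω : S.IsPolarization ω) :
    ∃ T, S.IsSubmeanBound ω T := by
  obtain ⟨ω₀, hω₀, hT₀⟩ := hS
  replace hT₀ := isSubmeanBound_toReal hT₀
  set T₀ := (S.submeanConst ω₀).toReal
  obtain ⟨a, ha, f, hf⟩ := hω₀.exists_nonneg (-ω)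
  have hle : a • ω ≤ ω₀ + S.ddc f := by
    rw [← sub_nonneg]; refine hf.trans_eq ?_; module
  set κ := ‖(f : C(X, ℝ))‖
  have hfκ (x : X) : |(f : C(X, ℝ)) x| ≤ κ := (f : C(X, ℝ)).norm_coe_le_norm x
  set K := S.calculus
  set B := 2 * κ * K.I (ι ω * hom p (ι ω₀ + K.d f) (ι ω₀)) 1
  refine ⟨(S.vol ω)⁻¹ * ((a ^ (p + 1))⁻¹ * (S.vol ω₀ * ((T₀ + 2 * κ) / a) + B)),
    isSubmeanBound_of_forall_max hω fun φ hφ h0 x hx => ?_⟩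
  have hψ : a • φ + f ∈ S.psh ω₀ := by
    change 0 ≤ ω₀ + S.ddc (a • φ + f)
    have h1 := smul_nonneg ha.le (show 0 ≤ ω + S.ddc φ from hφ)
    refine (add_nonneg h1 (sub_nonneg.2 hle)).trans_eq ?_
    rw [map_add, map_smul]; module
  have h1 := hT₀ _ hψ x
  have h2 := (abs_le.1 (abs_apply_le (refMeasure_mem_radonProb hω₀) (f : C(X, ℝ)))).2
  have h3 := (abs_le.1 (hfκ x)).1
  simp only [Submodule.coe_add, Submodule.coe_smul, map_add, map_smul, smul_eq_mul,
    ContinuousMap.add_apply, ContinuousMap.smul_apply, hx, mul_zero, zero_add] at h1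
  have h4 : S.refMeasure ω₀ (-(φ : C(X, ℝ))) ≤ (T₀ + 2 * κ) / a := by
    rw [le_div_iff₀ ha, map_neg]; linarith
  have hle' : a • ι ω ≤ ι ω₀ + K.d f := by
    rw [← map_smul, calculus_d, ← map_add]; exact ι_mono hle
  have h5 := K.I_pow_neg_le_of_le_add_d p (ι_pos hω) (ι_pos hω₀) (smul_nonneg ha.le (ι_pos hω))
    hle' (φ := φ) (by rw [calculus_d, ← map_add]; exact ι_nonneg hφ) h0 hfκ
  rw [smul_pow, map_smul, LinearMap.smul_apply, smul_eq_mul] at h5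
  have h6 (ω : Z) (hω : S.IsPolarization ω) (f : C(X, ℝ)) :
      K.I (ι ω ^ (p + 1)) f = S.vol ω * S.refMeasure ω f := by
    rw [refMeasure_eq_I hω, ncalc_I, ← mul_assoc, mul_inv_cancel₀ hω.vol_pos.ne', one_mul]
  rw [refMeasure_eq_I hω, ncalc_I]
  have hV := hω.vol_pos
  have hV₀ := hω₀.vol_pos
  gcongr
  rw [← div_eq_inv_mul, le_div_iff₀' (by positivity)]
  refine h5.trans ?_
  rw [h6 ω₀ hω₀]
  gcongr

/-! ### Rescaling of the form -/

lemma isOpen_preimage_finestTopology {V : Type*} [AddCommGroup V] [Module ℝ V] (T : V →ₗ[ℝ] V)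
    {A : Set V} (hA : IsOpen[finestTopology V] A) : IsOpen[finestTopology V] (T ⁻¹' A) := by
  simp only [isOpen_iSup_iff, isOpen_coinduced] at hA ⊢
  intro k L
  exact hA k (T.comp L)

lemma IsPolarization.smul (hω : S.IsPolarization ω) {c : ℝ} (hc : 0 < c) :
    S.IsPolarization (c • ω) := by
  refine ⟨smul_nonneg hc.le hω.1, ?_⟩
  obtain ⟨U, ⟨hU, hUs⟩, hωU⟩ := Set.mem_sUnion.1 hω.2
  refine Set.mem_sUnion.2 ⟨(c⁻¹ • LinearMap.id : S.HBC →ₗ[ℝ] S.HBC) ⁻¹' U,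
    ⟨isOpen_preimage_finestTopology _ hU, fun x hx => ?_⟩, ?_⟩
  · obtain ⟨θ, hθ, h⟩ := hUs hx
    refine ⟨c • θ, smul_nonneg hc.le hθ, ?_⟩
    change S.cls θ = c⁻¹ • x at h
    change c • S.cls θ = x
    rw [h, smul_smul, mul_inv_cancel₀ hc.ne', one_smul]
  · change c⁻¹ • (c • S.cls ω) ∈ U
    rwa [smul_smul, inv_mul_cancel₀ hc.ne', one_smul]

lemma vol_smul (c : ℝ) (ω : Z) : S.vol (c • ω) = c ^ (p + 1) * S.vol ω := by
  rw [vol_eq, vol_eq, map_smul, smul_pow, map_smul, LinearMap.smul_apply, smul_eq_mul]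

lemma ncalc_I_smul (hω : S.IsPolarization ω) {c : ℝ} (hc : 0 < c) (P : FormAlg Z) (f : C(X, ℝ)) :
    (ncalc (hω.smul hc)).I P f = (c ^ (p + 1))⁻¹ * (ncalc hω).I P f := by
  rw [ncalc_I, ncalc_I, vol_smul, mul_inv, mul_assoc]

lemma ncalc_E_smul (hω : S.IsPolarization ω) {c : ℝ} (hc : 0 < c) (φ : S.D) :
    (ncalc (hω.smul hc)).E p (ι (c • ω)) (c • φ) = c * (ncalc hω).E p (ι ω) φ := by
  have h := (ncalc hω).E_smul_smul p c (ι ω) φ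
  rw [map_smul]
  unfold Calculus.E at h ⊢
  rw [ncalc_I_smul hω hc, mul_left_comm]
  simp only [ncalc_d] at h ⊢
  rw [h]
  field_simp
  ring

/-- Homogeneity of the energy in the pair (ω, φ). It allows ω' to be replaced by e^d ω' ≥ ω in all
comparisons. -/
lemma energy_smul (hω : S.IsPolarization ω) {c : ℝ} (hc : 0 < c) (φ : S.D) :
    S.energy (c • ω) (c • φ) = c * S.energy ω φ := by
  rw [energy_eq_E (hω.smul hc), energy_eq_E hω, ncalc_E_smul hω hc]

lemma nablaEnergy_smul (hω : S.IsPolarization ω) {c : ℝ} (hc : 0 < c) (θ : Z) (φ : S.D) :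
    S.nablaEnergy (c • ω) θ (c • φ) = S.nablaEnergy ω θ φ := by
  rw [nablaEnergy_eq_nab (hω.smul hc), nablaEnergy_eq_nab hω, Calculus.nab, Calculus.nab,
    ncalc_E_smul hω hc, ncalc_I_smul hω hc, ncalc_I_smul hω hc, map_smul ι, ncalc_d,
    Calculus.smul_add_d_smul, Calculus.hom_smul_smul, smul_pow, mul_smul_comm, mul_smul_comm]
  simp only [map_smul, LinearMap.smul_apply, Submodule.coe_smul, smul_eq_mul, ncalc_d]
  field_simp
  ring

lemma smul_mem_psh_smul {c : ℝ} (hc : 0 ≤ c) {φ : S.D} (hφ : φ ∈ S.psh ω) :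
    c • φ ∈ S.psh (c • ω) := by
  change 0 ≤ c • ω + S.ddc (c • φ)
  rw [map_smul, ← smul_add]
  exact smul_nonneg hc hφ

lemma inv_smul_mem_psh {c : ℝ} (hc : 0 < c) {φ : S.D} (hφ : φ ∈ S.psh (c • ω)) :
    c⁻¹ • φ ∈ S.psh ω := by
  have := smul_mem_psh_smul (inv_nonneg.2 hc.le) hφ
  rwa [smul_smul, inv_mul_cancel₀ hc.ne', one_smul] at this

lemma energy_eq_mul_energy_inv_smul (hω : S.IsPolarization ω) {c : ℝ} (hc : 0 < c) (φ : S.D) :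
    S.energy (c • ω) φ = c * S.energy ω (c⁻¹ • φ) := by
  rw [← energy_smul hω hc, smul_smul, mul_inv_cancel₀ hc.ne', one_smul]

lemma refMeasure_smul (hω : S.IsPolarization ω) {c : ℝ} (hc : 0 < c) :
    S.refMeasure (c • ω) = S.refMeasure ω := by
  refine ContinuousLinearMap.ext fun f => ?_
  change S.refMeasure (c • ω) f = S.refMeasure ω f
  rw [refMeasure_eq_I (hω.smul hc), refMeasure_eq_I hω, ncalc_I_smul hω hc, map_smul ι, smul_pow,
    map_smul, LinearMap.smul_apply, smul_eq_mul]
  field_simp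

lemma IsSubmeanBound.smul {T : ℝ} (hT : S.IsSubmeanBound ω T) (hω : S.IsPolarization ω) {c : ℝ}
    (hc : 0 < c) : S.IsSubmeanBound (c • ω) (c * T) := by
  intro φ hφ x
  have h := mul_le_mul_of_nonneg_left (hT _ (inv_smul_mem_psh hc hφ) x) hc.le
  rw [refMeasure_smul hω hc]
  refine le_trans (le_of_eq ?_) h
  simp
  field_simp

lemma IsEnergyBound.smul {μ : SignedRadon X} {j : ℝ} (hj : S.IsEnergyBound ω μ j)
    (hω : S.IsPolarization ω) {c : ℝ} (hc : 0 < c) : S.IsEnergyBound (c • ω) μ (c * j) := by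
  intro φ hφ
  have h := mul_le_mul_of_nonneg_left (hj _ (inv_smul_mem_psh hc hφ)) hc.le
  rw [energy_eq_mul_energy_inv_smul hω hc]
  refine le_trans (le_of_eq ?_) h
  simp
  field_simp

lemma inv_smul_mem_nearMax (hω : S.IsPolarization ω) {μ : SignedRadon X} {j ε c : ℝ} (hc : 0 < c)
    {φ : S.D} (hφ : φ ∈ S.nearMax (c • ω) μ (c * j) (c * ε)) : c⁻¹ • φ ∈ S.nearMax ω μ j ε := by
  refine ⟨inv_smul_mem_psh hc hφ.1, le_of_mul_le_mul_left ?_ hc⟩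
  have h := hφ.2
  rw [energy_eq_mul_energy_inv_smul hω hc] at h
  rw [mul_sub]
  refine h.trans (le_of_eq ?_)
  simp
  field_simp

end Setup

end

/-! ### Variation of energies with the form -/

section

namespace Calculus

variable {X : Type*} [TopologicalSpace X]
  {R : Type*} [CommRing R] [Algebra ℝ R] [Preorder R]
  {D : Submodule ℝ C(X, ℝ)} (K : Calculus D R)
  [IsOrderedAddMonoid R] [PosMulMono R] [MulPosMono R] [ZeroLEOneClass R] [PosSMulMono ℝ R]

lemma mass_le_of_le_smul (p : ℕ) {w w₁ : R} {k : ℝ} (hw : 0 ≤ w) (h1 : w ≤ w₁)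
    (h2 : w₁ ≤ k • w) : K.I (w₁ ^ (p + 1)) 1 ≤ k ^ (p + 1) * K.I (w ^ (p + 1)) 1 := by
  have := K.I_mono (pow_le_pow_left₀ (hw.trans h1) h2 (p + 1)) zero_le_one'
  rwa [smul_pow, map_smul, LinearMap.smul_apply, smul_eq_mul] at this

/-- Variation of the derivative of the energy with the form `w`; here `u` is the ratio of the
volumes. -/
lemma abs_nab_sub_nab_le (p : ℕ) {w w₁ : R} {k g G u : ℝ} (hk : 1 ≤ k) (hk64 : k ≤ 64)
    (hg : k ^ (p + 1) - 1 ≤ g) (hG : k ^ (p + 1) ≤ G) (h64 : 64 ^ p ≤ G) (hG1 : 1 ≤ G)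
    (hu0 : 0 ≤ u) (hu1 : u ≤ 1)
    (hug : 1 - u ≤ g) (hw : 0 ≤ w) (hw1 : K.I (w ^ (p + 1)) 1 = 1) (h1 : w ≤ w₁)
    (h2 : w₁ ≤ k • w) {θ : R} {C : ℝ} (hC : 0 ≤ C)
    (hθ1 : θ ≤ C • w) (hθ2 : -θ ≤ C • w) {φ : D} (hφ : 0 ≤ w + K.d φ) (h0 : (φ : C(X, ℝ)) ≤ 0)
    {M : ℝ} (hM : -K.E p w φ ≤ M) :
    |(u * K.I (θ * hom p (w₁ + K.d φ) w₁) φ -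
        ((p : ℝ) + 1) * (u * K.I (θ * w₁ ^ p) 1) * (u * K.E p w₁ φ)) - K.nab p w θ φ| ≤
      6 * coerConst p * G ^ 2 * C * g * M := by
  have hE := K.E_nonpos p hw hφ h0
  have hM0 : 0 ≤ M := by linarith
  have hkg : k - 1 ≤ g := (sub_le_sub_right (le_self_pow₀ hk (Nat.succ_ne_zero p)) 1).trans hg
  have hg0 : 0 ≤ g := by linarith
  have hc := coerConst_ge_one p
  have hcp : (p : ℝ) + 2 ≤ coerConst p := by
    unfold coerConst
    have : (1 : ℝ) ≤ 2 ^ (p + 1) := one_le_pow₀ (by norm_num)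
    have h1 : (1 : ℝ) ≤ (p : ℝ) + 1 := by simp
    calc (p : ℝ) + 2 = 1 * (p + 2) * 1 := by ring
      _ ≤ _ := by gcongr
  -- the mixed integrals
  set A := K.I (θ * hom p (w + K.d φ) w) φ with hA
  set A₁ := K.I (θ * hom p (w₁ + K.d φ) w₁) φ with hA₁
  have a1 : |A| ≤ C * (coerConst p * M) :=
    (K.abs_I_hom_le p hw hC hθ1 hθ2 hφ h0).trans (by gcongr; linarith)
  have a2 : |A₁ - A| ≤ C * (g * (coerConst p * G * M)) := by
    -- As 1 ≤ k ≤ 64, this puts the increment in the form σ s with σ = (k - 1)/63 ≤ 1 and s = 63, so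
    -- that convexity in σ yields a bound linear in k - 1.
    have h3 : w₁ ≤ w + ((k - 1) / 63) • (63 : ℝ) • w := by
      refine h2.trans_eq ?_
      rw [smul_smul, div_mul_cancel₀ _ (by norm_num)]; module
    refine (K.abs_I_hom_sub_le p (by linarith) (by linarith) (by norm_num) hw h1 h3 hC hθ1 hθ2 hφ
      h0).trans ?_
    have e1 : (k - 1) / 63 ≤ g := by linarith
    rw [show (1 : ℝ) + 63 = 64 by norm_num]
    have hE' : 0 ≤ -K.E p w φ := neg_nonneg.2 hE
    calc _ ≤ C * (g * (((p : ℝ) + 1) * G * (2 ^ (p + 1) * (((p : ℝ) + 2) * M)))) := by gcongr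
      _ = _ := by unfold coerConst; ring
  -- the masses
  set m := K.I (θ * w ^ p) 1 with hm
  set m₁ := K.I (θ * w₁ ^ p) 1 with hm₁
  have b1 : |m| ≤ C := by
    have := K.abs_mass_le p hw hθ1 hθ2
    rwa [hw1, mul_one] at this
  have hpp : w ^ p ≤ w₁ ^ p := pow_le_pow_left₀ hw h1 p
  have b2 : |m₁ - m| ≤ C * g := by
    have e := K.abs_I_mul_le hθ1 hθ2 (sub_nonneg.2 hpp) zero_le_one'
    rw [mul_sub, map_sub, LinearMap.sub_apply] at e
    refine e.trans ?_
    gcongr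
    have h3 : w * w₁ ^ p ≤ w₁ ^ (p + 1) := by
      rw [pow_succ']; exact mul_le_mul_of_nonneg_right h1 (pow_nonneg (hw.trans h1) p)
    have h4 := K.I_mono h3 zero_le_one'
    have h5 := K.mass_le_of_le_smul p hw h1 h2
    rw [hw1] at h5
    rw [mul_sub, map_sub, LinearMap.sub_apply, ← pow_succ', hw1]
    linarith
  have b3 : |m₁| ≤ C * G := by
    have h3 := K.abs_I_mul_le hθ1 hθ2 (pow_nonneg (hw.trans h1) p) zero_le_one'
    refine h3.trans ?_
    gcongr
    have h3 : w * w₁ ^ p ≤ w₁ ^ (p + 1) := by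
      rw [pow_succ']; exact mul_le_mul_of_nonneg_right h1 (pow_nonneg (hw.trans h1) p)
    have h4 := K.I_mono h3 zero_le_one'
    have h5 := K.mass_le_of_le_smul p hw h1 h2
    rw [hw1] at h5
    linarith
  -- the energies
  set e := K.E p w φ with he
  set e₁ := K.E p w₁ φ with he₁
  have c1 : e₁ ≤ e := K.E_le_of_le p hw h1 hφ h0
  have c2 : k ^ (p + 1) * e ≤ e₁ := K.E_ge_of_le_smul p hk hw h1 h2 hφ h0
  have c3 : |e₁| ≤ G * M := by
    rw [abs_of_nonpos (by linarith)]
    have : k ^ (p + 1) * -e ≤ G * M := by gcongr; linarith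
    linarith
  have c4 : |e₁ - e| ≤ g * M := by
    rw [abs_of_nonpos (by linarith)]
    have : (k ^ (p + 1) - 1) * -e ≤ g * M :=
      mul_le_mul hg hM (by linarith) hg0
    linarith
  have d1 : |u * A₁ - A| ≤ C * (g * (coerConst p * G * M)) + g * (C * (coerConst p * M)) := by
    have : u * A₁ - A = u * (A₁ - A) + -((1 - u) * A) := by ring
    rw [this]
    refine (abs_add_le _ _).trans (add_le_add ?_ ?_)
    · rw [abs_mul, abs_of_nonneg hu0]
      exact (mul_le_of_le_one_left (abs_nonneg _) hu1).trans a2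
    · rw [abs_neg, abs_mul, abs_of_nonneg (sub_nonneg.2 hu1)]
      gcongr
  have d2 : |(u * m₁) * (u * e₁) - m * e| ≤
      2 * g * (C * G * (G * M)) + C * g * (G * M) + C * (g * M) := by
    have : (u * m₁) * (u * e₁) - m * e =
        -((1 - u) * (1 + u) * (m₁ * e₁)) + (m₁ - m) * e₁ + m * (e₁ - e) := by ring
    rw [this]
    refine (abs_add_le _ _).trans (add_le_add ((abs_add_le _ _).trans (add_le_add ?_ ?_)) ?_)
    · rw [abs_neg, abs_mul, abs_mul, abs_mul, abs_of_nonneg (sub_nonneg.2 hu1),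
        abs_of_nonneg (by linarith : 0 ≤ 1 + u)]
      calc (1 - u) * (1 + u) * (|m₁| * |e₁|) ≤ g * 2 * (C * G * (G * M)) := by
            gcongr; linarith
        _ = _ := by ring
    · rw [abs_mul]; gcongr
    · rw [abs_mul]; gcongr
  have e0 : (u * A₁ - ((p : ℝ) + 1) * (u * m₁) * (u * e₁)) - K.nab p w θ φ =
      (u * A₁ - A) - ((p : ℝ) + 1) * ((u * m₁) * (u * e₁) - m * e) := by
    rw [nab]; ring
  rw [e0]
  have hp1 : (0 : ℝ) ≤ (p : ℝ) + 1 := by positivity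
  have hcg : 0 ≤ C * g * M := by positivity
  have hG2 : G ≤ G ^ 2 := le_self_pow₀ hG1 two_ne_zero
  have hG3 : 1 ≤ G ^ 2 := one_le_pow₀ hG1
  calc _ ≤ |u * A₁ - A| + |((p : ℝ) + 1) * ((u * m₁) * (u * e₁) - m * e)| := abs_sub _ _
    _ ≤ (C * (g * (coerConst p * G * M)) + g * (C * (coerConst p * M))) +
        ((p : ℝ) + 1) * (2 * g * (C * G * (G * M)) + C * g * (G * M) + C * (g * M)) := by
      rw [abs_mul, abs_of_nonneg hp1]; gcongr
    _ = (coerConst p * (G + 1) + ((p : ℝ) + 1) * (2 * G ^ 2 + G + 1)) * (C * g * M) := by ring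
    _ ≤ (coerConst p * (G ^ 2 + G ^ 2) + coerConst p * (2 * G ^ 2 + G ^ 2 + G ^ 2)) *
        (C * g * M) := by
      gcongr; linarith
    _ = _ := by ring

end Calculus

namespace Setup

open FormAlg

variable {p : ℕ} {X : Type*} [TopologicalSpace X] [CompactSpace X] [T2Space X]
  {Z : Type*} [AddCommGroup Z] [Module ℝ Z] [PartialOrder Z] [IsOrderedAddMonoid Z]
  [PosSMulMono ℝ Z] {S : Setup (p + 1) X Z} {ω ω₁ : Z} {k : ℝ}

/-! ### Comparison of two polarizations -/

lemma ι_le_smul (h2 : ω₁ ≤ k • ω) : (ι ω₁ : FormAlg Z) ≤ k • ι ω := by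
  rw [← map_smul]; exact ι_mono h2

lemma psh_mono (h1 : ω ≤ ω₁) : S.psh ω ⊆ S.psh ω₁ := fun φ hφ => by
  change 0 ≤ ω₁ + S.ddc φ
  exact le_trans (show 0 ≤ ω + S.ddc φ from hφ) (by gcongr)

lemma vol_mono (hω : S.IsPolarization ω) (h1 : ω ≤ ω₁) : S.vol ω ≤ S.vol ω₁ := by
  rw [vol_eq, vol_eq]
  exact S.calculus.I_mono (pow_le_pow_left₀ (ι_pos hω) (ι_mono h1) _) Calculus.zero_le_one'

lemma vol_le_of_le_smul (hω : S.IsPolarization ω) (h1 : ω ≤ ω₁) (h2 : ω₁ ≤ k • ω) :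
    S.vol ω₁ ≤ k ^ (p + 1) * S.vol ω := by
  rw [vol_eq, vol_eq]
  exact S.calculus.mass_le_of_le_smul p (ι_pos hω) (ι_mono h1) (ι_le_smul h2)

lemma ncalc_I_eq_mul (hω : S.IsPolarization ω) (hω₁ : S.IsPolarization ω₁) (P : FormAlg Z)
    (f : C(X, ℝ)) :
    (ncalc hω₁).I P f = S.vol ω / S.vol ω₁ * (ncalc hω).I P f := by
  rw [ncalc_I, ncalc_I]
  have := hω.vol_pos.ne'
  field_simp

lemma ncalc_E_eq_mul (hω : S.IsPolarization ω) (hω₁ : S.IsPolarization ω₁) (φ : S.D) :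
    (ncalc hω₁).E p (ι ω₁) φ = S.vol ω / S.vol ω₁ * (ncalc hω).E p (ι ω₁) φ := by
  rw [Calculus.E, Calculus.E, ncalc_I_eq_mul hω hω₁, ncalc_d, ncalc_d]
  ring

lemma energy_ge_of_le_smul (hω : S.IsPolarization ω) (hω₁ : S.IsPolarization ω₁) (hk : 1 ≤ k)
    (h1 : ω ≤ ω₁) (h2 : ω₁ ≤ k • ω) {φ : S.D} (hφ : φ ∈ S.psh ω) (h0 : (φ : C(X, ℝ)) ≤ 0) :
    k ^ (p + 1) * S.energy ω φ ≤ S.energy ω₁ φ := by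
  rw [energy_eq_E hω, energy_eq_E hω₁, ncalc_E_eq_mul hω hω₁]
  have hφ' := nonneg_of_psh hω hφ
  have a1 := (ncalc hω).E_ge_of_le_smul p hk (ι_pos hω) (ι_mono h1) (ι_le_smul h2) hφ' h0
  have a2 := (ncalc hω).E_le_of_le p (ι_pos hω) (ι_mono h1) hφ' h0
  have a3 := (ncalc hω).E_nonpos p (ι_pos hω) hφ' h0
  have a4 := (div_le_one hω₁.vol_pos).2 (vol_mono hω h1)
  nlinarith

/-- Every ω-psh function is ω₁-psh, and the reference measures satisfy μ_ω ≤ k^{p+1} μ_{ω₁} by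
monotonicity of powers and the volume bound. -/
lemma IsSubmeanBound.of_le_smul {T : ℝ} (hT : S.IsSubmeanBound ω₁ T) (hω : S.IsPolarization ω)
    (hω₁ : S.IsPolarization ω₁) (hk : 1 ≤ k) (h1 : ω ≤ ω₁) (h2 : ω₁ ≤ k • ω) :
    S.IsSubmeanBound ω (k ^ (p + 1) * T) := by
  refine isSubmeanBound_of_forall_max hω fun φ hφ h0 x hx => ?_
  have a1 := hT φ (psh_mono h1 hφ) x
  rw [hx, zero_sub, ← map_neg, refMeasure_eq_I hω₁, ncalc_I_eq_mul hω hω₁] at a1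
  rw [refMeasure_eq_I hω]
  have a2 := (ncalc hω).I_mono (pow_le_pow_left₀ (ι_pos hω) (ι_mono h1) (p + 1)) (neg_nonneg.2 h0)
  have a3 := vol_le_of_le_smul hω h1 h2
  have hV := hω.vol_pos
  have hV₁ := hω₁.vol_pos
  have a5 : 0 ≤ (ncalc hω).I (ι ω₁ ^ (p + 1)) (-(φ : C(X, ℝ))) :=
    (ncalc hω).pos _ (pow_nonneg (ι_pos hω₁) _) _ (neg_nonneg.2 h0)
  refine a2.trans ?_
  have a6 : 1 ≤ k ^ (p + 1) * (S.vol ω / S.vol ω₁) := by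
    rw [← mul_div_assoc, one_le_div hV₁]; exact a3
  calc _ ≤ k ^ (p + 1) * (S.vol ω / S.vol ω₁) * (ncalc hω).I (ι ω₁ ^ (p + 1)) (-(φ : C(X, ℝ))) :=
        le_mul_of_one_le_left a5 a6
    _ ≤ _ := by rw [mul_assoc]; gcongr

/-- A rough comparison of the energies of a measure. -/
lemma IsEnergyBound.of_le_smul {μ : SignedRadon X} {T j : ℝ} (hj : S.IsEnergyBound ω₁ μ j)
    (hμ : μ ∈ radonProb X) (hT : S.IsSubmeanBound ω T) (hω : S.IsPolarization ω)
    (hω₁ : S.IsPolarization ω₁) (hk : 1 ≤ k) (h1 : ω ≤ ω₁) (h2 : ω₁ ≤ k • ω) :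
    S.IsEnergyBound ω μ (coerConst p * k ^ (p + 1) * (j + T)) := by
  intro ρ hρ
  obtain ⟨b, hb1, hb2, hb3⟩ := exists_normalize hω hT hρ
  have e : S.energy ω ρ - μ (ρ : C(X, ℝ)) =
      S.energy ω (ρ + S.cst b) - μ ((ρ + S.cst b : S.D) : C(X, ℝ)) := by
    rw [energy_add_cst hω, apply_add_cst hμ.2]; ring
  rw [e]
  set φ := ρ + S.cst b
  have hc := coerConst_ge_one p
  have hkp : 1 ≤ k ^ (p + 1) := one_le_pow₀ hk
  set c := coerConst p
  set Q := k ^ (p + 1)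
  have hcQ : 1 ≤ c * Q := one_le_mul_of_one_le_of_one_le hc hkp
  -- Testing with sφ makes the quadratic energy term, after division by s, equal to -E_ω(φ), which
  -- cancels.
  set s := (c * Q)⁻¹ with hs
  have hs0 : 0 < s := by positivity
  have hs1 : s ≤ 1 := inv_le_one_of_one_le₀ hcQ
  have hsφ := smul_mem_psh hω.1 hb1 hs0.le hs1
  have hsφ0 : ((s • φ : S.D) : C(X, ℝ)) ≤ 0 := by
    intro x
    have := hb2 x
    exact mul_nonpos_of_nonneg_of_nonpos hs0.le this
  have a1 := hj _ (psh_mono h1 hsφ)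
  have a2 := energy_ge_of_le_smul hω hω₁ hk h1 h2 hsφ hsφ0
  have a3 := (ncalc hω).neg_E_smul_le p (ι_pos hω) (nonneg_of_psh hω hb1) hb2 hs0.le hs1
  rw [Submodule.coe_smul, map_smul, smul_eq_mul] at a1
  rw [energy_eq_E hω] at a2 ⊢
  set e := (ncalc hω).E p (ι ω) φ
  have a4 : Q * -(ncalc hω).E p (ι ω) (s • φ) ≤ Q * (s * T + s ^ 2 * (c * -e)) := by
    gcongr
    refine a3.trans ?_
    gcongr
  have a5 : s * (-μ (φ : C(X, ℝ))) ≤ j + Q * (s * T + s ^ 2 * (c * -e)) := by linarith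
  have hsc : s * (c * Q) = 1 := inv_mul_cancel₀ (by positivity)
  have a6 : s * (-μ (φ : C(X, ℝ))) ≤ s * ((c * Q) * j + Q * T - e) := by
    exact a5.trans_eq (by linear_combination (-j - s * e) * hsc)
  have a7 := le_of_mul_le_mul_left a6 hs0
  have hT0 := hT.nonneg hω.1
  have : Q * T ≤ c * Q * T := by
    rw [mul_assoc]; exact le_mul_of_one_le_left (by positivity) hc
  linarith

/-- Comparison of the energies of a measure. -/
lemma HasEnergy.le_of_le_smul {μ : SignedRadon X} {T j j₁ : ℝ} (hj : S.HasEnergy ω μ j)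
    (hj₁ : S.IsEnergyBound ω₁ μ j₁)
    (hμ : μ ∈ radonProb X) (hT : S.IsSubmeanBound ω T) (hω : S.IsPolarization ω)
    (hω₁ : S.IsPolarization ω₁) (hk : 1 ≤ k) (h1 : ω ≤ ω₁) (h2 : ω₁ ≤ k • ω) :
    j ≤ j₁ + (k ^ (p + 1) - 1) * (T + coerConst p * j) := by
  have hc := coerConst_ge_one p
  have hkp : 1 ≤ k ^ (p + 1) := one_le_pow₀ hk
  refine le_of_forall_pos_le_add fun η hη => ?_
  -- A tolerance ε for χ produces a total error B ε, so ε = η / B is used.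
  set B := 1 + (k ^ (p + 1) - 1) * coerConst p with hB
  have hB0 : 0 < B := by nlinarith
  obtain ⟨χ, hχ⟩ := hj.nonempty (η / B) (by positivity)
  obtain ⟨b, hb1, hb2, hb3⟩ := exists_normalize hω hT hχ.1
  have hχ' := nearMax_add_cst hω hμ.2 hχ b
  have a1 := neg_energy_le hω hj.bound hχ' hb3
  have a2 := hj₁ _ (psh_mono h1 hb1)
  have a3 := energy_ge_of_le_smul hω hω₁ hk h1 h2 hb1 hb2
  have a4 := hχ'.2
  rw [← energy_eq_E hω] at a1
  have a5 := mul_le_mul_of_nonneg_left a1 (sub_nonneg.2 hkp)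
  have a6 : B * (η / B) = η := mul_div_cancel₀ _ hB0.ne'
  nlinarith

end Setup

end

/-! ### Comparison at bounded Thompson distance -/

section

section Forms

variable {Z : Type*} [AddCommGroup Z] [Module ℝ Z] [PartialOrder Z] [IsOrderedAddMonoid Z]
  [PosSMulMono ℝ Z] {ω ω' θ : Z}

lemma smul_le_smul_of_le (hω : 0 ≤ ω) {a b : ℝ} (h : a ≤ b) : a • ω ≤ b • ω := by
  rw [← sub_nonneg, ← sub_smul]; exact smul_nonneg (sub_nonneg.2 h) hω

/-- Working with strict upper bounds avoids deciding whether the infimum is attained; the sharp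
value is recovered by a limit in the main theorem. -/
lemma le_smul_of_formNorm_lt (hω : 0 ≤ ω) (h : IsBoundedBy ω θ) {A : ℝ}
    (hA : (formNorm ω θ).toReal < A) : θ ≤ A • ω ∧ -θ ≤ A • ω := by
  have hA0 : 0 ≤ A := ENNReal.toReal_nonneg.trans hA.le
  have h1 : formNorm ω θ < ENNReal.ofReal A := (ENNReal.lt_ofReal_iff_toReal_lt h.ne).2 hA
  obtain ⟨C, hC⟩ := iInf_lt_iff.1 h1
  obtain ⟨⟨hC1, hC2⟩, hC3⟩ := iInf_lt_iff.1 hC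
  have h2 : (C : ℝ) ≤ A := by
    rw [ENNReal.ofReal, ENNReal.coe_lt_coe] at hC3
    exact (Real.le_toNNReal_iff_coe_le hA0).1 hC3.le
  exact ⟨hC1.trans (smul_le_smul_of_le hω h2), hC2.trans (smul_le_smul_of_le hω h2)⟩

lemma isBoundedBy_of_le {A : ℝ} (hA : 0 ≤ A) (h1 : θ ≤ A • ω) (h2 : -θ ≤ A • ω) :
    IsBoundedBy ω θ :=
  (iInf₂_le (⟨A, hA⟩ : ℝ≥0) ⟨h1, h2⟩).trans_lt ENNReal.coe_lt_top

lemma le_exp_smul_of_thompsonDist_lt (hω : 0 ≤ ω) (hω' : 0 ≤ ω') (h : thompsonDist ω ω' < ⊤)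
    {d : ℝ} (hd : (thompsonDist ω ω').toReal < d) :
    ω ≤ Real.exp d • ω' ∧ ω' ≤ Real.exp d • ω := by
  have hd0 : 0 ≤ d := ENNReal.toReal_nonneg.trans hd.le
  have h1 : thompsonDist ω ω' < ENNReal.ofReal d := (ENNReal.lt_ofReal_iff_toReal_lt h.ne).2 hd
  obtain ⟨C, hC⟩ := iInf_lt_iff.1 h1
  obtain ⟨⟨hC1, hC2⟩, hC3⟩ := iInf_lt_iff.1 hC
  have h2 : Real.exp C ≤ Real.exp d := by
    rw [ENNReal.ofReal, ENNReal.coe_lt_coe] at hC3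
    exact Real.exp_le_exp.2 ((Real.le_toNNReal_iff_coe_le hd0).1 hC3.le)
  refine ⟨?_, hC2.trans (smul_le_smul_of_le hω h2)⟩
  have h3 := smul_le_smul_of_nonneg_left hC1 (Real.exp_nonneg C)
  rw [smul_smul, ← Real.exp_add, add_neg_cancel, Real.exp_zero, one_smul] at h3
  exact h3.trans (smul_le_smul_of_le hω' h2)

end Forms

/-- An upper bound of `exp (2 (p + 2) d)` for `0 ≤ d ≤ 2`. -/
def expConst (p : ℕ) : ℝ := 64 ^ (p + 2)

/-- A Lipschitz constant of `d ↦ exp (2 (p + 2) d)` on `[0, 2]`. -/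
def growthConst (p : ℕ) : ℝ := 2 * ((p : ℝ) + 2) * expConst p

lemma expConst_ge_one (p : ℕ) : 1 ≤ expConst p := one_le_pow₀ (by norm_num)

lemma growthConst_nonneg (p : ℕ) : 0 ≤ growthConst p := by
  have := expConst_ge_one p
  unfold growthConst; positivity

lemma exp_four_le : Real.exp 4 ≤ 64 := by
  have h1 := Real.exp_one_lt_d9
  have h2 : Real.exp 4 = Real.exp 1 ^ 4 := by rw [← Real.exp_nat_mul]; norm_num
  rw [h2]
  calc Real.exp 1 ^ 4 ≤ 2.72 ^ 4 := by gcongr; linarith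
    _ ≤ 64 := by norm_num

lemma exp_le_expConst (p : ℕ) {d : ℝ} (hd : d ≤ 2) :
    Real.exp (2 * ((p : ℝ) + 2) * d) ≤ expConst p := by
  have h : Real.exp (2 * ((p : ℝ) + 2) * d) = Real.exp (2 * d) ^ (p + 2) := by
    rw [← Real.exp_nat_mul]; congr 1; push_cast; ring
  rw [h, expConst]
  gcongr
  exact (Real.exp_le_exp.2 (by linarith)).trans exp_four_le

lemma exp_sub_one_le (p : ℕ) {d : ℝ} (hd0 : 0 ≤ d) (hd : d ≤ 2) :
    Real.exp (2 * ((p : ℝ) + 2) * d) - 1 ≤ growthConst p * d := by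
  set x := 2 * ((p : ℝ) + 2) * d with hx
  have hx0 : 0 ≤ x := by positivity
  have h1 := Real.add_one_le_exp (-x)
  have h2 : Real.exp x * Real.exp (-x) = 1 := by rw [← Real.exp_add, add_neg_cancel, Real.exp_zero]
  have h3 := Real.exp_pos x
  have h4 : Real.exp x - 1 ≤ x * Real.exp x := by nlinarith
  have h5 := exp_le_expConst p hd
  calc _ ≤ x * expConst p := h4.trans (by gcongr)
    _ = _ := by rw [hx, growthConst]; ring

lemma exp_pow_mul_le (p : ℕ) {d : ℝ} (hd0 : 0 ≤ d) :
    Real.exp (2 * d) ^ (p + 1) * Real.exp d ≤ Real.exp (2 * ((p : ℝ) + 2) * d) := by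
  rw [← Real.exp_nat_mul, ← Real.exp_add, Real.exp_le_exp]
  push_cast; linarith

lemma exp_pow_le (p : ℕ) {d : ℝ} (hd0 : 0 ≤ d) :
    Real.exp (2 * d) ^ (p + 1) ≤ Real.exp (2 * ((p : ℝ) + 2) * d) := by
  rw [← Real.exp_nat_mul, Real.exp_le_exp]
  push_cast; linarith

lemma exp_le_exp_mul (p : ℕ) {d : ℝ} (hd0 : 0 ≤ d) :
    Real.exp d ≤ Real.exp (2 * ((p : ℝ) + 2) * d) := by
  rw [Real.exp_le_exp]
  nlinarith [Nat.cast_nonneg (α := ℝ) p]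

/-- The constant of the Lipschitz estimate for the energy. -/
def energyConst (p : ℕ) : ℝ :=
  growthConst p * ((coerConst p + 1) * (1 + 2 * coerConst p * expConst p ^ 2))

namespace Setup

open FormAlg Filter

variable {p : ℕ} {X : Type*} [TopologicalSpace X] [CompactSpace X] [T2Space X]
  {Z : Type*} [AddCommGroup Z] [Module ℝ Z] [PartialOrder Z] [IsOrderedAddMonoid Z]
  [PosSMulMono ℝ Z] {S : Setup (p + 1) X Z} {ω ω' : Z} {d : ℝ}

/-! ### Comparison of polarizations at finite Thompson distance -/

lemma exp_smul_le (h2 : ω' ≤ Real.exp d • ω) : Real.exp d • ω' ≤ Real.exp (2 * d) • ω := by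
  have := smul_le_smul_of_nonneg_left h2 (Real.exp_nonneg d)
  rwa [smul_smul, ← Real.exp_add, ← two_mul] at this

lemma one_le_exp_two_mul (hd0 : 0 ≤ d) : 1 ≤ Real.exp (2 * d) := Real.one_le_exp (by positivity)

/-- The one-sided comparison applies to ω ≤ e^d ω' ≤ e^{2d} ω, with ratio k = e^{2d}; rescaling ω'
contributes the extra factor e^d. -/
lemma IsSubmeanBound.of_exp {T' : ℝ} (hT' : S.IsSubmeanBound ω' T') (hω : S.IsPolarization ω)
    (hω' : S.IsPolarization ω') (hd0 : 0 ≤ d) (h1 : ω ≤ Real.exp d • ω')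
    (h2 : ω' ≤ Real.exp d • ω) :
    S.IsSubmeanBound ω (Real.exp (2 * ((p : ℝ) + 2) * d) * T') := by
  have h := (hT'.smul hω' (Real.exp_pos d)).of_le_smul hω (hω'.smul (Real.exp_pos d))
    (one_le_exp_two_mul hd0) h1 (exp_smul_le h2)
  refine fun φ hφ x => (h φ hφ x).trans ?_
  rw [← mul_assoc]
  exact mul_le_mul_of_nonneg_right (exp_pow_mul_le p hd0) (hT'.nonneg hω'.1)

lemma IsEnergyBound.of_exp {μ : SignedRadon X} (hμ : μ ∈ radonProb X) {T j' : ℝ}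
    (hj' : S.IsEnergyBound ω' μ j') (hT : S.IsSubmeanBound ω T) (hω : S.IsPolarization ω)
    (hω' : S.IsPolarization ω') (hd0 : 0 ≤ d) (h1 : ω ≤ Real.exp d • ω')
    (h2 : ω' ≤ Real.exp d • ω) :
    S.IsEnergyBound ω μ (coerConst p * Real.exp (2 * ((p : ℝ) + 2) * d) * (j' + T)) := by
  have h := (hj'.smul hω' (Real.exp_pos d)).of_le_smul hμ hT hω (hω'.smul (Real.exp_pos d))
    (one_le_exp_two_mul hd0) h1 (exp_smul_le h2)
  refine fun φ hφ => (h φ hφ).trans ?_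
  have hc := coerConst_ge_one p
  have hj0 := hj'.nonneg hω'
  have hT0 := hT.nonneg hω.1
  have a1 := mul_le_mul_of_nonneg_right (exp_pow_mul_le p hd0) hj0
  have a2 := mul_le_mul_of_nonneg_right (exp_pow_le p hd0) hT0
  rw [mul_assoc, mul_assoc]
  exact mul_le_mul_of_nonneg_left (by linarith) (by linarith)

lemma HasEnergy.sub_le_of_exp {μ : SignedRadon X} (hμ : μ ∈ radonProb X) {T j j' : ℝ}
    (hj : S.HasEnergy ω μ j) (hj' : S.IsEnergyBound ω' μ j') (hT : S.IsSubmeanBound ω T)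
    (hω : S.IsPolarization ω) (hω' : S.IsPolarization ω') (hd0 : 0 ≤ d)
    (h1 : ω ≤ Real.exp d • ω') (h2 : ω' ≤ Real.exp d • ω) :
    j - j' ≤ (Real.exp (2 * ((p : ℝ) + 2) * d) - 1) * (j' + coerConst p * (j + T)) := by
  have h := hj.le_of_le_smul (hj'.smul hω' (Real.exp_pos d)) hμ hT hω
    (hω'.smul (Real.exp_pos d)) (one_le_exp_two_mul hd0) h1 (exp_smul_le h2)
  have hc := coerConst_ge_one p
  have hj0 := hj.bound.nonneg hω
  have hj0' := hj'.nonneg hω'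
  have hT0 := hT.nonneg hω.1
  have a1 := mul_le_mul_of_nonneg_right (exp_le_exp_mul p hd0) hj0'
  have a2 : (Real.exp (2 * d) ^ (p + 1) - 1) * (T + coerConst p * j) ≤
      (Real.exp (2 * ((p : ℝ) + 2) * d) - 1) * (coerConst p * (j + T)) := by
    have : T ≤ coerConst p * T := le_mul_of_one_le_left hT0 hc
    have e := exp_pow_le p hd0
    have e0 := one_le_pow₀ (one_le_exp_two_mul hd0) (n := p + 1)
    have e1 : (0:ℝ) ≤ Real.exp (2 * ((p : ℝ) + 2) * d) - 1 := by linarith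
    gcongr
    linarith
  linarith

/-- Up to constants, the energies of a measure with respect to nearby forms are comparable. -/
lemma HasEnergy.add_le_of_exp {μ : SignedRadon X} (hμ : μ ∈ radonProb X) {T T' j j' : ℝ}
    (hj : S.HasEnergy ω μ j) (hj' : S.IsEnergyBound ω' μ j') (hT : S.IsSubmeanBound ω T)
    (hTT' : T ≤ expConst p * T') (hT' : 0 ≤ T')
    (hω : S.IsPolarization ω) (hω' : S.IsPolarization ω') (hd0 : 0 ≤ d) (hd : d ≤ 2)
    (h1 : ω ≤ Real.exp d • ω') (h2 : ω' ≤ Real.exp d • ω) :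
    j + T ≤ 2 * coerConst p * expConst p ^ 2 * (j' + T') := by
  have hc := coerConst_ge_one p
  have hG := expConst_ge_one p
  have hb := hj'.of_exp hμ hT hω hω' hd0 h1 h2
  have hj0' := hj'.nonneg hω'
  have hT0 := hT.nonneg hω.1
  have hle : j ≤ coerConst p * expConst p * (j' + T) := by
    refine le_trans ?_ (mul_le_mul_of_nonneg_right (mul_le_mul_of_nonneg_left
      (exp_le_expConst p hd) (by linarith)) (by positivity) : coerConst p *
        Real.exp (2 * ((p : ℝ) + 2) * d) * (j' + T) ≤ _)
    refine le_of_forall_pos_le_add fun ε hε => ?_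
    obtain ⟨χ, hχ, h⟩ := hj.nonempty ε hε
    linarith [hb χ hχ]
  set c := coerConst p
  set G := expConst p
  have e1 : G ≤ c * G ^ 2 := by
    calc G ≤ G ^ 2 := le_self_pow₀ hG two_ne_zero
      _ ≤ _ := le_mul_of_one_le_left (by positivity) hc
  calc j + T ≤ c * G * (j' + G * T') + G * T' := by
        refine add_le_add (hle.trans ?_) hTT'
        gcongr
    _ = c * G * j' + (c * G ^ 2 + G) * T' := by ring
    _ ≤ 2 * c * G ^ 2 * j' + (c * G ^ 2 + c * G ^ 2) * T' := by
        have : c * G ≤ 2 * c * G ^ 2 := by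
          have : G ≤ G ^ 2 := le_self_pow₀ hG two_ne_zero
          nlinarith
        gcongr
    _ = _ := by ring

/-- Lipschitz dependence of the energy of a measure on the form. -/
lemma abs_energyPlus_sub_le {μ : SignedRadon X} (hμ : μ ∈ radonProb X) {T T' j j' : ℝ}
    (hj : S.HasEnergy ω μ j) (hj' : S.HasEnergy ω' μ j') (hT : S.IsSubmeanBound ω T)
    (hT' : S.IsSubmeanBound ω' T') (hω : S.IsPolarization ω) (hω' : S.IsPolarization ω')
    (hd0 : 0 ≤ d) (hd : d ≤ 2) (h1 : ω ≤ Real.exp d • ω') (h2 : ω' ≤ Real.exp d • ω)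
    (hTT' : T ≤ Real.exp (2 * ((p : ℝ) + 2) * d) * T')
    (hTT : T' ≤ Real.exp (2 * ((p : ℝ) + 2) * d) * T) :
    |(j + T) - (j' + T')| ≤ energyConst p * d * (j' + T') := by
  have hc := coerConst_ge_one p
  have hj0 := hj.bound.nonneg hω
  have hj0' := hj'.bound.nonneg hω'
  have hT0 := hT.nonneg hω.1
  have hT0' := hT'.nonneg hω'.1
  have hexp := exp_le_expConst p hd
  have a1 := hj.sub_le_of_exp hμ hj'.bound hT hω hω' hd0 h1 h2
  have a2 := hj'.sub_le_of_exp hμ hj.bound hT' hω' hω hd0 h2 h1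
  have a3 := hj.add_le_of_exp hμ hj'.bound hT
    (hTT'.trans (mul_le_mul_of_nonneg_right hexp hT0')) hT0' hω hω' hd0 hd h1 h2
  have a4 := exp_sub_one_le p hd0 hd
  have a5 : 0 ≤ Real.exp (2 * ((p : ℝ) + 2) * d) - 1 :=
    sub_nonneg.2 (Real.one_le_exp (by positivity))
  have hL := growthConst_nonneg p
  set g := Real.exp (2 * ((p : ℝ) + 2) * d) - 1 with hg
  set c := coerConst p
  have b1 : |(j + T) - (j' + T')| ≤ g * ((c + 1) * ((j' + T') + (j + T))) := by
    have e1 : T - T' ≤ g * T' := by rw [hg]; linarith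
    have e2 : T' - T ≤ g * T := by rw [hg]; linarith
    have n1 := mul_nonneg a5 hj0
    have n2 := mul_nonneg a5 hj0'
    have n3 := mul_nonneg a5 hT0
    have n4 := mul_nonneg a5 hT0'
    have c0 : 0 ≤ c := by linarith
    have m1 := mul_nonneg c0 n1
    have m2 := mul_nonneg c0 n2
    have m3 := mul_nonneg c0 n3
    have m4 := mul_nonneg c0 n4
    rw [abs_le]
    constructor <;> linarith
  calc _ ≤ _ := b1
    _ ≤ (growthConst p * d) * ((c + 1) * ((j' + T') +
        2 * c * expConst p ^ 2 * (j' + T'))) := by gcongr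
    _ = _ := by rw [energyConst]; ring

lemma nablaEnergy_sub_left (hω : S.IsPolarization ω) (θ θ' : Z) (φ : S.D) :
    S.nablaEnergy ω θ φ - S.nablaEnergy ω θ' φ = S.nablaEnergy ω (θ - θ') φ := by
  have h := (ncalc hω).nab_add_left p (ι ω) (ι (θ - θ')) (ι θ') φ
  rw [← map_add, sub_add_cancel] at h
  simp only [nablaEnergy_eq_nab hω]
  linarith

/-- Dependence of the derivative of the energy on the form. -/
lemma abs_nablaEnergy_sub_exp_le (hω : S.IsPolarization ω) (hω' : S.IsPolarization ω')
    (hd0 : 0 ≤ d) (hd : d ≤ 2) (h1 : ω ≤ Real.exp d • ω') (h2 : ω' ≤ Real.exp d • ω)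
    {θ : Z} {C : ℝ} (hC : 0 ≤ C) (hθ1 : θ ≤ C • ω) (hθ2 : -θ ≤ C • ω) {φ : S.D}
    (hφ : φ ∈ S.psh ω) (h0 : (φ : C(X, ℝ)) ≤ 0) {M : ℝ} (hM : -S.energy ω φ ≤ M) :
    |S.nablaEnergy (Real.exp d • ω') θ φ - S.nablaEnergy ω θ φ| ≤
      6 * coerConst p * expConst p ^ 2 * C * (growthConst p * d) * M := by
  set ω₁ := Real.exp d • ω' with hω₁'
  have hω₁ : S.IsPolarization ω₁ := hω'.smul (Real.exp_pos d)
  have hk := exp_smul_le h2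
  set k := Real.exp (2 * d) with hk'
  have hk1 : 1 ≤ k := one_le_exp_two_mul hd0
  have hkp := exp_pow_le p hd0
  have hg := exp_sub_one_le p hd0 hd
  have hG := exp_le_expConst p hd
  have hV := hω.vol_pos
  have hV₁ := hω₁.vol_pos
  have hvol := vol_le_of_le_smul hω h1 hk
  have hkp0 : 1 ≤ k ^ (p + 1) := one_le_pow₀ hk1
  have hu : 1 - S.vol ω / S.vol ω₁ ≤ k ^ (p + 1) - 1 := by
    have : (k ^ (p + 1))⁻¹ ≤ S.vol ω / S.vol ω₁ := by
      rw [le_div_iff₀ hV₁, inv_mul_le_iff₀ (by positivity)]; exact hvol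
    have h3 : k ^ (p + 1) * (k ^ (p + 1))⁻¹ = 1 := mul_inv_cancel₀ (by positivity)
    have h4 : 0 < (k ^ (p + 1))⁻¹ := by positivity
    nlinarith
  rw [energy_eq_E hω] at hM
  have := (ncalc hω).abs_nab_sub_nab_le p hk1
    ((Real.exp_le_exp.2 (by linarith)).trans exp_four_le) (g := growthConst p * d)
    (G := expConst p) (u := S.vol ω / S.vol ω₁) (by linarith) (by linarith)
    (pow_le_pow_right₀ (by norm_num) (by omega)) (expConst_ge_one p) (by positivity)
    ((div_le_one hV₁).2 (vol_mono hω h1)) (by linarith) (ι_pos hω) (ncalc_mass hω) (ι_mono h1)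
    (ι_le_smul hk) hC (ι_le_smul hθ1) (by rw [← map_neg]; exact ι_le_smul hθ2)
    (nonneg_of_psh hω hφ) h0 hM
  rw [nablaEnergy_eq_nab hω₁, nablaEnergy_eq_nab hω]
  refine le_trans (le_of_eq ?_) this
  rw [Calculus.nab, ncalc_I_eq_mul hω hω₁, ncalc_I_eq_mul hω hω₁, ncalc_E_eq_mul hω hω₁]
  simp only [ncalc_d]

end Setup

end

/-! ### Transfer of near maximizers between forms -/

section

/-- The constant measuring the failure of a near maximizer for one form to be one for a nearby
form. -/
def transferConst (p : ℕ) : ℝ :=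
  1 + 2 * coerConst p * expConst p ^ 2 + 2 * growthConst p *
    (2 * coerConst p + 1 + (coerConst p + 1) * (2 * coerConst p * expConst p ^ 2))

/-- The constant of the Hölder estimate for twisted energies. -/
def twistedConst (p : ℕ) : ℝ :=
  twistConst p + 2 * coerConst p * (2 * (p : ℝ) + 3) +
    24 * coerConst p ^ 2 * expConst p ^ 2 * growthConst p +
    twistConst p * expConst p * transferConst p

lemma energyConst_nonneg (p : ℕ) : 0 ≤ energyConst p := by
  have := coerConst_ge_one p
  have := growthConst_nonneg p
  unfold energyConst; positivity

lemma transferConst_ge (p : ℕ) :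
    1 + 2 * coerConst p * expConst p ^ 2 ≤ transferConst p := by
  have := coerConst_ge_one p
  have := growthConst_nonneg p
  have : 0 ≤ 2 * growthConst p *
    (2 * coerConst p + 1 + (coerConst p + 1) * (2 * coerConst p * expConst p ^ 2)) := by
    positivity
  unfold transferConst; linarith

namespace Setup

open FormAlg Filter

variable {p : ℕ} {X : Type*} [TopologicalSpace X] [CompactSpace X] [T2Space X]
  {Z : Type*} [AddCommGroup Z] [Module ℝ Z] [PartialOrder Z] [IsOrderedAddMonoid Z]
  [PosSMulMono ℝ Z] {S : Setup (p + 1) X Z} {ω ω' : Z} {d : ℝ}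

/-- A near maximizer for `ω` yields one for a nearby form `ω'`. -/
lemma exp_neg_smul_mem_nearMax {μ : SignedRadon X} (hμ : μ ∈ radonProb X) {T T' j j' M : ℝ}
    (hj : S.HasEnergy ω μ j) (hj' : S.HasEnergy ω' μ j') (hT : S.IsSubmeanBound ω T)
    (hT' : S.IsSubmeanBound ω' T') (hω : S.IsPolarization ω) (hω' : S.IsPolarization ω')
    (hd0 : 0 ≤ d) (hd : d ≤ 2) (h1 : ω ≤ Real.exp d • ω') (h2 : ω' ≤ Real.exp d • ω)
    (hM : j + T ≤ M) (hM' : j' + T' ≤ 2 * coerConst p * expConst p ^ 2 * M) {φ : S.D}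
    (hφ : φ ∈ S.nearMax ω μ j (d / 2 * M)) (h0 : (φ : C(X, ℝ)) ≤ 0)
    (hE : -S.energy ω φ ≤ 2 * coerConst p * M) :
    (Real.exp d)⁻¹ • φ ∈ S.nearMax ω' μ j' (d / 2 * (transferConst p * M)) := by
  have hc := coerConst_ge_one p
  have hL := growthConst_nonneg p
  have hj0 := hj.bound.nonneg hω
  have hj0' := hj'.bound.nonneg hω'
  have hT0 := hT.nonneg hω.1
  have hT0' := hT'.nonneg hω'.1
  have hM0 : 0 ≤ M := by linarith
  have hκ := transferConst_ge p
  have hκ0 : 0 ≤ transferConst p := le_trans (by positivity) hκ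
  have hω₁ := hω'.smul (Real.exp_pos d)
  have a1 := hj'.sub_le_of_exp hμ hj.bound hT' hω' hω hd0 h2 h1
  have a2 := energy_ge_of_le_smul hω hω₁ (one_le_exp_two_mul hd0) h1 (exp_smul_le h2) hφ.1 h0
  have a3 := hφ.2
  have a4 := exp_sub_one_le p hd0 hd
  have a5 := exp_pow_le p hd0
  have a6 := exp_le_exp_mul p hd0
  have a7 : 0 ≤ Real.exp (2 * ((p : ℝ) + 2) * d) - 1 :=
    sub_nonneg.2 (Real.one_le_exp (by positivity))
  have a8 : (1 : ℝ) ≤ Real.exp (2 * d) ^ (p + 1) := one_le_pow₀ (one_le_exp_two_mul hd0)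
  have a9 : 1 ≤ Real.exp d := Real.one_le_exp hd0
  set g := Real.exp (2 * ((p : ℝ) + 2) * d) - 1 with hg
  set c := coerConst p
  set G := expConst p
  have b1 : (Real.exp (2 * d) ^ (p + 1) - 1) * -S.energy ω φ ≤ g * (2 * c * M) :=
    mul_le_mul (by linarith) hE (by
      rw [energy_eq_E hω]
      exact neg_nonneg.2 ((ncalc hω).E_nonpos p (ι_pos hω) (nonneg_of_psh hω hφ.1) h0)) a7
  have b2 : (Real.exp d - 1) * j' ≤ g * j' := mul_le_mul_of_nonneg_right (by linarith) hj0'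
  have b3 : g * (j' + (j + c * (j' + T')) + 2 * c * M) ≤
      d / 2 * ((transferConst p - 1 - 2 * c * G ^ 2) * M) := by
    have e1 : j' + (j + c * (j' + T')) + 2 * c * M ≤
        (2 * c + 1 + (c + 1) * (2 * c * G ^ 2)) * M := by
      have e2 : (c + 1) * (j' + T') ≤ (c + 1) * (2 * c * G ^ 2 * M) := by gcongr
      linarith
    calc _ ≤ (growthConst p * d) * ((2 * c + 1 + (c + 1) * (2 * c * G ^ 2)) * M) :=
          mul_le_mul a4 e1 (by positivity) (by positivity)
      _ = _ := by unfold transferConst; ring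
  -- Near maximality is checked for φ itself and the form e^d ω'. The losses are the initial error,
  -- the change of E at φ, the change of J, and the factor e^d on j'.
  refine inv_smul_mem_nearMax hω' (Real.exp_pos d) ⟨psh_mono h1 hφ.1, ?_⟩
  have b4 : d / 2 * (transferConst p * M) ≤ Real.exp d * (d / 2 * (transferConst p * M)) :=
    le_mul_of_one_le_left (mul_nonneg (by positivity) (mul_nonneg hκ0 hM0)) a9
  have b5 : 0 ≤ d / 2 * (2 * c * G ^ 2 * M) := by positivity
  linarith

/-- Hölder dependence of the twisted energy on the forms. -/
lemma abs_twistedEnergy_sub_le {μ : SignedRadon X} (hμ : μ ∈ radonProb X) {T T' j j' M A B : ℝ}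
    (hj : S.HasEnergy ω μ j) (hj' : S.HasEnergy ω' μ j') (hT : S.IsSubmeanBound ω T)
    (hT' : S.IsSubmeanBound ω' T') (hω : S.IsPolarization ω) (hω' : S.IsPolarization ω')
    (hd0 : 0 < d) (hd : d ≤ 2) (h1 : ω ≤ Real.exp d • ω') (h2 : ω' ≤ Real.exp d • ω)
    (hM0 : 0 < M) (hM : j + T ≤ M) (hM' : j' + T' ≤ 2 * coerConst p * expConst p ^ 2 * M)
    {θ θ' : Z} (hA : 0 ≤ A) (hB : 0 ≤ B) (hA1 : θ ≤ A • ω) (hA2 : -θ ≤ A • ω)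
    (hB1 : θ - θ' ≤ B • ω) (hB2 : -(θ - θ') ≤ B • ω) {L L' : ℝ}
    (hL : S.IsTwistedValue ω T A θ μ j L)
    (hL' : S.IsTwistedValue ω' T' (expConst p * (A + B)) θ' μ j' L') :
    |L - L'| ≤ twistedConst p * (d ^ ((2 : ℝ)⁻¹ ^ (p + 1)) * A + B) * M := by
  have hc := coerConst_ge_one p
  have hLg := growthConst_nonneg p
  have hκ := transferConst_ge p
  have hκ0 : 0 ≤ transferConst p := le_trans (by positivity) hκ
  have hκ1 : 0 < transferConst p := lt_of_lt_of_le (by positivity) hκ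
  have hG := expConst_ge_one p
  have htw := twistConst_nonneg p
  have hj0 := hj.bound.nonneg hω
  have hT0 := hT.nonneg hω.1
  obtain ⟨χ, hχ⟩ := hj.nonempty (d / 2 * M) (by positivity)
  obtain ⟨b, hb1, hb2, hb3⟩ := exists_normalize hω hT hχ.1
  have hφ := nearMax_add_cst hω hμ.2 hχ b
  set φ := χ + S.cst b
  have hE : -S.energy ω φ ≤ 2 * coerConst p * M := by
    rw [energy_eq_E hω]
    refine (neg_energy_le hω hj.bound hφ hb3).trans ?_
    have e1 : d / 2 * M ≤ M := by nlinarith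
    calc T + coerConst p * (j + d / 2 * M) ≤ coerConst p * T + coerConst p * (j + M) := by
          gcongr; exact le_mul_of_one_le_left hT0 hc
      _ = coerConst p * (j + T + M) := by ring
      _ ≤ coerConst p * (M + M) := by gcongr
      _ = _ := by ring
  have hφ' := exp_neg_smul_mem_nearMax hμ hj hj' hT hT' hω hω' hd0.le hd h1 h2 hM hM' hφ hb2 hE
  have hr : d / 2 ≤ 1 := by linarith
  have hα0 : (0 : ℝ) < (2 : ℝ)⁻¹ ^ (p + 1) := by positivity
  have hα1 : (2 : ℝ)⁻¹ ^ (p + 1) ≤ 1 := pow_le_one₀ (by norm_num) (by norm_num)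
  have c1 := hL M hM0 hM (d / 2) (by positivity) hr φ hφ
  have hM'' : j' + T' ≤ transferConst p * M :=
    hM'.trans (mul_le_mul_of_nonneg_right (by linarith) hM0.le)
  have c2 := hL' (transferConst p * M) (mul_pos hκ1 hM0) hM'' (d / 2) (by positivity) hr _ hφ'
  have e2 := nablaEnergy_smul hω' (Real.exp_pos d) θ' ((Real.exp d)⁻¹ • φ)
  rw [smul_smul, mul_inv_cancel₀ (Real.exp_pos d).ne', one_smul] at e2
  rw [← e2] at c2
  have hθ1 : θ' ≤ (A + B) • ω := by
    have := add_le_add hA1 hB2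
    rw [← add_smul] at this
    refine le_trans (le_of_eq ?_) this; abel
  have hθ2 : -θ' ≤ (A + B) • ω := by
    have := add_le_add hA2 hB1
    rw [← add_smul] at this
    refine le_trans (le_of_eq ?_) this; abel
  have c3 := abs_nablaEnergy_sub_exp_le hω hω' hd0.le hd h1 h2 (add_nonneg hA hB) hθ1 hθ2 hb1 hb2 hE
  have c4 : |S.nablaEnergy ω θ φ - S.nablaEnergy ω θ' φ| ≤
      (2 * (p : ℝ) + 3) * B * (2 * coerConst p * M) := by
    rw [nablaEnergy_sub_left hω, nablaEnergy_eq_nab hω]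
    rw [energy_eq_E hω] at hE
    exact (ncalc hω).abs_nab_le p (ι_pos hω) (ncalc_mass hω) hB (ι_le_smul hB1)
      (by rw [← map_neg]; exact ι_le_smul hB2) (nonneg_of_psh hω hb1) hb2 hE
  set ρ := (d / 2) ^ ((2 : ℝ)⁻¹ ^ (p + 1)) with hρ
  have hρ0 : 0 ≤ ρ := by positivity
  have hρ1 : ρ ≤ 1 := Real.rpow_le_one (by positivity) hr hα0.le
  -- Errors linear in d are absorbed in the Hölder term because d/2 ≤ 1 and α ≤ 1.
  have hdρ : d ≤ 2 * ρ := by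
    have := Real.rpow_le_rpow_of_exponent_ge (by positivity : 0 < d / 2) hr hα1
    rw [Real.rpow_one] at this
    linarith
  have hρd : ρ ≤ d ^ ((2 : ℝ)⁻¹ ^ (p + 1)) :=
    Real.rpow_le_rpow (by positivity) (by linarith) hα0.le
  set c := coerConst p
  set G := expConst p
  set κ := transferConst p
  set t := twistConst p
  -- The chain is L, ∇_θE_ω(φ), ∇_{θ'}E_ω(φ), ∇_{θ'}E_{e^dω'}(φ) = ∇_{θ'}E_{ω'}(e^{-d}φ), L'.
  have d1 : |L - L'| ≤ t * A * ρ * M + (2 * (p : ℝ) + 3) * B * (2 * c * M) +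
      6 * c * G ^ 2 * (A + B) * (growthConst p * d) * (2 * c * M) +
      t * (G * (A + B)) * ρ * (κ * M) := by
    have c1' := abs_le.1 c1
    have c2' := abs_le.1 c2
    have c3' := abs_le.1 c3
    have c4' := abs_le.1 c4
    rw [abs_le]
    constructor <;> linarith [c1'.1, c1'.2, c2'.1, c2'.2, c3'.1, c3'.2, c4'.1, c4'.2]
  have d2 : (A + B) * ρ ≤ ρ * A + B := by nlinarith
  have d3 : ρ * A + B ≤ d ^ ((2 : ℝ)⁻¹ ^ (p + 1)) * A + B := by gcongr
  have d4 : A * ρ ≤ ρ * A + B := by linarith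
  have d5 : B ≤ ρ * A + B := by linarith [mul_nonneg hρ0 hA]
  set Y := ρ * A + B
  calc _ ≤ _ := d1
    _ ≤ t * A * ρ * M + (2 * (p : ℝ) + 3) * B * (2 * c * M) +
      6 * c * G ^ 2 * (A + B) * (growthConst p * (2 * ρ)) * (2 * c * M) +
      t * (G * (A + B)) * ρ * (κ * M) := by gcongr
    _ = (t * (A * ρ) + 2 * c * (2 * (p : ℝ) + 3) * B +
      24 * c ^ 2 * G ^ 2 * growthConst p * ((A + B) * ρ) +
      t * G * κ * ((A + B) * ρ)) * M := by ring
    _ ≤ (t * Y + 2 * c * (2 * (p : ℝ) + 3) * Y +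
      24 * c ^ 2 * G ^ 2 * growthConst p * Y + t * G * κ * Y) * M := by gcongr
    _ = twistedConst p * Y * M := by rw [twistedConst]; ring
    _ ≤ _ := by
      have : 0 ≤ twistedConst p := by unfold twistedConst; positivity
      gcongr

end Setup

end

/-! ### Assembly of the estimates -/

section

namespace Setup

open FormAlg Filter

variable {p : ℕ} {X : Type*} [TopologicalSpace X] [CompactSpace X] [T2Space X]
  {Z : Type*} [AddCommGroup Z] [Module ℝ Z] [PartialOrder Z] [IsOrderedAddMonoid Z]
  [PosSMulMono ℝ Z] {S : Setup (p + 1) X Z} {ω ω' : Z} {d : ℝ}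

theorem submeanConst_lt_top (hS : S.SubmeanProperty) (hω : S.IsPolarization ω) :
    S.submeanConst ω < ⊤ := by
  obtain ⟨T, hT⟩ := hS.exists_isSubmeanBound hω
  exact (submeanConst_le_iff.2 hT).trans_lt (EReal.coe_lt_top T)

lemma toReal_submeanConst_le (hS : S.SubmeanProperty) (hω : S.IsPolarization ω)
    (hω' : S.IsPolarization ω') (hd0 : 0 ≤ d) (h1 : ω ≤ Real.exp d • ω')
    (h2 : ω' ≤ Real.exp d • ω) : (S.submeanConst ω).toReal ≤
      Real.exp (2 * ((p : ℝ) + 2) * d) * (S.submeanConst ω').toReal :=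
  ((isSubmeanBound_toReal (submeanConst_lt_top hS hω')).of_exp hω hω' hd0 h1 h2).toReal_le hω.1

lemma finiteEnergy_subset (hS : S.SubmeanProperty) (hω : S.IsPolarization ω)
    (hω' : S.IsPolarization ω') (hd0 : 0 ≤ d) (h1 : ω ≤ Real.exp d • ω')
    (h2 : ω' ≤ Real.exp d • ω) : S.finiteEnergy ω' ⊆ S.finiteEnergy ω := fun μ hμ => by
  have h := (hasEnergy_of_mem hω' hμ).bound.of_exp hμ.1
    (isSubmeanBound_toReal (submeanConst_lt_top hS hω)) hω hω' hd0 h1 h2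
  exact ⟨hμ.1, (measureEnergy_le_iff.2 h).trans_lt (EReal.coe_lt_top _)⟩

/-- Polarizations at finite Thompson distance have the same measures of finite energy. -/
theorem finiteEnergy_eq (hS : S.SubmeanProperty) (hω : S.IsPolarization ω)
    (hω' : S.IsPolarization ω') (hd0 : 0 ≤ d) (h1 : ω ≤ Real.exp d • ω')
    (h2 : ω' ≤ Real.exp d • ω) : S.finiteEnergy ω = S.finiteEnergy ω' :=
  (finiteEnergy_subset hS hω' hω hd0 h2 h1).antisymm (finiteEnergy_subset hS hω hω' hd0 h1 h2)

theorem existsUnique_isTwistedEnergy_of_isBoundedBy (hS : S.SubmeanProperty)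
    (hω : S.IsPolarization ω) (ho : S.OrthogonalityProperty ω) {θ : Z} (hθ : IsBoundedBy ω θ) :
    ∃! F, S.IsTwistedEnergy ω θ F := by
  obtain ⟨h1, h2⟩ := le_smul_of_formNorm_lt hω.1 hθ (lt_add_one _)
  exact existsUnique_isTwistedEnergy hω ho (isSubmeanBound_toReal (submeanConst_lt_top hS hω))
    (add_pos_of_nonneg_of_pos ENNReal.toReal_nonneg one_pos) h1 h2

lemma isBoundedBy_of_exp (hω : 0 ≤ ω) {θ : Z} (hθ : IsBoundedBy ω θ)
    (h1 : ω ≤ Real.exp d • ω') : IsBoundedBy ω' θ := by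
  obtain ⟨h3, h4⟩ := le_smul_of_formNorm_lt hω hθ (lt_add_one _)
  have hA : 0 ≤ (formNorm ω θ).toReal + 1 := by positivity
  have h5 := smul_le_smul_of_nonneg_left h1 hA
  rw [smul_smul] at h5
  exact isBoundedBy_of_le (by positivity) (h3.trans h5) (h4.trans h5)

lemma isBoundedBy_sub {Z : Type*} [AddCommGroup Z] [Module ℝ Z] [PartialOrder Z]
    [IsOrderedAddMonoid Z] [PosSMulMono ℝ Z] {ω θ θ' : Z} (hω : 0 ≤ ω) (hθ : IsBoundedBy ω θ)
    (hθ' : IsBoundedBy ω θ') : IsBoundedBy ω (θ - θ') := by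
  obtain ⟨h1, h2⟩ := le_smul_of_formNorm_lt hω hθ (lt_add_one _)
  obtain ⟨h3, h4⟩ := le_smul_of_formNorm_lt hω hθ' (lt_add_one _)
  refine isBoundedBy_of_le (A := ((formNorm ω θ).toReal + 1) + ((formNorm ω θ').toReal + 1))
    (by positivity) ?_ ?_
  · rw [add_smul, sub_eq_add_neg]; exact add_le_add h1 h4
  · rw [add_smul, neg_sub, sub_eq_add_neg, add_comm]; exact add_le_add h2 h3

/-- Lipschitz estimate for `J⁺`, for forms at Thompson distance less than `d`. -/
lemma abs_energyPlus_sub_energyPlus_le (hS : S.SubmeanProperty) (hω : S.IsPolarization ω)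
    (hω' : S.IsPolarization ω') (hd0 : 0 ≤ d) (hd : d ≤ 2) (h1 : ω ≤ Real.exp d • ω')
    (h2 : ω' ≤ Real.exp d • ω) {μ : SignedRadon X} (hμ : μ ∈ S.finiteEnergy ω)
    (hμ' : μ ∈ S.finiteEnergy ω') :
    |S.energyPlus ω μ - S.energyPlus ω' μ| ≤ energyConst p * d * S.energyPlus ω' μ :=
  abs_energyPlus_sub_le hμ.1 (hasEnergy_of_mem hω hμ) (hasEnergy_of_mem hω' hμ')
    (isSubmeanBound_toReal (submeanConst_lt_top hS hω))
    (isSubmeanBound_toReal (submeanConst_lt_top hS hω')) hω hω' hd0 hd h1 h2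
    (toReal_submeanConst_le hS hω hω' hd0 h1 h2) (toReal_submeanConst_le hS hω' hω hd0 h2 h1)

lemma energyPlus_nonneg (hS : S.SubmeanProperty) (hω : S.IsPolarization ω) {μ : SignedRadon X}
    (hμ : μ ∈ S.finiteEnergy ω) : 0 ≤ S.energyPlus ω μ :=
  add_nonneg ((hasEnergy_of_mem hω hμ).bound.nonneg hω)
    ((isSubmeanBound_toReal (submeanConst_lt_top hS hω)).nonneg hω.1)

/-- Hölder estimate for the twisted energy, with constants larger than the distance and norms. -/
lemma abs_twistedEnergy_sub_twistedEnergy_le (hS : S.SubmeanProperty) (hω : S.IsPolarization ω)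
    (hω' : S.IsPolarization ω') (ho : S.OrthogonalityProperty ω)
    (ho' : S.OrthogonalityProperty ω') (hd0 : 0 < d) (hd : d ≤ 2) (h1 : ω ≤ Real.exp d • ω')
    (h2 : ω' ≤ Real.exp d • ω) {μ : SignedRadon X} (hμ : μ ∈ S.finiteEnergy ω)
    (hμ' : μ ∈ S.finiteEnergy ω') {θ θ' : Z} {A B M : ℝ} (hA : 0 < A) (hB : 0 < B)
    (hA1 : θ ≤ A • ω) (hA2 : -θ ≤ A • ω) (hB1 : θ - θ' ≤ B • ω) (hB2 : -(θ - θ') ≤ B • ω)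
    (hM : S.energyPlus ω μ < M) :
    |S.twistedEnergy ω θ ⟨μ, hμ⟩ - S.twistedEnergy ω' θ' ⟨μ, hμ'⟩| ≤
      twistedConst p * (d ^ ((2 : ℝ)⁻¹ ^ (p + 1)) * A + B) * M := by
  have hT := isSubmeanBound_toReal (submeanConst_lt_top hS hω)
  have hT' := isSubmeanBound_toReal (submeanConst_lt_top hS hω')
  have hj := hasEnergy_of_mem hω hμ
  have hj' := hasEnergy_of_mem hω' hμ'
  have hG := expConst_ge_one p
  have hc := coerConst_ge_one p
  have hexp := exp_le_expConst p hd
  have hdG : Real.exp d ≤ expConst p := (exp_le_exp_mul p hd0.le).trans hexp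
  have hM' := hj'.add_le_of_exp hμ.1 hj.bound hT'
    ((toReal_submeanConst_le hS hω' hω hd0.le h2 h1).trans
      (mul_le_mul_of_nonneg_right hexp (hT.nonneg hω.1))) (hT.nonneg hω.1) hω' hω hd0.le hd h2 h1
  have hωG : (A + B) • ω ≤ (expConst p * (A + B)) • ω' := by
    have := smul_le_smul_of_nonneg_left (h1.trans (smul_le_smul_of_le hω'.1 hdG))
      (add_nonneg hA.le hB.le)
    rwa [smul_smul, mul_comm] at this
  have hθ1 : θ' ≤ (A + B) • ω := by
    have := add_le_add hA1 hB2
    rw [← add_smul] at this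
    refine le_trans (le_of_eq ?_) this; abel
  have hθ2 : -θ' ≤ (A + B) • ω := by
    have := add_le_add hA2 hB1
    rw [← add_smul] at this
    refine le_trans (le_of_eq ?_) this; abel
  exact abs_twistedEnergy_sub_le hμ.1 hj hj' hT hT' hω hω' hd0 hd h1 h2
    ((energyPlus_nonneg hS hω hμ).trans_lt hM) hM.le
    (hM'.trans (by gcongr; exact hM.le)) hA.le hB.le hA1 hA2 hB1 hB2
    (isTwistedValue_twistedEnergy hω ho hT hA hA1 hA2 ⟨μ, hμ⟩)
    (isTwistedValue_twistedEnergy hω' ho' hT' (by positivity) (hθ1.trans hωG) (hθ2.trans hωG)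
      ⟨μ, hμ'⟩)

end Setup

end

end Pluripotential

end

theorem mainTheorem5 (n : ℕ) (hn : 1 ≤ n) :
    ∃ C : ℝ, 0 < C ∧
      ∀ (X : Type*) [TopologicalSpace X] [CompactSpace X] [T2Space X]
        (Z : Type*) [AddCommGroup Z] [Module ℝ Z] [PartialOrder Z] [IsOrderedAddMonoid Z]
        [PosSMulMono ℝ Z] (S : Pluripotential.Setup n X Z) (ω ω' : Z),
        S.SubmeanProperty →
        S.IsPolarization ω → S.IsPolarization ω' →
        S.OrthogonalityProperty ω → S.OrthogonalityProperty ω' →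
        Pluripotential.thompsonDist ω ω' ≤ 1 →
        ∀ θ θ' : Z, Pluripotential.IsBoundedBy ω θ → Pluripotential.IsBoundedBy ω θ' →
          -- the twisted energies and the constants `T_ω`, `T_ω'` are well defined
          (∃! F : S.finiteEnergy ω → ℝ, S.IsTwistedEnergy ω θ F) ∧
          (∃! F : S.finiteEnergy ω' → ℝ, S.IsTwistedEnergy ω' θ' F) ∧
          S.submeanConst ω < ⊤ ∧ S.submeanConst ω' < ⊤ ∧
          S.finiteEnergy ω = S.finiteEnergy ω' ∧
          -- the two estimates
          ∀ (μ : Pluripotential.SignedRadon X) (hμ : μ ∈ S.finiteEnergy ω)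
            (hμ' : μ ∈ S.finiteEnergy ω'),
            |S.twistedEnergy ω θ ⟨μ, hμ⟩ - S.twistedEnergy ω' θ' ⟨μ, hμ'⟩| ≤
              C * ((Pluripotential.thompsonDist ω ω').toReal ^ ((2 : ℝ)⁻¹ ^ n) *
                    (Pluripotential.formNorm ω θ).toReal +
                  (Pluripotential.formNorm ω (θ - θ')).toReal) * S.energyPlus ω μ ∧
            |S.energyPlus ω μ - S.energyPlus ω' μ| ≤
              C * (Pluripotential.thompsonDist ω ω').toReal ^ ((2 : ℝ)⁻¹ ^ n) *
                S.energyPlus ω' μ := by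
  obtain ⟨p, rfl⟩ := Nat.exists_eq_add_of_le' hn
  have hE := Pluripotential.energyConst_nonneg p
  have hK : 0 ≤ Pluripotential.twistedConst p := by
    have := Pluripotential.coerConst_ge_one p
    have := Pluripotential.growthConst_nonneg p
    have := Pluripotential.expConst_ge_one p
    have := Pluripotential.twistConst_nonneg p
    have : 0 ≤ Pluripotential.transferConst p := le_trans (by positivity)
      (Pluripotential.transferConst_ge p)
    unfold Pluripotential.twistedConst; positivity
  refine ⟨Pluripotential.twistedConst p + Pluripotential.energyConst p + 1, by positivity, ?_⟩
  intro X _ _ _ Z _ _ _ _ _ S ω ω' hS hω hω' ho ho' hδ θ θ' hθ hθ'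
  have hδt : Pluripotential.thompsonDist ω ω' < ⊤ := hδ.trans_lt ENNReal.one_lt_top
  set δ := (Pluripotential.thompsonDist ω ω').toReal with hδ'
  have hδ0 : 0 ≤ δ := ENNReal.toReal_nonneg
  have hδ1 : δ ≤ 1 := ENNReal.toReal_le_of_le_ofReal one_pos.le (by simpa using hδ)
  have hle {d : ℝ} (hd : δ < d) := Pluripotential.le_exp_smul_of_thompsonDist_lt hω.1 hω'.1 hδt hd
  have h1 := (hle (lt_add_one δ)).1
  have h2 := (hle (lt_add_one δ)).2
  have hα0 : (0 : ℝ) < (2 : ℝ)⁻¹ ^ (p + 1) := by positivity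
  have hα1 : (2 : ℝ)⁻¹ ^ (p + 1) ≤ 1 := pow_le_one₀ (by norm_num) (by norm_num)
  refine ⟨Pluripotential.Setup.existsUnique_isTwistedEnergy_of_isBoundedBy hS hω ho hθ,
    Pluripotential.Setup.existsUnique_isTwistedEnergy_of_isBoundedBy hS hω' ho'
      (Pluripotential.Setup.isBoundedBy_of_exp hω.1 hθ' h1),
        Pluripotential.Setup.submeanConst_lt_top hS hω,
    Pluripotential.Setup.submeanConst_lt_top hS hω',
      Pluripotential.Setup.finiteEnergy_eq hS hω hω' (by positivity) h1 h2, ?_⟩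
  intro μ hμ hμ'
  have hJ := Pluripotential.Setup.energyPlus_nonneg hS hω hμ
  have hJ' := Pluripotential.Setup.energyPlus_nonneg hS hω' hμ'
  constructor
  · have hθθ' := Pluripotential.Setup.isBoundedBy_sub hω.1 hθ hθ'
    set a := (Pluripotential.formNorm ω θ).toReal
    set b := (Pluripotential.formNorm ω (θ - θ')).toReal
    have ha : 0 ≤ a := ENNReal.toReal_nonneg
    have hb : 0 ≤ b := ENNReal.toReal_nonneg
    set J := S.energyPlus ω μ
    -- The estimate holds for all strict upper bounds of the distance, the norms and J⁺; letting η
    -- decrease to 0 gives the exact quantities, including zero distance or norm. The range η ≤ 1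
    -- keeps δ + η ≤ 2.
    have hlim : Filter.Tendsto (fun η : ℝ => Pluripotential.twistedConst p *
        ((δ + η) ^ ((2 : ℝ)⁻¹ ^ (p + 1)) * (a + η) + (b + η)) * (J + η)) (𝓝[>] 0)
        (𝓝 (Pluripotential.twistedConst p * ((δ + 0) ^ ((2 : ℝ)⁻¹ ^ (p + 1)) * (a + 0) + (b + 0)) *
          (J + 0))) := by
      refine Filter.Tendsto.mono_left (Continuous.tendsto ?_ 0) nhdsWithin_le_nhds
      have : Continuous fun η : ℝ => (δ + η) ^ ((2 : ℝ)⁻¹ ^ (p + 1)) :=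
        (Real.continuous_rpow_const hα0.le).comp (continuous_const.add continuous_id)
      fun_prop
    simp only [add_zero] at hlim
    refine (ge_of_tendsto hlim ?_).trans ?_
    · filter_upwards [Ioc_mem_nhdsGT (zero_lt_one' ℝ)] with η hη
      have hη0 := hη.1
      obtain ⟨e1, e2⟩ := hle (lt_add_of_pos_right δ hη0)
      obtain ⟨e3, e4⟩ := Pluripotential.le_smul_of_formNorm_lt hω.1 hθ (lt_add_of_pos_right a hη0)
      obtain ⟨e5, e6⟩ := Pluripotential.le_smul_of_formNorm_lt hω.1 hθθ' (lt_add_of_pos_right b hη0)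
      exact Pluripotential.Setup.abs_twistedEnergy_sub_twistedEnergy_le hS hω hω' ho ho'
        (by positivity)
        (by linarith [hη.2]) e1 e2 hμ hμ' (by positivity) (by positivity) e3 e4 e5 e6
        (lt_add_of_pos_right J hη0)
    · gcongr; linarith
  · have hlim : Filter.Tendsto
        (fun η : ℝ => Pluripotential.energyConst p * (δ + η) * S.energyPlus ω' μ) (𝓝[>] 0)
        (𝓝 (Pluripotential.energyConst p * (δ + 0) * S.energyPlus ω' μ)) := by
      refine Filter.Tendsto.mono_left (Continuous.tendsto ?_ 0) nhdsWithin_le_nhds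
      fun_prop
    rw [add_zero] at hlim
    refine (ge_of_tendsto hlim ?_).trans ?_
    · filter_upwards [Ioc_mem_nhdsGT (zero_lt_one' ℝ)] with η hη
      have hη0 := hη.1
      obtain ⟨e1, e2⟩ := hle (lt_add_of_pos_right δ hη0)
      exact Pluripotential.Setup.abs_energyPlus_sub_energyPlus_le hS hω hω' (by positivity)
        (by linarith [hη.2]) e1 e2 hμ hμ'
    -- The Lipschitz bound for J⁺ implies the Hölder bound since δ ≤ 1.
    · have : δ ≤ δ ^ ((2 : ℝ)⁻¹ ^ (p + 1)) := by
        rcases hδ0.eq_or_lt with h | h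
        · rw [← h, Real.zero_rpow hα0.ne']
        · simpa using Real.rpow_le_rpow_of_exponent_ge h hδ1 hα1
      gcongr; linarith
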